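/- Notation. Elements $\mathbf q\in\mathbb R^3$ are column vectors, elements $\mathbf p\in(\mathbb R^3)^*$ are row vectors, and $\times:\mathbb R^3\times\mathbb R^3\to(\mathbb R^3)^*$ is the vector product given by the standard volume form. Let $Q^5=\{(\mathbf q,\mathbf p)\in\mathbb R^3\times(\mathbb R^3)^*:\mathbf p\mathbf q=1\}$, with the rank 2 distribution $\mathcal D=\{d\mathbf p=\mathbf q\times d\mathbf q\}\subset TQ^5$. Let $M^4\subset\mathbb{RP}^2\times\mathbb{RP}^{2*}$ be the open set of non-incident pairs $([\mathbf q],[\mathbf p])$, $\mathbf p\mathbf q\neq0$, and let $\Pi:Q^5\to M^4$, $(\mathbf q,\mathbf p)\mapsto([\mathbf q],[\mathbf p])$. The group $\mathrm{SL}_3(\mathbb R)$ acts by $g\cdot(\mathbf q,\mathbf p)=(g\mathbf q,\mathbf pg^{-1})$ and $g\cdot([\mathbf q],[\mathbf p])=([g\mathbf q],[\mathbf pg^{-1}])$, and on tangent planes of $M^4$ through the differentials of $m\mapsto g\cdot m$. The dancing metric $\mathbf g$ is the pseudo-Riemannian metric on $M^4$ for which $\Pi$ is a pseudo-Riemannian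 submersion, where $Q^5$ carries the restriction of the flat metric $-2\,d\mathbf p\,d\mathbf q$ of $\mathbb R^3\times(\mathbb R^3)^*$. It has signature $(2,2)$. Orient $M^4$ so that a basis $(e_1,e_2,f^1,f^2)$ of $T_{(q,p)}M^4=T_q\mathbb{RP}^2\oplus T_p\mathbb{RP}^{2*}$ with $e_a\in T_q\mathbb{RP}^2$, $f^b\in T_p\mathbb{RP}^{2*}$ and $\mathbf g(e_a,f^b)=\delta_a^b$ is positive. To a 2-plane $W\subset T_mM^4$ is associated the 2-form $\beta=\theta_1\wedge\theta_2$, where $\theta_1,\theta_2$ is a basis of the annihilator of $W$; $\beta$ is unique up to a non-zero factor. The plane $W$ is null if $\mathbf g|_W=0$, and self-dual if $*\beta=\beta$ for the Hodge operator of $\mathbf g$ and the orientation; a null plane $W$ is principal if $\beta\wedge\mathcal W\beta=0$, where $\mathcal W$ is the Weyl tensor of $\mathbf g$ acting on 2-forms. The self-dual twistor space $\mathbb T^+M^4$ is the set of all self-dual null tangent 2-planes of $M^4$, a subset of the bundle $\mathrm{Gr}_2(TM^4)$ of tangent 2-planes from which it inherits its smooth structure, and $\mathbb T^+_*M^4\subset\mathbb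 T^+M^4$ is its subset of non-principal planes. The twistor distribution $\mathcal D^+$ is the rank 2 distribution on $\mathbb T^+M^4$ whose value at $W\subset T_mM^4$ is the horizontal lift of $W$ to the point $W$ by the Levi-Civita connection of $\mathbf g$. Theorem. For every $(\mathbf q,\mathbf p)\in Q^5$ the image $\nu(\mathbf q,\mathbf p):=\Pi_*\mathcal D_{(\mathbf q,\mathbf p)}\subset T_{(q,p)}M^4$, $(q,p)=\Pi(\mathbf q,\mathbf p)$, is 2-dimensional, and it is a null, self-dual and non-principal 2-plane. The resulting map $\nu:Q^5\to\mathbb T^+M^4$ is $\mathrm{SL}_3(\mathbb R)$-equivariant, it is a diffeomorphism of $Q^5$ onto $\mathbb T^+_*M^4$, and it maps $\mathcal D$ to $\mathcal D^+$: $\nu_*\mathcal D_u=\mathcal D^+_{\nu(u)}$ for all $u\in Q^5$. -/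

import Mathlib

open scoped Manifold ContDiff Matrix LinearAlgebra.Projectivization MatrixGroups

namespace Dancing

abbrev R2 : Type := Fin 2 → ℝ
abbrev R3 : Type := Fin 3 → ℝ
abbrev R4 : Type := Fin 4 → ℝ

/-! ### Derivatives of maps between manifolds

In Mathlib the tangent space of a manifold at `x` is, by definition, the model space: a tangent
vector is given by its components in the preferred chart `chartAt _ x`. `tangentDeriv f x` is the
differential `T_x X → T_(f x) Y`, with this identification of both tangent spaces. -/

/-- The differential of `f : X → Y` at `x`. -/
noncomputable def tangentDeriv {X Y : Type*} (E F : Type*) [NormedAddCommGroup E]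
    [NormedSpace ℝ E] [NormedAddCommGroup F] [NormedSpace ℝ F] [TopologicalSpace X] [ChartedSpace E X]
    [TopologicalSpace Y] [ChartedSpace F Y] (f : X → Y) (x : X) : E →L[ℝ] F :=
  mfderiv 𝓘(ℝ, E) 𝓘(ℝ, F) f x

/-- `f` is a diffeomorphism of the manifold `X` onto the subset `S` of the manifold `Y`, where `S`
carries the smooth structure induced from `Y`: `f` is smooth, it is a bijection onto `S`, and its
inverse `S → X` is locally the restriction of a smooth map defined on an open subset of `Y`. -/
def IsDiffeoOnto {E F X Y : Type*} [NormedAddCommGroup E] [NormedSpace ℝ E]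
    [NormedAddCommGroup F] [NormedSpace ℝ F] [TopologicalSpace X] [ChartedSpace E X]
    [TopologicalSpace Y] [ChartedSpace F Y] (f : X → Y) (S : Set Y) : Prop :=
  ContMDiff 𝓘(ℝ, E) 𝓘(ℝ, F) ∞ f ∧ Set.BijOn f Set.univ S ∧
    ∀ x, ∃ U : Set Y, IsOpen U ∧ f x ∈ U ∧ ∃ r : Y → X,
      ContMDiffOn 𝓘(ℝ, F) 𝓘(ℝ, E) ∞ r U ∧ ∀ x', f x' ∈ U → r (f x') = x'

/-! ### The quadric `Q⁵` -/

/-- `Q⁵ = {(𝐪, 𝐩) : 𝐩𝐪 = 1} ⊂ ℝ³ × (ℝ³)*`; row vectors `𝐩 ∈ (ℝ³)*` are given by their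
components. -/
@[ext]
structure Q5 where
  q : R3
  p : R3
  pairing : p ⬝ᵥ q = 1

theorem act_pairing (g : SL(3, ℝ)) (q p : R3) :
    (p ᵥ* (g⁻¹).1) ⬝ᵥ (g.1 *ᵥ q) = p ⬝ᵥ q := by
  rw [← Matrix.dotProduct_mulVec, Matrix.mulVec_mulVec, ← Matrix.SpecialLinearGroup.coe_mul]
  simp

namespace Q5

/-- The inclusion `Q⁵ ⊂ ℝ³ × (ℝ³)*`. -/
def incl (u : Q5) : R3 × R3 := (u.q, u.p)

/-- The subspace topology. -/
instance : TopologicalSpace Q5 := TopologicalSpace.induced incl inferInstance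

theorem isInducing_incl : Topology.IsInducing incl := ⟨rfl⟩
theorem continuous_incl : Continuous incl := isInducing_incl.continuous
theorem continuous_q : Continuous q := continuous_incl.fst
theorem continuous_p : Continuous p := continuous_incl.snd

/-- `g • (𝐪, 𝐩) = (g𝐪, 𝐩g⁻¹)`. -/
noncomputable instance : MulAction SL(3, ℝ) Q5 where
  smul g u := ⟨g.1 *ᵥ u.q, u.p ᵥ* (g⁻¹).1, (act_pairing g u.q u.p).trans u.pairing⟩
  one_smul u := by
    refine Q5.ext ?_ ?_
    · show (1 : SL(3, ℝ)).1 *ᵥ u.q = u.q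
      simp
    · show u.p ᵥ* ((1 : SL(3, ℝ))⁻¹).1 = u.p
      simp
  mul_smul g h u := by
    refine Q5.ext ?_ ?_
    · show (g * h).1 *ᵥ u.q = g.1 *ᵥ (h.1 *ᵥ u.q)
      simp [Matrix.mulVec_mulVec]
    · show u.p ᵥ* ((g * h)⁻¹).1 = (u.p ᵥ* (h⁻¹).1) ᵥ* (g⁻¹).1
      simp [Matrix.vecMul_vecMul]

theorem pairing_iff (i : Fin 3) (q p : R3) (hq : q i ≠ 0) :
    p ⬝ᵥ q = 1 ↔ p i = (1 - ∑ k, p (i.succAbove k) * q (i.succAbove k)) / q i := by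
  rw [dotProduct, Fin.sum_univ_succAbove _ i, eq_div_iff hq]
  constructor <;> intro h <;> linarith

/-- The covector with components `y.2` (without the `i`-th one) such that `𝐩𝐪 = 1`, `𝐪 = y.1`. -/
noncomputable def solve (i : Fin 3) (y : R3 × R2) : R3 :=
  i.insertNth ((1 - ∑ k, y.2 k * y.1 (i.succAbove k)) / y.1 i) y.2

theorem solve_pairing {i : Fin 3} {y : R3 × R2} (hy : y.1 i ≠ 0) : solve i y ⬝ᵥ y.1 = 1 := by
  rw [pairing_iff i _ _ hy]
  simp [solve]

theorem contDiffOn_solve (i : Fin 3) : ContDiffOn ℝ ∞ (solve i) {y | y.1 i ≠ 0} := by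
  refine contDiffOn_pi.2 fun j => ?_
  have h1 : ∀ k, ContDiff ℝ ∞ fun y : R3 × R2 => y.1 k := fun k => contDiff_pi.1 contDiff_fst k
  have h2 : ∀ k, ContDiff ℝ ∞ fun y : R3 × R2 => y.2 k := fun k => contDiff_pi.1 contDiff_snd k
  rcases Fin.eq_self_or_eq_succAbove i j with rfl | ⟨k, rfl⟩
  · simp only [solve, Fin.insertNth_apply_same]
    exact ((contDiff_const.sub (ContDiff.sum fun k _ => (h2 k).mul (h1 _))).contDiffOn).div
      (h1 j).contDiffOn (fun y hy => hy)
  · simp only [solve, Fin.insertNth_apply_succAbove]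
    exact (h2 k).contDiffOn

open Classical in
/-- The inverse of the chart on `qⁱ ≠ 0` (with an arbitrary value outside of its target). -/
noncomputable def param (i : Fin 3) (y : R3 × R2) : Q5 :=
  if h : y.1 i ≠ 0 then ⟨y.1, solve i y, solve_pairing h⟩
  else ⟨Pi.single 0 1, Pi.single 0 1, by simp⟩

theorem param_eq {i : Fin 3} {y : R3 × R2} (h : y.1 i ≠ 0) :
    param i y = ⟨y.1, solve i y, solve_pairing h⟩ := dif_pos h

/-- The chart of `Q⁵` on the open subset `qⁱ ≠ 0`: all coordinates of `(𝐪, 𝐩)` except `pᵢ`. -/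
noncomputable def chart (i : Fin 3) : OpenPartialHomeomorph Q5 (R3 × R2) where
  toFun u := (u.q, fun k => u.p (i.succAbove k))
  invFun := param i
  source := {u | u.q i ≠ 0}
  target := {y | y.1 i ≠ 0}
  map_source' u hu := hu
  map_target' y hy := by
    have hy' : y.1 i ≠ 0 := hy
    rw [param_eq hy']
    exact hy
  left_inv' u hu := by
    have hu' : u.q i ≠ 0 := hu
    rw [param_eq (y := (u.q, fun k => u.p (i.succAbove k))) hu']
    refine Q5.ext rfl ?_
    refine (Fin.eq_insertNth_iff.2 ⟨?_, rfl⟩).symm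
    exact (pairing_iff i _ _ hu').1 u.pairing
  right_inv' y hy := by
    have hy' : y.1 i ≠ 0 := hy
    rw [param_eq hy']
    refine Prod.ext rfl ?_
    funext k
    simp [solve]
  open_source := isOpen_ne_fun ((continuous_apply i).comp continuous_q) continuous_const
  open_target := isOpen_ne_fun ((continuous_apply i).comp continuous_fst) continuous_const
  continuousOn_toFun := (continuous_q.prodMk (continuous_pi fun k =>
    (continuous_apply _).comp continuous_p)).continuousOn
  continuousOn_invFun := by
    rw [isInducing_incl.continuousOn_iff]
    refine (continuousOn_fst.prodMk (contDiffOn_solve i).continuousOn).congr fun y hy => ?_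
    rw [Function.comp_apply, param_eq hy]
    rfl

theorem exists_ne_zero (u : Q5) : ∃ i, u.q i ≠ 0 := by
  by_contra! h
  have h1 := u.pairing
  rw [show u.q = 0 from funext h, dotProduct_zero] at h1
  exact zero_ne_one h1

noncomputable instance : ChartedSpace (R3 × R2) Q5 where
  atlas := Set.range chart
  chartAt u := chart u.exists_ne_zero.choose
  mem_chart_source u := u.exists_ne_zero.choose_spec
  chart_mem_atlas _ := ⟨_, rfl⟩

instance : IsManifold 𝓘(ℝ, R3 × R2) ∞ Q5 := by
  apply isManifold_of_contDiffOn
  rintro _ _ ⟨i, rfl⟩ ⟨j, rfl⟩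
  have h : ContDiffOn ℝ ∞ (fun y : R3 × R2 => (y.1, fun k => solve i y (j.succAbove k)))
      {y | y.1 i ≠ 0} :=
    contDiff_fst.contDiffOn.prodMk (contDiffOn_pi.2 fun k =>
      contDiffOn_pi.1 (contDiffOn_solve i) _)
  refine (h.mono ?_).congr ?_
  · intro y hy
    exact hy.1.1
  · intro y hy
    have hy' : y.1 i ≠ 0 := hy.1.1
    show ((param i y).q, fun k => (param i y).p (j.succAbove k)) = _
    rw [param_eq hy']

end Q5

/-! ### The space `M⁴` of non-incident point-line pairs -/

/-- `M⁴ ⊂ ℝP² × ℝP²*`, the pairs (point `q`, line `p`) with `𝐩𝐪 ≠ 0`. -/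
@[ext]
structure M4 where
  point : ℙ ℝ R3
  line : ℙ ℝ R3
  not_incident : ¬ Projectivization.orthogonal line point

namespace M4

theorem left_ne_zero {p q : R3} (h : p ⬝ᵥ q ≠ 0) : p ≠ 0 := by
  rintro rfl; simp at h

theorem right_ne_zero {p q : R3} (h : p ⬝ᵥ q ≠ 0) : q ≠ 0 := by
  rintro rfl; simp at h

/-- The pair `([𝐪], [𝐩])`. -/
noncomputable def ofHomog (q p : R3) (h : p ⬝ᵥ q ≠ 0) : M4 :=
  ⟨.mk ℝ q (right_ne_zero h), .mk ℝ p (left_ne_zero h), h⟩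

theorem exists_ofHomog (m : M4) : ∃ q p, ∃ h : p ⬝ᵥ q = 1, m = ofHomog q p (h ▸ one_ne_zero) := by
  obtain ⟨q, p, h⟩ := m
  induction q with | h q hq =>
  induction p with | h p hp =>
  have h' : p ⬝ᵥ q ≠ 0 := h
  refine ⟨q, (p ⬝ᵥ q)⁻¹ • p, by simp [h'], ?_⟩
  ext1
  · rfl
  · exact (Projectivization.mk_eq_mk_iff' ℝ _ _ _ _).2 ⟨p ⬝ᵥ q, by simp [smul_smul, h']⟩

theorem inv_mul_coe (g : SL(3, ℝ)) : (g⁻¹).1 * g.1 = 1 := by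
  rw [← Matrix.SpecialLinearGroup.coe_mul, inv_mul_cancel]; rfl

theorem injective_mulVec (g : SL(3, ℝ)) : Function.Injective g.1.mulVecLin := by
  intro v w h
  have h' : g.1 *ᵥ v = g.1 *ᵥ w := h
  have := congrArg ((g⁻¹).1 *ᵥ ·) h'
  simpa only [Matrix.mulVec_mulVec, inv_mul_coe, Matrix.one_mulVec] using this

theorem injective_vecMul (g : SL(3, ℝ)) : Function.Injective (g⁻¹).1.vecMulLinear := by
  intro v w h
  have h' : v ᵥ* (g⁻¹).1 = w ᵥ* (g⁻¹).1 := h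
  have := congrArg (· ᵥ* g.1) h'
  simpa only [Matrix.vecMul_vecMul, inv_mul_coe, Matrix.vecMul_one] using this

theorem not_incident_act (g : SL(3, ℝ)) {q p : ℙ ℝ R3}
    (h : ¬ Projectivization.orthogonal p q) :
    ¬ Projectivization.orthogonal (p.map (g⁻¹).1.vecMulLinear (injective_vecMul g))
      (q.map g.1.mulVecLin (injective_mulVec g)) := by
  induction q with | h q hq =>
  induction p with | h p hp =>
  rw [Projectivization.map_mk, Projectivization.map_mk, Projectivization.orthogonal_mk]
  rw [Projectivization.orthogonal_mk, ← act_pairing g] at h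
  exact h

/-- `g • ([𝐪], [𝐩]) = ([g𝐪], [𝐩g⁻¹])`. -/
noncomputable instance : SMul SL(3, ℝ) M4 where
  smul g m := ⟨m.point.map g.1.mulVecLin (injective_mulVec g),
    m.line.map (g⁻¹).1.vecMulLinear (injective_vecMul g), not_incident_act g m.not_incident⟩

theorem smul_ofHomog (g : SL(3, ℝ)) (q p : R3) (h : p ⬝ᵥ q ≠ 0) :
    g • ofHomog q p h = ofHomog (g.1 *ᵥ q) (p ᵥ* (g⁻¹).1) ((act_pairing g q p).symm ▸ h) := rfl

noncomputable instance : MulAction SL(3, ℝ) M4 where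
  one_smul m := by
    obtain ⟨q, p, h, rfl⟩ := m.exists_ofHomog
    rw [smul_ofHomog]
    congr 1 <;> simp
  mul_smul g g' m := by
    obtain ⟨q, p, h, rfl⟩ := m.exists_ofHomog
    simp only [smul_ofHomog]
    congr 1 <;> simp [Matrix.mulVec_mulVec, Matrix.vecMul_vecMul]

/-- The affine coordinates of `([𝐪], [𝐩])`. -/
noncomputable def coords (q p : R3) : R4 := ![q 0 / q 2, q 1 / q 2, p 0 / p 2, p 1 / p 2]

theorem coords_smul (q p : R3) {a b : ℝ} (ha : a ≠ 0) (hb : b ≠ 0) :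
    coords (a • q) (b • p) = coords q p := by
  simp [coords, mul_div_mul_left, ha, hb]

def homogPoint (x : R4) : R3 := ![x 0, x 1, 1]
def homogLine (x : R4) : R3 := ![x 2, x 3, 1]

noncomputable def base : M4 := ofHomog ![0, 0, 1] ![0, 0, 1] (by simp)

theorem rep_ofHomog (q p : R3) (h : p ⬝ᵥ q ≠ 0) : ∃ a b : ℝ, a ≠ 0 ∧ b ≠ 0 ∧
    (ofHomog q p h).point.rep = a • q ∧ (ofHomog q p h).line.rep = b • p := by
  obtain ⟨a, ha⟩ := Projectivization.exists_smul_eq_mk_rep ℝ q (right_ne_zero h)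
  obtain ⟨b, hb⟩ := Projectivization.exists_smul_eq_mk_rep ℝ p (left_ne_zero h)
  exact ⟨a, b, a.ne_zero, b.ne_zero, ha.symm, hb.symm⟩

theorem ofHomog_smul (q p : R3) {a b : ℝ} (_ : a ≠ 0) (_ : b ≠ 0) (h : p ⬝ᵥ q ≠ 0)
    (h' : (b • p) ⬝ᵥ (a • q) ≠ 0) : ofHomog (a • q) (b • p) h' = ofHomog q p h := by
  ext1
  · exact (Projectivization.mk_eq_mk_iff' ℝ _ _ _ _).2 ⟨a, rfl⟩
  · exact (Projectivization.mk_eq_mk_iff' ℝ _ _ _ _).2 ⟨b, rfl⟩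

open Classical in
/-- The affine coordinates on the open set `q³ ≠ 0`, `p₃ ≠ 0` (they do not depend on the choice of
the homogeneous coordinates). -/
noncomputable def chart₀ : PartialEquiv M4 R4 where
  toFun m := coords m.point.rep m.line.rep
  invFun x := if h : homogLine x ⬝ᵥ homogPoint x ≠ 0 then
    ofHomog (homogPoint x) (homogLine x) h else base
  source := {m | m.point.rep 2 ≠ 0 ∧ m.line.rep 2 ≠ 0}
  target := {x | homogLine x ⬝ᵥ homogPoint x ≠ 0}
  map_source' m hm := by
    obtain ⟨q, p, h, rfl⟩ := m.exists_ofHomog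
    obtain ⟨a, b, ha, hb, hq, hp⟩ := rep_ofHomog q p (h ▸ one_ne_zero)
    simp only [Set.mem_ofPred_eq, hq, hp] at hm ⊢
    rw [coords_smul q p ha hb]
    simp only [Pi.smul_apply, smul_eq_mul, ne_eq, mul_eq_zero, not_or] at hm
    obtain ⟨⟨-, hq2⟩, -, hp2⟩ := hm
    intro h0
    have : p ⬝ᵥ q = (p 2 * q 2) * (homogLine (coords q p) ⬝ᵥ homogPoint (coords q p)) := by
      simp only [coords, homogLine, homogPoint, dotProduct, Fin.sum_univ_three]
      simp
      field_simp
    rw [h, h0] at this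
    simp at this
  map_target' x hx := by
    have hx' : homogLine x ⬝ᵥ homogPoint x ≠ 0 := hx
    obtain ⟨a, b, ha, hb, hq, hp⟩ := rep_ofHomog _ _ hx'
    simp only [dif_pos hx', Set.mem_ofPred_eq, hq, hp]
    simp [homogLine, homogPoint, ha, hb]
  left_inv' m hm := by
    obtain ⟨q, p, h, rfl⟩ := m.exists_ofHomog
    obtain ⟨a, b, ha, hb, hq, hp⟩ := rep_ofHomog q p (h ▸ one_ne_zero)
    simp only [Set.mem_ofPred_eq, hq, hp] at hm ⊢
    simp only [Pi.smul_apply, smul_eq_mul, ne_eq, mul_eq_zero, not_or] at hm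
    obtain ⟨⟨-, hq2⟩, -, hp2⟩ := hm
    have h1 : homogPoint (coords q p) = (q 2)⁻¹ • q := by
      ext i; fin_cases i <;> simp [homogPoint, coords, hq2, div_eq_inv_mul]
    have h2 : homogLine (coords q p) = (p 2)⁻¹ • p := by
      ext i; fin_cases i <;> simp [homogLine, coords, hp2, div_eq_inv_mul]
    simp only [coords_smul q p ha hb, h1, h2]
    have h3 : ((p 2)⁻¹ • p) ⬝ᵥ ((q 2)⁻¹ • q) ≠ 0 := by simp [h, hq2, hp2]
    rw [dif_pos h3]
    exact ofHomog_smul q p (inv_ne_zero hq2) (inv_ne_zero hp2) _ _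
  right_inv' x hx := by
    have hx' : homogLine x ⬝ᵥ homogPoint x ≠ 0 := hx
    obtain ⟨a, b, ha, hb, hq, hp⟩ := rep_ofHomog _ _ hx'
    simp only [dif_pos hx', hq, hp]
    rw [coords_smul _ _ ha hb]
    ext i; fin_cases i <;> simp [homogLine, homogPoint, coords]

/-- Affine coordinates with respect to the unimodular basis of `ℝ³` formed by the columns of `g`. -/
noncomputable def chart (g : SL(3, ℝ)) : PartialEquiv M4 R4 :=
  (MulAction.toPerm g⁻¹ : M4 ≃ M4).toPartialEquiv.trans chart₀

theorem mem_source_ofHomog (q p : R3) (h : p ⬝ᵥ q ≠ 0) :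
    ofHomog q p h ∈ chart₀.source ↔ q 2 ≠ 0 ∧ p 2 ≠ 0 := by
  obtain ⟨a, b, ha, hb, hq, hp⟩ := rep_ofHomog q p h
  simp [chart₀, hq, hp, ha, hb]

theorem chart₀_ofHomog (q p : R3) (h : p ⬝ᵥ q ≠ 0) : chart₀ (ofHomog q p h) = coords q p := by
  obtain ⟨a, b, ha, hb, hq, hp⟩ := rep_ofHomog q p h
  show coords _ _ = _
  rw [hq, hp, coords_smul q p ha hb]

theorem chart₀_symm {x : R4} (h : homogLine x ⬝ᵥ homogPoint x ≠ 0) :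
    chart₀.symm x = ofHomog (homogPoint x) (homogLine x) h := dif_pos h

theorem smul_symm {g h : SL(3, ℝ)} {x : R4} (hx : homogLine x ⬝ᵥ homogPoint x ≠ 0) :
    h⁻¹ • (chart g).symm x = ofHomog ((h⁻¹ * g).1 *ᵥ homogPoint x)
      (homogLine x ᵥ* ((h⁻¹ * g)⁻¹).1) ((act_pairing _ _ _).symm ▸ hx) := by
  have h1 : (chart g).symm x = g • chart₀.symm x := by
    show (g⁻¹)⁻¹ • (chart₀.symm x : M4) = _
    rw [inv_inv]
  rw [h1, chart₀_symm hx, smul_smul, smul_ofHomog]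

theorem trans_source (g h : SL(3, ℝ)) : ((chart g).symm.trans (chart h)).source =
    {x | homogLine x ⬝ᵥ homogPoint x ≠ 0 ∧ ((h⁻¹ * g).1 *ᵥ homogPoint x) 2 ≠ 0 ∧
      (homogLine x ᵥ* ((h⁻¹ * g)⁻¹).1) 2 ≠ 0} := by
  ext x
  have hmem : ∀ m : M4, m ∈ (chart h).source ↔ h⁻¹ • m ∈ chart₀.source := fun m =>
    ⟨fun H => H.2, fun H => ⟨trivial, H⟩⟩
  have ht : x ∈ (chart g).target ↔ homogLine x ⬝ᵥ homogPoint x ≠ 0 :=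
    ⟨fun H => H.1, fun H => ⟨H, trivial⟩⟩
  rw [PartialEquiv.trans_source, Set.mem_inter_iff, PartialEquiv.symm_source, ht,
    Set.mem_preimage, hmem]
  constructor
  · rintro ⟨h1, h2⟩
    rw [smul_symm h1, mem_source_ofHomog] at h2
    exact ⟨h1, h2⟩
  · rintro ⟨h1, h2⟩
    refine ⟨h1, ?_⟩
    rw [smul_symm h1, mem_source_ofHomog]
    exact h2

theorem trans_apply {g h : SL(3, ℝ)} {x : R4} (hx : homogLine x ⬝ᵥ homogPoint x ≠ 0) :
    ((chart g).symm.trans (chart h)) x =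
      coords ((h⁻¹ * g).1 *ᵥ homogPoint x) (homogLine x ᵥ* ((h⁻¹ * g)⁻¹).1) := by
  show chart₀ (h⁻¹ • (chart g).symm x) = _
  rw [smul_symm hx, chart₀_ofHomog]

theorem contDiff_homogPoint : ContDiff ℝ ∞ homogPoint := by
  refine contDiff_pi.2 fun i => ?_
  fin_cases i
  · exact contDiff_apply ℝ ℝ (0 : Fin 4)
  · exact contDiff_apply ℝ ℝ (1 : Fin 4)
  · exact contDiff_const

theorem contDiff_homogLine : ContDiff ℝ ∞ homogLine := by
  refine contDiff_pi.2 fun i => ?_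
  fin_cases i
  · exact contDiff_apply ℝ ℝ (2 : Fin 4)
  · exact contDiff_apply ℝ ℝ (3 : Fin 4)
  · exact contDiff_const

theorem contDiff_mulVec (A : Matrix (Fin 3) (Fin 3) ℝ) (i : Fin 3) :
    ContDiff ℝ ∞ fun x : R4 => (A *ᵥ homogPoint x) i := by
  simp only [Matrix.mulVec, dotProduct]
  exact ContDiff.sum fun j _ => contDiff_const.mul (contDiff_pi.1 contDiff_homogPoint j)

theorem contDiff_vecMul (A : Matrix (Fin 3) (Fin 3) ℝ) (i : Fin 3) :
    ContDiff ℝ ∞ fun x : R4 => (homogLine x ᵥ* A) i := by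
  simp only [Matrix.vecMul, dotProduct]
  exact ContDiff.sum fun j _ => (contDiff_pi.1 contDiff_homogLine j).mul contDiff_const

theorem isOpen_trans_source (g h : SL(3, ℝ)) :
    IsOpen ((chart g).symm.trans (chart h)).source := by
  rw [trans_source]
  have h1 : Continuous fun x : R4 => homogLine x ⬝ᵥ homogPoint x :=
    contDiff_homogLine.continuous.dotProduct contDiff_homogPoint.continuous
  exact (isOpen_ne_fun h1 continuous_const).inter
    ((isOpen_ne_fun (contDiff_mulVec _ 2).continuous continuous_const).inter
      (isOpen_ne_fun (contDiff_vecMul _ 2).continuous continuous_const))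

theorem contDiffOn_trans (g h : SL(3, ℝ)) :
    ContDiffOn ℝ ∞ ((chart g).symm.trans (chart h)) ((chart g).symm.trans (chart h)).source := by
  rw [trans_source]
  refine ContDiffOn.congr ?_ (fun x hx => trans_apply hx.1)
  refine contDiffOn_pi.2 fun i => ?_
  have hq := fun i => (contDiff_mulVec (h⁻¹ * g).1 i).contDiffOn (s :=
    {x | homogLine x ⬝ᵥ homogPoint x ≠ 0 ∧ ((h⁻¹ * g).1 *ᵥ homogPoint x) 2 ≠ 0 ∧
      (homogLine x ᵥ* ((h⁻¹ * g)⁻¹).1) 2 ≠ 0})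
  have hp := fun i => (contDiff_vecMul ((h⁻¹ * g)⁻¹).1 i).contDiffOn (s :=
    {x | homogLine x ⬝ᵥ homogPoint x ≠ 0 ∧ ((h⁻¹ * g).1 *ᵥ homogPoint x) 2 ≠ 0 ∧
      (homogLine x ᵥ* ((h⁻¹ * g)⁻¹).1) 2 ≠ 0})
  fin_cases i
  · exact (hq 0).div (hq 2) fun x hx => hx.2.1
  · exact (hq 1).div (hq 2) fun x hx => hx.2.1
  · exact (hp 0).div (hp 2) fun x hx => hx.2.2
  · exact (hp 1).div (hp 2) fun x hx => hx.2.2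

theorem exists_cross {p : R3} (hp : p ≠ 0) : ∃ a b : R3, a ⨯₃ b = p := by
  by_cases h2 : p 2 = 0
  · by_cases h1 : p 1 = 0
    · have h0 : p 0 ≠ 0 := fun h0 => hp (by ext i; fin_cases i <;> simp [h0, h1, h2])
      refine ⟨![0, 1, 0], ![0, 0, p 0], ?_⟩
      ext i; fin_cases i <;> simp [cross_apply, h1, h2]
    · refine ⟨![0, 0, 1], ![p 1, - p 0, 0], ?_⟩
      ext i; fin_cases i <;> simp [cross_apply, h2]
  · refine ⟨![1, 0, - p 0 / p 2], ![0, p 2, - p 1], ?_⟩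
    ext i; fin_cases i <;> simp [cross_apply, h2]

theorem exists_smul_base (m : M4) : ∃ g : SL(3, ℝ), g • base = m := by
  obtain ⟨q, p, h, rfl⟩ := m.exists_ofHomog
  obtain ⟨a, b, hab⟩ := exists_cross (left_ne_zero (h ▸ one_ne_zero : p ⬝ᵥ q ≠ 0))
  subst hab
  have hdet : (!![a 0, b 0, q 0; a 1, b 1, q 1; a 2, b 2, q 2]).det = 1 := by
    rw [← h, Matrix.det_fin_three]
    simp [cross_apply, dotProduct, Fin.sum_univ_three]
    ring
  let g : SL(3, ℝ) := ⟨_, hdet⟩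
  have h1 : g.1 *ᵥ ![0, 0, 1] = q := by
    ext i; fin_cases i <;> simp [g, Matrix.mulVec, dotProduct, Fin.sum_univ_three]
  have h2 : (a ⨯₃ b) ᵥ* g.1 = ![0, 0, 1] := by
    ext i; fin_cases i
    · simp [g, Matrix.vecMul, dotProduct, Fin.sum_univ_three, cross_apply]; ring
    · simp [g, Matrix.vecMul, dotProduct, Fin.sum_univ_three, cross_apply]; ring
    · simp [dotProduct, Fin.sum_univ_three, cross_apply] at h
      simp [g, Matrix.vecMul, dotProduct, Fin.sum_univ_three, cross_apply]; linarith
  refine ⟨g, ?_⟩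
  unfold base
  rw [smul_ofHomog]
  congr 1
  rw [← h2, Matrix.vecMul_vecMul, ← Matrix.SpecialLinearGroup.coe_mul]
  simp

theorem mem_chart_source_of_smul {g : SL(3, ℝ)} {m : M4} (h : g • base = m) :
    m ∈ (chart g).source := by
  refine ⟨trivial, ?_⟩
  show g⁻¹ • m ∈ chart₀.source
  rw [← h, inv_smul_smul]
  exact (mem_source_ofHomog _ _ _).2 (by simp)

/-- The atlas of all affine charts, which defines the topology and the smooth structure of `M⁴` as an
open subset of `ℝP² × ℝP²*`. The preferred chart at `m` is the affine chart of a basis in which `m`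
has the coordinates zero. -/
noncomputable def core : ChartedSpaceCore R4 M4 where
  atlas := Set.range chart
  chartAt m := chart (exists_smul_base m).choose
  mem_chart_source m := mem_chart_source_of_smul (exists_smul_base m).choose_spec
  chart_mem_atlas m := ⟨_, rfl⟩
  open_source := by
    rintro _ _ ⟨g, rfl⟩ ⟨h, rfl⟩
    exact isOpen_trans_source g h
  continuousOn_toFun := by
    rintro _ _ ⟨g, rfl⟩ ⟨h, rfl⟩
    exact (contDiffOn_trans g h).continuousOn

noncomputable instance : TopologicalSpace M4 := core.toTopologicalSpace

noncomputable instance : ChartedSpace R4 M4 := core.toChartedSpace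

instance : IsManifold 𝓘(ℝ, R4) ∞ M4 := by
  apply isManifold_of_contDiffOn
  intro e e' he he'
  simp only [atlas, ChartedSpace.atlas, Set.mem_iUnion, Set.mem_singleton_iff] at he he'
  obtain ⟨_, ⟨g, rfl⟩, rfl⟩ := he
  obtain ⟨_, ⟨h, rfl⟩, rfl⟩ := he'
  have H := contDiffOn_trans g h
  simpa using! H

end M4

/-! ### The bundle of tangent 2-planes of a 4-manifold

The Grassmann bundle `Gr₂(TM) → M` with its standard smooth structure: a chart `i` of `M` and a
linear isomorphism `L : ℝ⁴ → ℝ² × ℝ²` give the chart which assigns to a plane `W ⊂ T_m M` the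
coordinates of `m` and the linear map `φ : ℝ² → ℝ²` such that `L(W)` is the graph of `φ`, where
`T_m M = ℝ⁴` through the coordinates of the chart `i`. -/

section Planes

/-- A 2-dimensional subspace `plane` of the tangent space of `M` at `pt`; tangent vectors are given by
their components in the preferred chart at `pt`. -/
structure TwoPlane (M : Type*) [TopologicalSpace M] [ChartedSpace R4 M] where
  pt : M
  plane : Submodule ℝ R4
  finrank_plane : Module.finrank ℝ plane = 2

theorem finrank_graph (φ : R2 →L[ℝ] R2) :
    Module.finrank ℝ (LinearMap.graph (φ : R2 →ₗ[ℝ] R2)) = 2 := by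
  rw [LinearMap.graph_eq_range_prod, LinearMap.finrank_range_of_inj]
  · simp
  · intro x y h
    exact congrArg Prod.fst h

theorem graph_injective {φ ψ : R2 →L[ℝ] R2}
    (h : LinearMap.graph (φ : R2 →ₗ[ℝ] R2) = LinearMap.graph (ψ : R2 →ₗ[ℝ] R2)) : φ = ψ := by
  ext1 a
  have : (a, φ a) ∈ LinearMap.graph (ψ : R2 →ₗ[ℝ] R2) := by
    rw [← h]; rfl
  exact this

theorem exists_frame (W : Submodule ℝ R4) (hW : Module.finrank ℝ W = 2) :
    ∃ L : R4 ≃L[ℝ] R2 × R2,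
      W.map (L : R4 →ₗ[ℝ] R2 × R2) = LinearMap.graph ((0 : R2 →L[ℝ] R2) : R2 →ₗ[ℝ] R2) := by
  obtain ⟨W', hW'⟩ := W.exists_isCompl
  have h4 : Module.finrank ℝ W + Module.finrank ℝ W' = 4 := by
    rw [Submodule.finrank_add_eq_of_isCompl hW']; simp
  let e₁ : W ≃ₗ[ℝ] R2 := LinearEquiv.ofFinrankEq _ _ (by simp [hW])
  let e₂ : W' ≃ₗ[ℝ] R2 := LinearEquiv.ofFinrankEq _ _ (by simp; omega)
  let e := (Submodule.prodEquivOfIsCompl W W' hW').symm.trans (e₁.prodCongr e₂)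
  refine ⟨e.toContinuousLinearEquiv, ?_⟩
  ext ⟨a, b⟩
  simp only [Submodule.mem_map, LinearMap.mem_graph_iff]
  constructor
  · rintro ⟨w, hw, h⟩
    have h2 : e w = (a, b) := h
    have h3 : (Submodule.prodEquivOfIsCompl W W' hW').symm w = (⟨w, hw⟩, 0) :=
      Submodule.prodEquivOfIsCompl_symm_apply_left W W' hW' ⟨w, hw⟩
    have : e w = (e₁ ⟨w, hw⟩, 0) := by
      simp [e, h3]
    rw [this] at h2
    simpa using (congrArg Prod.snd h2).symm
  · intro h
    have hb : b = 0 := h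
    refine ⟨e₁.symm a, (e₁.symm a).2, ?_⟩
    have h3 : (Submodule.prodEquivOfIsCompl W W' hW').symm (e₁.symm a) = (e₁.symm a, 0) :=
      Submodule.prodEquivOfIsCompl_symm_apply_left W W' hW' _
    show e (e₁.symm a) = (a, b)
    simp [e, h3, hb]

variable {M : Type*} [TopologicalSpace M] [ChartedSpace R4 M]

namespace TwoPlane

theorem ext' {p q : TwoPlane M} (h : p.pt = q.pt) (h' : p.plane = q.plane) : p = q := by
  obtain ⟨m, W, hW⟩ := p
  obtain ⟨m', W', hW'⟩ := q
  dsimp only at h h'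
  subst h h'
  rfl

theorem map_eq_self {V : Type*} [AddCommGroup V] [Module ℝ V] {f : V →ₗ[ℝ] V}
    (h : ∀ v, f v = v) (W : Submodule ℝ V) : W.map f = W := by
  have : f = LinearMap.id := LinearMap.ext h
  rw [this, Submodule.map_id]

/-- The isomorphism `L` which is used in the preferred chart at `p`; here `L(W) = ℝ² × 0`. -/
noncomputable def frameAt (p : TwoPlane M) : R4 ≃L[ℝ] R2 × R2 :=
  (exists_frame p.plane p.finrank_plane).choose

theorem map_frameAt (p : TwoPlane M) :
    Submodule.map (p.frameAt : R4 →ₗ[ℝ] R2 × R2) p.plane =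
      LinearMap.graph ((0 : R2 →L[ℝ] R2) : R2 →ₗ[ℝ] R2) :=
  (exists_frame p.plane p.finrank_plane).choose_spec

variable [IsManifold 𝓘(ℝ, R4) ∞ M]

/-- The change of the components of tangent vectors at `m` from the chart `i` to the chart `j`. -/
noncomputable def change (i j : atlas R4 M) (m : M) : R4 →L[ℝ] R4 :=
  (tangentBundleCore 𝓘(ℝ, R4) M).coordChange i j m

theorem change_comp {i j k : atlas R4 M} {m : M} (hi : m ∈ i.1.source) (hj : m ∈ j.1.source)
    (hk : m ∈ k.1.source) (v : R4) : change j k m (change i j m v) = change i k m v :=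
  (tangentBundleCore 𝓘(ℝ, R4) M).coordChange_comp i j k m ⟨⟨hi, hj⟩, hk⟩ v

theorem change_self {i : atlas R4 M} {m : M} (hi : m ∈ i.1.source) (v : R4) :
    change i i m v = v :=
  (tangentBundleCore 𝓘(ℝ, R4) M).coordChange_self i m hi v

theorem change_injective {i j : atlas R4 M} {m : M} (hi : m ∈ i.1.source) (hj : m ∈ j.1.source) :
    Function.Injective (change i j m) := by
  intro v w h
  have := congrArg (change j i m) h
  rwa [change_comp hi hj hi, change_comp hi hj hi, change_self hi, change_self hi] at this

/-- The plane `p`, with respect to the coordinates of the chart `i`. -/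
noncomputable def planeIn (i : atlas R4 M) (p : TwoPlane M) : Submodule ℝ R4 :=
  Submodule.map (change (achart R4 p.pt) i p.pt : R4 →ₗ[ℝ] R4) p.plane

theorem finrank_map {W : Submodule ℝ R4} (hW : Module.finrank ℝ W = 2) {f : R4 →L[ℝ] R4}
    (hf : Function.Injective f) : Module.finrank ℝ (W.map (f : R4 →ₗ[ℝ] R4)) = 2 := by
  rw [← hW]
  exact ((Submodule.equivMapOfInjective (f : R4 →ₗ[ℝ] R4) hf W).finrank_eq).symm

theorem finrank_graphIn (L : R4 ≃L[ℝ] R2 × R2) (φ : R2 →L[ℝ] R2) :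
    Module.finrank ℝ ((LinearMap.graph (φ : R2 →ₗ[ℝ] R2)).map
      (L.symm : R2 × R2 →ₗ[ℝ] R4)) = 2 := by
  exact (LinearEquiv.finrank_map_eq L.symm.toLinearEquiv _).trans (finrank_graph φ)

theorem planeIn_eq {i j : atlas R4 M} {p : TwoPlane M} (hi : p.pt ∈ i.1.source)
    (hj : p.pt ∈ j.1.source) :
    planeIn j p = (planeIn i p).map (change i j p.pt : R4 →ₗ[ℝ] R4) := by
  unfold planeIn
  rw [← Submodule.map_comp]
  congr 1
  refine LinearMap.ext fun v => ?_
  exact (change_comp (mem_chart_source R4 p.pt) hi hj _).symm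

theorem planeIn_achart (p : TwoPlane M) : planeIn (achart R4 p.pt) p = p.plane := by
  exact map_eq_self (change_self (mem_chart_source R4 p.pt)) _

open Classical in
/-- The inverse of the chart given by `i` and `L`. -/
noncomputable def param (i : atlas R4 M) (L : R4 ≃L[ℝ] R2 × R2) (y : R4 × (R2 →L[ℝ] R2)) :
    TwoPlane M :=
  if h : y.1 ∈ i.1.target then
    ⟨i.1.symm y.1,
      Submodule.map (change i (achart R4 (i.1.symm y.1)) (i.1.symm y.1) : R4 →ₗ[ℝ] R4)
        ((LinearMap.graph (y.2 : R2 →ₗ[ℝ] R2)).map (L.symm : R2 × R2 →ₗ[ℝ] R4)),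
      finrank_map (finrank_graphIn L y.2)
        (change_injective (i.1.map_target h) (mem_chart_source R4 _))⟩
  else
    ⟨i.1.symm y.1, (LinearMap.graph (y.2 : R2 →ₗ[ℝ] R2)).map (L.symm : R2 × R2 →ₗ[ℝ] R4),
      finrank_graphIn L y.2⟩

theorem param_pt (i : atlas R4 M) (L : R4 ≃L[ℝ] R2 × R2) (y : R4 × (R2 →L[ℝ] R2)) :
    (param i L y).pt = i.1.symm y.1 := by
  unfold param; split <;> rfl

theorem planeIn_param {i : atlas R4 M} (L : R4 ≃L[ℝ] R2 × R2) {y : R4 × (R2 →L[ℝ] R2)}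
    (h : y.1 ∈ i.1.target) :
    planeIn i (param i L y) =
      (LinearMap.graph (y.2 : R2 →ₗ[ℝ] R2)).map (L.symm : R2 × R2 →ₗ[ℝ] R4) := by
  have hm := i.1.map_target h
  unfold param planeIn
  rw [dif_pos h]
  dsimp only
  rw [← Submodule.map_comp]
  exact map_eq_self (fun v => (change_comp hm (mem_chart_source R4 _) hm v).trans
    (change_self hm v)) _

theorem map_planeIn_param {i : atlas R4 M} (L : R4 ≃L[ℝ] R2 × R2) {y : R4 × (R2 →L[ℝ] R2)}
    (h : y.1 ∈ i.1.target) :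
    (planeIn i (param i L y)).map (L : R4 →ₗ[ℝ] R2 × R2) =
      LinearMap.graph (y.2 : R2 →ₗ[ℝ] R2) := by
  rw [planeIn_param L h, ← Submodule.map_comp]
  exact map_eq_self L.apply_symm_apply _

open Classical in
/-- The linear map whose graph is the image by `L` of the plane `p` (zero if there is none). -/
noncomputable def slope (i : atlas R4 M) (L : R4 ≃L[ℝ] R2 × R2) (p : TwoPlane M) :
    R2 →L[ℝ] R2 :=
  if h : ∃ φ : R2 →L[ℝ] R2, (planeIn i p).map (L : R4 →ₗ[ℝ] R2 × R2) =
      LinearMap.graph (φ : R2 →ₗ[ℝ] R2) then h.choose else 0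

theorem slope_eq {i : atlas R4 M} {L : R4 ≃L[ℝ] R2 × R2} {p : TwoPlane M} {φ : R2 →L[ℝ] R2}
    (h : (planeIn i p).map (L : R4 →ₗ[ℝ] R2 × R2) = LinearMap.graph (φ : R2 →ₗ[ℝ] R2)) :
    slope i L p = φ := by
  have h' : ∃ φ : R2 →L[ℝ] R2, (planeIn i p).map (L : R4 →ₗ[ℝ] R2 × R2) =
      LinearMap.graph (φ : R2 →ₗ[ℝ] R2) := ⟨φ, h⟩
  unfold slope
  rw [dif_pos h']
  exact graph_injective (h'.choose_spec.symm.trans h)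

/-- The chart given by `i` and `L`. -/
noncomputable def chart (i : atlas R4 M) (L : R4 ≃L[ℝ] R2 × R2) :
    PartialEquiv (TwoPlane M) (R4 × (R2 →L[ℝ] R2)) where
  toFun p := (i.1 p.pt, slope i L p)
  invFun := param i L
  source := {p | p.pt ∈ i.1.source ∧ ∃ φ : R2 →L[ℝ] R2,
    (planeIn i p).map (L : R4 →ₗ[ℝ] R2 × R2) = LinearMap.graph (φ : R2 →ₗ[ℝ] R2)}
  target := {y | y.1 ∈ i.1.target}
  map_source' p hp := i.1.map_source hp.1
  map_target' y hy := by
    refine ⟨?_, y.2, map_planeIn_param L hy⟩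
    rw [param_pt]
    exact i.1.map_target hy
  left_inv' p hp := by
    obtain ⟨hp1, φ, hφ⟩ := hp
    have ht : (i.1 p.pt, slope i L p).1 ∈ i.1.target := i.1.map_source hp1
    have hpt : (param i L (i.1 p.pt, slope i L p)).pt = p.pt := by
      rw [param_pt]; exact i.1.left_inv hp1
    have h1 := planeIn_param L ht
    have h2 : planeIn i p = (LinearMap.graph (φ : R2 →ₗ[ℝ] R2)).map
        (L.symm : R2 × R2 →ₗ[ℝ] R4) := by
      rw [← hφ, ← Submodule.map_comp]
      symm
      exact map_eq_self L.symm_apply_apply _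
    rw [slope_eq hφ] at h1 hpt ht ⊢
    set q := param i L (i.1 p.pt, φ) with hq
    have h3 : planeIn i q = planeIn i p := h1.trans h2.symm
    refine ext' hpt ?_
    obtain ⟨m, W, hW⟩ := p
    obtain ⟨m', W', hW'⟩ := q
    dsimp only at hpt hp1
    subst hpt
    rw [← planeIn_achart ⟨m', W, hW⟩, ← planeIn_achart ⟨m', W', hW'⟩]
    dsimp only
    rw [planeIn_eq (i := i) hp1 (mem_chart_source R4 _),
      planeIn_eq (i := i) (p := ⟨m', W, hW⟩) hp1 (mem_chart_source R4 _), h3]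
  right_inv' y hy := by
    refine Prod.ext ?_ ?_
    · dsimp only
      rw [param_pt]
      exact i.1.right_inv hy
    · exact slope_eq (map_planeIn_param L hy)

/-- `a ↦ K(T(L⁻¹(a, φ a)))`, where `y = (x, φ)` and `T` is the change of components from the chart `i`
to the chart `j`. -/
noncomputable def blk (i j : atlas R4 M) (L K : R4 ≃L[ℝ] R2 × R2) (y : R4 × (R2 →L[ℝ] R2)) :
    R2 →L[ℝ] R2 × R2 :=
  ((K : R4 →L[ℝ] R2 × R2).comp (change i j (i.1.symm y.1))).comp
    ((L.symm : R2 × R2 →L[ℝ] R4).comp ((ContinuousLinearMap.id ℝ R2).prod y.2))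

theorem map_planeIn_param' {i j : atlas R4 M} (L K : R4 ≃L[ℝ] R2 × R2) {y : R4 × (R2 →L[ℝ] R2)}
    (h : y.1 ∈ i.1.target) (hj : i.1.symm y.1 ∈ j.1.source) :
    (planeIn j (param i L y)).map (K : R4 →ₗ[ℝ] R2 × R2) =
      LinearMap.range (blk i j L K y : R2 →ₗ[ℝ] R2 × R2) := by
  have hi := i.1.map_target h
  rw [← param_pt i L] at hi hj
  rw [planeIn_eq hi hj, planeIn_param L h, LinearMap.graph_eq_range_prod, ← LinearMap.range_comp,
    ← LinearMap.range_comp, ← LinearMap.range_comp, param_pt]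
  rfl

theorem blk_injective {i j : atlas R4 M} (L K : R4 ≃L[ℝ] R2 × R2) {y : R4 × (R2 →L[ℝ] R2)}
    (h : y.1 ∈ i.1.target) (hj : i.1.symm y.1 ∈ j.1.source) :
    Function.Injective (blk i j L K y) := by
  intro a b hab
  have h1 := L.symm.injective (change_injective (i.1.map_target h) hj (K.injective hab))
  exact congrArg Prod.fst h1

theorem range_eq_graph_iff {B : R2 →L[ℝ] R2 × R2} (hB : Function.Injective B)
    (φ : R2 →L[ℝ] R2) :
    LinearMap.range (B : R2 →ₗ[ℝ] R2 × R2) = LinearMap.graph (φ : R2 →ₗ[ℝ] R2) ↔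
      IsUnit ((ContinuousLinearMap.fst ℝ R2 R2).comp B) ∧
        φ = (ContinuousLinearMap.snd ℝ R2 R2).comp B *
          Ring.inverse ((ContinuousLinearMap.fst ℝ R2 R2).comp B) := by
  set P := (ContinuousLinearMap.fst ℝ R2 R2).comp B with hP
  set R := (ContinuousLinearMap.snd ℝ R2 R2).comp B with hR
  have hB' : ∀ a, B a = (P a, R a) := fun a => rfl
  constructor
  · intro h
    have hφ : ∀ a, R a = φ (P a) := by
      intro a
      have : B a ∈ LinearMap.graph (φ : R2 →ₗ[ℝ] R2) := by
        rw [← h]; exact ⟨a, rfl⟩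
      exact this
    have hinj : Function.Injective P := by
      intro a b hab
      apply hB
      rw [hB', hB', hφ, hφ, hab]
    have hu : IsUnit P := by
      have h1 : Function.Bijective (P : R2 →ₗ[ℝ] R2) :=
        ⟨hinj, LinearMap.injective_iff_surjective.1 hinj⟩
      let e := (LinearEquiv.ofBijective (P : R2 →ₗ[ℝ] R2) h1).toContinuousLinearEquiv
      have : P = ContinuousLinearEquiv.toUnit e := by ext1 a; rfl
      rw [this]; exact Units.isUnit _
    refine ⟨hu, ?_⟩
    have : R = φ * P := by ext1 a; exact hφ a
    rw [this, mul_assoc, Ring.mul_inverse_cancel _ hu, mul_one]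
  · rintro ⟨hu, rfl⟩
    ext ⟨a, b⟩
    rw [LinearMap.mem_graph_iff]
    constructor
    · rintro ⟨c, hc⟩
      have hc' : (P c, R c) = (a, b) := hc
      obtain ⟨h1, h2⟩ := Prod.mk.inj hc'
      have : (Ring.inverse P * P) c = c := by rw [Ring.inverse_mul_cancel _ hu]; rfl
      show b = R (Ring.inverse P a)
      rw [← h1, ← h2]
      exact congrArg R this.symm
    · intro h
      refine ⟨Ring.inverse P a, ?_⟩
      have : (P * Ring.inverse P) a = a := by rw [Ring.mul_inverse_cancel _ hu]; rfl
      have h' : b = R (Ring.inverse P a) := h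
      show (P (Ring.inverse P a), R (Ring.inverse P a)) = (a, b)
      rw [h']
      exact congrArg (fun t => (t, _)) this

theorem trans_source (i j : atlas R4 M) (L K : R4 ≃L[ℝ] R2 × R2) :
    ((chart i L).symm.trans (chart j K)).source =
      {y | y.1 ∈ (i.1.symm.trans j.1).source ∧
        IsUnit ((ContinuousLinearMap.fst ℝ R2 R2).comp (blk i j L K y))} := by
  ext y
  rw [PartialEquiv.trans_source, OpenPartialHomeomorph.trans_source]
  constructor
  · rintro ⟨hy, h1, φ, hφ⟩
    have hy' : y.1 ∈ i.1.target := hy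
    change (param i L y).pt ∈ j.1.source at h1
    rw [param_pt] at h1
    have h2 := map_planeIn_param' L K hy' h1
    exact ⟨⟨hy', h1⟩, ((range_eq_graph_iff (blk_injective L K hy' h1) φ).1 (h2.symm.trans hφ)).1⟩
  · rintro ⟨⟨hy, h1⟩, hu⟩
    have hy' : y.1 ∈ i.1.target := hy
    have h1' : i.1.symm y.1 ∈ j.1.source := h1
    refine ⟨hy, ?_, _, (map_planeIn_param' L K hy' h1').trans
      ((range_eq_graph_iff (blk_injective L K hy' h1') _).2 ⟨hu, rfl⟩)⟩
    change (param i L y).pt ∈ j.1.source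
    rw [param_pt]; exact h1'

theorem trans_apply {i j : atlas R4 M} {L K : R4 ≃L[ℝ] R2 × R2} {y : R4 × (R2 →L[ℝ] R2)}
    (hy : y ∈ ((chart i L).symm.trans (chart j K)).source) :
    ((chart i L).symm.trans (chart j K)) y = (j.1 (i.1.symm y.1),
      (ContinuousLinearMap.snd ℝ R2 R2).comp (blk i j L K y) *
        Ring.inverse ((ContinuousLinearMap.fst ℝ R2 R2).comp (blk i j L K y))) := by
  rw [trans_source] at hy
  obtain ⟨⟨hy, h1⟩, hu⟩ := hy
  refine Prod.ext ?_ ?_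
  · change j.1 (param i L y).pt = _
    rw [param_pt]
  · exact slope_eq ((map_planeIn_param' L K hy h1).trans
      ((range_eq_graph_iff (blk_injective L K hy h1) _).2 ⟨hu, rfl⟩))

theorem contDiffOn_blk (i j : atlas R4 M) (L K : R4 ≃L[ℝ] R2 × R2) :
    ContDiffOn ℝ ∞ (blk i j L K) {y | y.1 ∈ (i.1.symm.trans j.1).source} := by
  have h0 : ContDiffOn ℝ ∞ (fun x : R4 => change i j (i.1.symm x)) (i.1.symm.trans j.1).source := by
    have : IsManifold 𝓘(ℝ, R4) (∞ + 1) M := by simpa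
    have h := contDiffOn_fderiv_coord_change (I := 𝓘(ℝ, R4)) (n := ∞) i j
    refine (h.mono ?_).congr ?_
    · intro x hx
      simpa [OpenPartialHomeomorph.extend] using hx
    · intro x hx
      have hx' : x ∈ i.1.target := hx.1
      show fderivWithin ℝ _ _ (i.1.extend 𝓘(ℝ, R4) (i.1.symm x)) = _
      congr 1
      exact i.1.right_inv hx'
  have h1 : ContDiffOn ℝ ∞ (fun y : R4 × (R2 →L[ℝ] R2) => change i j (i.1.symm y.1))
      {y | y.1 ∈ (i.1.symm.trans j.1).source} :=
    h0.comp contDiff_fst.contDiffOn (fun y hy => hy)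
  unfold blk
  refine ContDiffOn.clm_comp (contDiffOn_const.clm_comp h1) (contDiffOn_const.clm_comp ?_)
  have h2 : ContDiff ℝ ∞ (fun φ : R2 →L[ℝ] R2 => (ContinuousLinearMap.id ℝ R2).prod φ) := by
    have h3 : (fun φ : R2 →L[ℝ] R2 => (ContinuousLinearMap.id ℝ R2).prod φ) = fun φ =>
        ContinuousLinearMap.inl ℝ R2 R2 + (ContinuousLinearMap.inr ℝ R2 R2).comp φ := by
      funext φ; ext <;> simp
    rw [h3]
    exact contDiff_const.add (contDiff_const.clm_comp contDiff_id)
  exact h2.comp_contDiffOn contDiff_snd.contDiffOn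

theorem isOpen_trans_source (i j : atlas R4 M) (L K : R4 ≃L[ℝ] R2 × R2) :
    IsOpen ((chart i L).symm.trans (chart j K)).source := by
  rw [trans_source]
  have h1 : IsOpen {y : R4 × (R2 →L[ℝ] R2) | y.1 ∈ (i.1.symm.trans j.1).source} :=
    (i.1.symm.trans j.1).open_source.preimage continuous_fst
  exact ((contDiffOn_const (c := ContinuousLinearMap.fst ℝ R2 R2)).clm_comp
    (contDiffOn_blk i j L K)).continuousOn.isOpen_inter_preimage h1 Units.isOpen

theorem contDiffOn_trans (i j : atlas R4 M) (L K : R4 ≃L[ℝ] R2 × R2) :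
    ContDiffOn ℝ ∞ ((chart i L).symm.trans (chart j K))
      ((chart i L).symm.trans (chart j K)).source := by
  refine ContDiffOn.congr ?_ (fun y hy => trans_apply hy)
  rw [trans_source]
  have hsub : {y : R4 × (R2 →L[ℝ] R2) | y.1 ∈ (i.1.symm.trans j.1).source ∧
      IsUnit ((ContinuousLinearMap.fst ℝ R2 R2).comp (blk i j L K y))} ⊆
      {y | y.1 ∈ (i.1.symm.trans j.1).source} := fun y hy => hy.1
  have hb := (contDiffOn_blk i j L K).mono hsub
  refine ContDiffOn.prodMk ?_ ?_
  · have h : ContDiffOn ℝ ∞ (j.1 ∘ i.1.symm) (i.1.symm.trans j.1).source := by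
      have h := 𝓘(ℝ, R4).contDiffOn_extendCoordChange (n := ∞)
        (IsManifold.subset_maximalAtlas i.2) (IsManifold.subset_maximalAtlas j.2)
      refine h.mono fun x hx => ?_
      simpa [OpenPartialHomeomorph.extend] using hx
    exact h.comp contDiff_fst.contDiffOn (fun y hy => hy.1)
  · refine ContDiffOn.clm_comp (contDiffOn_const.clm_comp hb) ?_
    intro y hy
    have := contDiffAt_ringInverse (n := ∞) ℝ hy.2.unit
    exact ContDiffAt.comp_contDiffWithinAt y this
      ((contDiffOn_const (c := ContinuousLinearMap.fst ℝ R2 R2)).clm_comp hb y hy)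

/-- The atlas of `TwoPlane M`. -/
noncomputable def core (M : Type*) [TopologicalSpace M] [ChartedSpace R4 M]
    [IsManifold 𝓘(ℝ, R4) ∞ M] : ChartedSpaceCore (R4 × (R2 →L[ℝ] R2)) (TwoPlane M) where
  atlas := {e | ∃ i L, e = chart i L}
  chartAt p := chart (achart R4 p.pt) p.frameAt
  mem_chart_source p := ⟨mem_chart_source R4 p.pt, 0, by
    rw [planeIn_achart]; exact map_frameAt p⟩
  chart_mem_atlas p := ⟨_, _, rfl⟩
  open_source := by
    rintro _ _ ⟨i, L, rfl⟩ ⟨j, K, rfl⟩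
    exact isOpen_trans_source i j L K
  continuousOn_toFun := by
    rintro _ _ ⟨i, L, rfl⟩ ⟨j, K, rfl⟩
    exact (contDiffOn_trans i j L K).continuousOn

noncomputable instance : TopologicalSpace (TwoPlane M) := (core M).toTopologicalSpace

noncomputable instance : ChartedSpace (R4 × (R2 →L[ℝ] R2)) (TwoPlane M) := (core M).toChartedSpace

instance : IsManifold 𝓘(ℝ, R4 × (R2 →L[ℝ] R2)) ∞ (TwoPlane M) := by
  apply isManifold_of_contDiffOn
  intro e e' he he'
  simp only [atlas, ChartedSpace.atlas, Set.mem_iUnion, Set.mem_singleton_iff] at he he'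
  obtain ⟨_, ⟨i, L, rfl⟩, rfl⟩ := he
  obtain ⟨_, ⟨j, K, rfl⟩, rfl⟩ := he'
  have h := contDiffOn_trans i j L K
  simpa using! h

end TwoPlane
end Planes

/-! ### Pseudo-Riemannian geometry in dimension four

`M` is a smooth 4-manifold, `g m v w` is the scalar product of the tangent vectors `v, w` at `m`,
and `σ m` is the sign (`1` or `-1`) of the preferred chart at `m` with respect to the orientation
of `M`. All tensors at `m` are computed in the preferred chart at `m`. -/

section Geometry

variable {M : Type*} [TopologicalSpace M] [ChartedSpace R4 M]

/-- The matrix of the metric with respect to the coordinate vector fields of the preferred chart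
at `m`, at the point with coordinates `x`. -/
noncomputable def metricMatrix (g : M → R4 → R4 → ℝ) (m : M) (x : R4) : Matrix (Fin 4) (Fin 4) ℝ :=
  Matrix.of fun i j => g ((chartAt R4 m).symm x)
    (tangentDeriv R4 R4 (chartAt R4 m).symm x (Pi.single i 1))
    (tangentDeriv R4 R4 (chartAt R4 m).symm x (Pi.single j 1))

/-- The `i`-th partial derivative. -/
noncomputable def pderiv (i : Fin 4) (f : R4 → ℝ) (x : R4) : ℝ := fderiv ℝ f x (Pi.single i 1)

/-- Christoffel symbols `Γᵏᵢⱼ` of the Levi-Civita connection, in the preferred chart at `m`. -/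
noncomputable def christoffel (g : M → R4 → R4 → ℝ) (m : M) (k i j : Fin 4) (x : R4) : ℝ :=
  (1 / 2) * ∑ l, (metricMatrix g m x)⁻¹ k l *
    (pderiv i (fun y => metricMatrix g m y j l) x + pderiv j (fun y => metricMatrix g m y i l) x -
      pderiv l (fun y => metricMatrix g m y i j) x)

/-- The components `Rˡₖᵢⱼ` of the curvature tensor at the point with coordinates `x`:
`R(∂ᵢ,∂ⱼ)∂ₖ = ∇ᵢ∇ⱼ∂ₖ - ∇ⱼ∇ᵢ∂ₖ = ∑ₗ Rˡₖᵢⱼ ∂ₗ`. -/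
noncomputable def curvature (g : M → R4 → R4 → ℝ) (m : M) (l k i j : Fin 4) (x : R4) : ℝ :=
  pderiv i (christoffel g m l j k) x - pderiv j (christoffel g m l i k) x +
    ∑ n, (christoffel g m l i n x * christoffel g m n j k x -
      christoffel g m l j n x * christoffel g m n i k x)

/-- `Rᵢⱼₖₗ = g(R(∂ᵢ,∂ⱼ)∂ₗ, ∂ₖ)`. -/
noncomputable def riemann (g : M → R4 → R4 → ℝ) (m : M) (i j k l : Fin 4) (x : R4) : ℝ :=
  ∑ n, metricMatrix g m x k n * curvature g m n l i j x

/-- The Ricci tensor, `Ricⱼₖ = ∑ᵢ Rⁱₖᵢⱼ`. -/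
noncomputable def ricci (g : M → R4 → R4 → ℝ) (m : M) (j k : Fin 4) (x : R4) : ℝ :=
  ∑ i, curvature g m i k i j x

/-- The scalar curvature. -/
noncomputable def scalarCurvature (g : M → R4 → R4 → ℝ) (m : M) (x : R4) : ℝ :=
  ∑ j, ∑ k, (metricMatrix g m x)⁻¹ j k * ricci g m j k x

/-- The Weyl tensor `Wᵢⱼₖₗ`. -/
noncomputable def weyl (g : M → R4 → R4 → ℝ) (m : M) (i j k l : Fin 4) (x : R4) : ℝ :=
  let G := metricMatrix g m x
  riemann g m i j k l x -
    (1 / 2) * (G i k * ricci g m j l x - G i l * ricci g m j k x -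
      G j k * ricci g m i l x + G j l * ricci g m i k x) +
    (scalarCurvature g m x / 6) * (G i k * G j l - G i l * G j k)

/-- The matrix of the scalar product of `T_m M`. -/
noncomputable def gram (g : M → R4 → R4 → ℝ) (m : M) : Matrix (Fin 4) (Fin 4) ℝ :=
  Matrix.of fun i j => g m (Pi.single i 1) (Pi.single j 1)

/-- A 2-form `½ ∑ βᵢⱼ dxⁱ ∧ dxʲ` is given by the skew-symmetric matrix `β`. This is the matrix with
both indices raised. -/
noncomputable def raise (g : M → R4 → R4 → ℝ) (m : M) (β : Matrix (Fin 4) (Fin 4) ℝ) :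
    Matrix (Fin 4) (Fin 4) ℝ :=
  (gram g m)⁻¹ * β * ((gram g m)⁻¹)ᵀ

/-- The scalar product of 2-forms, for which `⟨θ₁ ∧ θ₂, θ₃ ∧ θ₄⟩ = det ⟨θₐ, θ_b⟩`. -/
noncomputable def formInner (g : M → R4 → R4 → ℝ) (m : M) (α β : Matrix (Fin 4) (Fin 4) ℝ) : ℝ :=
  (1 / 2) * ∑ i, ∑ j, α i j * raise g m β i j

/-- The coefficient of the 4-form `α ∧ β` with respect to `dx⁰ ∧ dx¹ ∧ dx² ∧ dx³`. -/
def wedge (α β : Matrix (Fin 4) (Fin 4) ℝ) : ℝ :=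
  α 0 1 * β 2 3 - α 0 2 * β 1 3 + α 0 3 * β 1 2 + α 1 2 * β 0 3 - α 1 3 * β 0 2 + α 2 3 * β 0 1

/-- The coefficient of the positive unit volume form of `T_m M` with respect to
`dx⁰ ∧ dx¹ ∧ dx² ∧ dx³`. -/
noncomputable def volCoeff (g : M → R4 → R4 → ℝ) (σ : M → ℝ) (m : M) : ℝ :=
  σ m * Real.sqrt |(gram g m).det|

/-- `*β = β`, where the Hodge dual is defined by `α ∧ *β = ⟨α, β⟩ vol` for all 2-forms `α`. -/
def IsSelfDualForm (g : M → R4 → R4 → ℝ) (σ : M → ℝ) (m : M) (β : Matrix (Fin 4) (Fin 4) ℝ) :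
    Prop :=
  ∀ α : Matrix (Fin 4) (Fin 4) ℝ, αᵀ = -α → wedge α β = formInner g m α β * volCoeff g σ m

/-- The action of the Weyl tensor at `m` on 2-forms: `(𝒲β)ᵢⱼ = ½ ∑ Wᵢⱼₖₗ βᵏˡ`. -/
noncomputable def weylOp (g : M → R4 → R4 → ℝ) (m : M) (β : Matrix (Fin 4) (Fin 4) ℝ) :
    Matrix (Fin 4) (Fin 4) ℝ :=
  Matrix.of fun i j => (1 / 2) * ∑ k, ∑ l, weyl g m i j k l (chartAt R4 m m) * raise g m β k l

/-- `β = θ₁ ∧ θ₂` for a basis `θ₁, θ₂` of the annihilator of the 2-plane `W`. -/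
def IsPluckerForm (W : Submodule ℝ R4) (β : Matrix (Fin 4) (Fin 4) ℝ) : Prop :=
  ∃ θ : Fin 2 → R4, LinearIndependent ℝ θ ∧ (∀ a, ∀ w ∈ W, θ a ⬝ᵥ w = 0) ∧
    β = Matrix.of fun i j => θ 0 i * θ 1 j - θ 0 j * θ 1 i

/-- The scalar product vanishes on the plane. -/
def IsNull (g : M → R4 → R4 → ℝ) (W : TwoPlane M) : Prop :=
  ∀ v ∈ W.plane, ∀ w ∈ W.plane, g W.pt v w = 0

/-- Self-dual 2-planes. -/
def IsSelfDual (g : M → R4 → R4 → ℝ) (σ : M → ℝ) (W : TwoPlane M) : Prop :=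
  ∀ β, IsPluckerForm W.plane β → IsSelfDualForm g σ W.pt β

/-- A null 2-plane is principal if `β ∧ 𝒲β = 0` for the associated 2-forms `β`. -/
def IsPrincipal (g : M → R4 → R4 → ℝ) (W : TwoPlane M) : Prop :=
  IsNull g W ∧ ∀ β, IsPluckerForm W.plane β → wedge β (weylOp g W.pt β) = 0

/-- The self-dual twistor space `𝕋⁺M`, a subset of the bundle of tangent 2-planes. -/
def twistorSpace (g : M → R4 → R4 → ℝ) (σ : M → ℝ) : Set (TwoPlane M) :=
  {W | IsNull g W ∧ IsSelfDual g σ W}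

/-- The non-principal locus `𝕋⁺_*M` of the self-dual twistor space. -/
def nonPrincipalLocus (g : M → R4 → R4 → ℝ) (σ : M → ℝ) : Set (TwoPlane M) :=
  {W | W ∈ twistorSpace g σ ∧ ¬ IsPrincipal g W}

/-- The bilinear map `Γ(v, w)` at `m`: the covariant derivative in the direction `v` of a vector
field `w` along a curve is `w' + Γ(v, w)`. -/
noncomputable def christoffelMap (g : M → R4 → R4 → ℝ) (m : M) (v w : R4) : R4 :=
  fun k => ∑ i, ∑ j, christoffel g m k i j (chartAt R4 m m) * v i * w j

variable [IsManifold 𝓘(ℝ, R4) ∞ M]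

/-- The twistor distribution at the 2-plane `W`: the horizontal lift of `W` by the Levi-Civita
connection. In the preferred chart of `TwoPlane M` at `W`, a tangent vector `ξ = (v, ψ)` is the
velocity of a curve of planes `W(t) = {L⁻¹(a, φ(t) a)}` over a curve with velocity `v`, where
`L = W.frameAt`, `W(0) = W`, `φ(0) = 0` and `φ'(0) = ψ`. The vector `ξ` is horizontal if the
covariant derivatives `w' + Γ(v, w)` at `t = 0` of the sections `w(t) = L⁻¹(a, φ(t) a)` belong
to `W`; it is the horizontal lift of `v`. -/
noncomputable def twistorDistribution (g : M → R4 → R4 → ℝ) (W : TwoPlane M) :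
    Submodule ℝ (R4 × (R2 →L[ℝ] R2)) where
  carrier := {ξ | ξ.1 ∈ W.plane ∧ ∀ a : R2,
    W.frameAt.symm (0, ξ.2 a) + christoffelMap g W.pt ξ.1 (W.frameAt.symm (a, 0)) ∈ W.plane}
  zero_mem' := by
    refine ⟨W.plane.zero_mem, fun a => ?_⟩
    have h : christoffelMap g W.pt 0 (W.frameAt.symm (a, 0)) = 0 := by
      funext k; simp [christoffelMap]
    have h2 : W.frameAt.symm ((0 : R2), (0 : R2)) = 0 := W.frameAt.symm.map_zero
    simp [h, h2]
  add_mem' := by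
    rintro ξ ζ ⟨h1, h2⟩ ⟨h3, h4⟩
    refine ⟨W.plane.add_mem h1 h3, fun a => ?_⟩
    convert! W.plane.add_mem (h2 a) (h4 a) using 1
    have e1 : christoffelMap g W.pt (ξ + ζ).1 (W.frameAt.symm (a, 0)) =
        christoffelMap g W.pt ξ.1 (W.frameAt.symm (a, 0)) +
          christoffelMap g W.pt ζ.1 (W.frameAt.symm (a, 0)) := by
      funext k
      simp [christoffelMap, mul_add, add_mul, Finset.sum_add_distrib]
    have e2 : W.frameAt.symm ((0 : R2), (ξ + ζ).2 a) =
        W.frameAt.symm (0, ξ.2 a) + W.frameAt.symm (0, ζ.2 a) := by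
      rw [← map_add]; simp
    rw [e1, e2]; abel
  smul_mem' := by
    rintro c ξ ⟨h1, h2⟩
    refine ⟨W.plane.smul_mem c h1, fun a => ?_⟩
    convert! W.plane.smul_mem c (h2 a) using 1
    have e1 : christoffelMap g W.pt (c • ξ).1 (W.frameAt.symm (a, 0)) =
        c • christoffelMap g W.pt ξ.1 (W.frameAt.symm (a, 0)) := by
      funext k
      simp only [christoffelMap, Prod.smul_fst, Pi.smul_apply, smul_eq_mul, Finset.mul_sum]
      exact Finset.sum_congr rfl fun i _ => Finset.sum_congr rfl fun j _ => by ring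
    have e2 : W.frameAt.symm ((0 : R2), (c • ξ).2 a) = c • W.frameAt.symm (0, ξ.2 a) := by
      rw [← map_smul]; simp
    rw [e1, e2, smul_add]

end Geometry

/-! ### The fibration `Π`, the distribution `𝒟` and the dancing metric -/

/-- `Π : Q⁵ → M⁴`, `(𝐪, 𝐩) ↦ ([𝐪], [𝐩])`. -/
noncomputable def hopf (u : Q5) : M4 :=
  M4.ofHomog u.q u.p (by rw [u.pairing]; exact one_ne_zero)

/-- The rank 2 distribution `d𝐩 = 𝐪 × d𝐪` on `Q⁵`. -/
noncomputable def distribution (u : Q5) : Submodule ℝ (R3 × R2) where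
  carrier := {ξ | (tangentDeriv (R3 × R2) (R3 × R3) Q5.incl u ξ).2 =
    u.q ⨯₃ (tangentDeriv (R3 × R2) (R3 × R3) Q5.incl u ξ).1}
  zero_mem' := by simp
  add_mem' := by
    intro ξ ζ h1 h2
    simp only [Set.mem_ofPred_eq, map_add, Prod.fst_add, Prod.snd_add] at *
    rw [h1, h2]
  smul_mem' := by
    intro c ξ h
    simp only [Set.mem_ofPred_eq, map_smul, Prod.smul_fst, Prod.smul_snd] at *
    rw [h]

/-- The flat metric `-2 d𝐩 d𝐪` on `ℝ³ × (ℝ³)*`. -/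
def flatMetric (a b : R3 × R3) : ℝ := -(a.2 ⬝ᵥ b.1 + b.2 ⬝ᵥ a.1)

/-- The restriction of the flat metric to `Q⁵`. -/
noncomputable def metricQ5 (u : Q5) (ξ ζ : R3 × R2) : ℝ :=
  flatMetric (tangentDeriv (R3 × R2) (R3 × R3) Q5.incl u ξ)
    (tangentDeriv (R3 × R2) (R3 × R3) Q5.incl u ζ)

/-- `ξ` is the horizontal lift to `u` of the tangent vector `v` at `Π(u)`: it projects to `v` and
is orthogonal to the fibre of `Π`. -/
def IsHorizontalLift (u : Q5) (v : R4) (ξ : R3 × R2) : Prop :=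
  tangentDeriv (R3 × R2) R4 hopf u ξ = v ∧
    ∀ τ : R3 × R2, tangentDeriv (R3 × R2) R4 hopf u τ = 0 → metricQ5 u ξ τ = 0

/-- The dancing metric: `dancingMetric m v w` is the real number which is the scalar product of the
horizontal lifts of `v, w` to a point of `Q⁵` above `m`; that is, `Π` is a pseudo-Riemannian
submersion. -/
noncomputable def dancingMetric (m : M4) (v w : R4) : ℝ :=
  Classical.epsilon fun r : ℝ => ∃ u ξ ζ, hopf u = m ∧ IsHorizontalLift u v ξ ∧
    IsHorizontalLift u w ζ ∧ metricQ5 u ξ ζ = r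

/-- `e₀, e₁` is a basis of `T_q ℝP² ⊕ 0`, `e₂, e₃` is a basis of `0 ⊕ T_p ℝP²*`, and they are dual
to each other with respect to the dancing metric. (All charts of `M⁴` are products of affine charts
of `ℝP²` and of `ℝP²*`, with coordinates `0, 1` on the first factor and `2, 3` on the second.) -/
def IsSplitNullBasis (m : M4) (e : Fin 4 → R4) : Prop :=
  (e 0 2 = 0 ∧ e 0 3 = 0 ∧ e 1 2 = 0 ∧ e 1 3 = 0) ∧
  (e 2 0 = 0 ∧ e 2 1 = 0 ∧ e 3 0 = 0 ∧ e 3 1 = 0) ∧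
  (dancingMetric m (e 0) (e 2) = 1 ∧ dancingMetric m (e 0) (e 3) = 0 ∧
    dancingMetric m (e 1) (e 2) = 0 ∧ dancingMetric m (e 1) (e 3) = 1)

open Classical in
/-- The orientation of `M⁴`, for which the bases `IsSplitNullBasis` are positive: the sign of the
preferred chart at `m`. -/
noncomputable def orientationSign (m : M4) : ℝ :=
  if ∃ e : Fin 4 → R4, IsSplitNullBasis m e ∧ 0 < (Matrix.of e).det then 1 else -1

/-- `𝕋⁺_*M⁴`, the non-principal locus of the self-dual twistor space of the dancing metric. -/
def nonPrincipalTwistorSpace : Set (TwoPlane M4) :=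
  nonPrincipalLocus dancingMetric orientationSign

end Dancing

open Dancing

/-! Everything is read at the origin of an affine chart. `SL(3, ℝ)` acts transitively on `M4`, and
the preferred chart at `m` comes from a unimodular basis in which `m` is `([e₃], [e₃])`, with
coordinates zero. The points of `Q5` above `m` become `(t e₃, t⁻¹ e₃)` with `t ≠ 0`. Pairings and
cross products are `SL(3, ℝ)`-invariant, so the metric and the planes `Π_* 𝒟` are given by the same
formulas in every affine chart.

Metric. With `s = 1 + x₀x₂ + x₁x₃` the only non-zero components of the metric are the mixed second
derivatives of `-log s` (`dancingMetric_affineChart`, `metricMatrix_eq`). The Christoffel symbols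
vanish at the origin and their first derivatives there are integers, so curvature, Ricci and Weyl
tensors reduce to finite integer tables. The result is `Ric = -3g`, and on self-dual forms, with
entries `β₀₁`, `β₀₂ = β₁₃`, `β₂₃`, the Weyl operator is diagonal with eigenvalues `1, -2, 1`. A
decomposable self-dual form satisfies `β₀₁β₂₃ = β₀₂²`, whence `β ∧ 𝒲β = 6β₀₂²`: the plane is
non-principal iff `β₀₂ ≠ 0`, and then it is `{v₂ = -a v₁, v₃ = a v₀}` with `a = β₀₁/β₀₂ ≠ 0`
(`exists_eq_of_not_isPrincipal`).

Bijection. At `(t e₃, t⁻¹ e₃)` the equation `d𝐩 = 𝐪 × d𝐪` projects to that same plane with `a = t³`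
(`exists_mem_twistorLift`). As `t ↦ t³` is a bijection of the non-zero reals, `ν` is a bijection
from each fibre of `Π` onto the non-principal planes over its base point. The inverse is smooth
because `t³` is a rational function of the coordinates of the plane, even away from the origin of a
chart, and the cube root is smooth off zero (`ofAffine_coords`).

Distribution. Since the connection vanishes at the origin, horizontal vectors there are those whose
plane component is zero (`mem_twistorDistribution`). Along `𝒟` the slope of `ν` is stationary at the
origin: it depends on `q₂, p₂`, which do not vary to first order, and on products of two factors
that both vanish (`tangentDeriv_twistorLift`). -/

namespace Dancing

open Topology Filter

/-! ### Calculus of `tangentDeriv` -/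

section TangentDeriv

variable {X Y Z E F G : Type*} [NormedAddCommGroup E] [NormedSpace ℝ E] [NormedAddCommGroup F]
  [NormedSpace ℝ F] [NormedAddCommGroup G] [NormedSpace ℝ G] [TopologicalSpace X]
  [ChartedSpace E X] [TopologicalSpace Y] [ChartedSpace F Y] [TopologicalSpace Z]
  [ChartedSpace G Z]

theorem tangentDeriv_comp {f : X → Y} {g : Y → Z} {x : X}
    (hg : MDifferentiableAt 𝓘(ℝ, F) 𝓘(ℝ, G) g (f x)) (hf : MDifferentiableAt 𝓘(ℝ, E) 𝓘(ℝ, F) f x) :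
    tangentDeriv E G (g ∘ f) x = (tangentDeriv F G g (f x)).comp (tangentDeriv E F f x) :=
  mfderiv_comp x hg hf

theorem tangentDeriv_congr {f f' : X → Y} {x : X} (h : f =ᶠ[𝓝 x] f') :
    tangentDeriv E F f x = tangentDeriv E F f' x :=
  h.mfderiv_eq

theorem tangentDeriv_eq_fderiv {f : E → F} {x : E} : tangentDeriv E F f x = fderiv ℝ f x :=
  mfderiv_eq_fderiv

/-- The derivative is by definition written in the preferred chart of the target, so this chart may
be inserted explicitly. This turns derivatives of maps into `M4` or `TwoPlane M4` into derivatives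
of vector-valued maps. -/
theorem tangentDeriv_eq_chartAt_comp [IsManifold 𝓘(ℝ, F) ∞ Y] {f : X → Y} {x : X}
    (hf : MDifferentiableAt 𝓘(ℝ, E) 𝓘(ℝ, F) f x) :
    tangentDeriv E F f x = tangentDeriv E F (chartAt F (f x) ∘ f) x := by
  have h1 : IsManifold 𝓘(ℝ, F) 1 Y := IsManifold.of_le (n := ∞) (by simp)
  have h2 : MDifferentiableAt 𝓘(ℝ, E) 𝓘(ℝ, F) (chartAt F (f x) ∘ f) x :=
    (mdifferentiableAt_atlas (chart_mem_atlas F (f x)) (mem_chart_source F (f x))).comp x hf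
  unfold tangentDeriv
  rw [hf.mfderiv, h2.mfderiv]
  rfl

theorem mem_maximalAtlas [IsManifold 𝓘(ℝ, F) ∞ Y] {e : OpenPartialHomeomorph Y F}
    (he : e ∈ atlas F Y) : e ∈ IsManifold.maximalAtlas 𝓘(ℝ, F) ∞ Y :=
  IsManifold.subset_maximalAtlas he

theorem mdifferentiableAt_chart [IsManifold 𝓘(ℝ, F) ∞ Y] {e : OpenPartialHomeomorph Y F}
    (he : e ∈ atlas F Y) {y : Y} (hy : y ∈ e.source) :
    MDifferentiableAt 𝓘(ℝ, F) 𝓘(ℝ, F) e y :=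
  (contMDiffAt_of_mem_maximalAtlas (mem_maximalAtlas he) hy).mdifferentiableAt (by simp)

theorem mdifferentiableAt_chart_symm [IsManifold 𝓘(ℝ, F) ∞ Y] {e : OpenPartialHomeomorph Y F}
    (he : e ∈ atlas F Y) {y : F} (hy : y ∈ e.target) :
    MDifferentiableAt 𝓘(ℝ, F) 𝓘(ℝ, F) e.symm y :=
  (contMDiffAt_symm_of_mem_maximalAtlas (mem_maximalAtlas he) hy).mdifferentiableAt (by simp)

/-- The components of a tangent vector in another chart. -/
theorem tangentDeriv_atlas_comp {M : Type*} [TopologicalSpace M] [ChartedSpace R4 M]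
    [IsManifold 𝓘(ℝ, R4) ∞ M] (i : atlas R4 M) {f : X → M} {x : X}
    (hf : MDifferentiableAt 𝓘(ℝ, E) 𝓘(ℝ, R4) f x) (hi : f x ∈ i.1.source) :
    tangentDeriv E R4 (i.1 ∘ f) x =
      (TwoPlane.change (achart R4 (f x)) i (f x)).comp (tangentDeriv E R4 f x) := by
  rw [tangentDeriv_comp (mdifferentiableAt_chart i.2 hi) hf]
  congr 1
  unfold tangentDeriv
  rw [(mdifferentiableAt_chart i.2 hi).mfderiv]
  rfl

/-- A map which agrees with `e.symm ∘ F`, for a chart `e` and a smooth `F`, is smooth. -/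
theorem contMDiffAt_of_eventuallyEq_symm [IsManifold 𝓘(ℝ, F) ∞ Y] {e : OpenPartialHomeomorph Y F}
    (he : e ∈ atlas F Y) {f : X → Y} {φ : X → F} {x : X}
    (hφ : ContMDiffAt 𝓘(ℝ, E) 𝓘(ℝ, F) ∞ φ x) (hx : φ x ∈ e.target)
    (h : f =ᶠ[𝓝 x] e.symm ∘ φ) : ContMDiffAt 𝓘(ℝ, E) 𝓘(ℝ, F) ∞ f x :=
  ((contMDiffAt_symm_of_mem_maximalAtlas (mem_maximalAtlas he) hx).comp x hφ).congr_of_eventuallyEq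
    h

end TangentDeriv

/-! ### `Q⁵` as a submanifold of `ℝ³ × ℝ³` -/

namespace Q5

theorem contMDiff_incl : ContMDiff 𝓘(ℝ, R3 × R2) 𝓘(ℝ, R3 × R3) ∞ incl := by
  intro u
  have hc : chartAt (R3 × R2) u ∈ atlas (R3 × R2) Q5 := chart_mem_atlas _ u
  have hu := mem_chart_source (R3 × R2) u
  obtain ⟨i, hi⟩ := hc
  have h1 : ContMDiffAt 𝓘(ℝ, R3 × R2) 𝓘(ℝ, R3 × R2) ∞ (chart i) u :=
    contMDiffAt_of_mem_maximalAtlas (mem_maximalAtlas ⟨i, rfl⟩) (by rw [hi]; exact hu)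
  have hui : u.q i ≠ 0 := by rw [← hi] at hu; exact hu
  have h2 : ContMDiffAt 𝓘(ℝ, R3 × R2) 𝓘(ℝ, R3 × R3) ∞
      (fun y : R3 × R2 => (y.1, solve i y)) (chart i u) := by
    apply ContDiffAt.contMDiffAt
    refine (contDiff_fst.contDiffAt).prodMk ((contDiffOn_solve i).contDiffAt ?_)
    exact (chart i).open_target.mem_nhds hui
  refine (h2.comp u h1).congr_of_eventuallyEq ?_
  filter_upwards [(chart i).open_source.mem_nhds hui] with w hw
  have h3 := (chart i).left_inv hw
  have h4 : ((chart i) w).1 i ≠ 0 := hw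
  change param i (chart i w) = w at h3
  rw [param_eq h4] at h3
  conv_lhs => rw [← h3]
  rfl

/-- `Q5` has the submanifold structure: each chart is the restriction of a linear projection of `ℝ³
× ℝ³`, so smoothness can be tested after the inclusion. -/
theorem contMDiffAt_iff {X E : Type*} [NormedAddCommGroup E] [NormedSpace ℝ E]
    [TopologicalSpace X] [ChartedSpace E X] {f : X → Q5} {x : X} :
    ContMDiffAt 𝓘(ℝ, E) 𝓘(ℝ, R3 × R2) ∞ f x ↔
      ContMDiffAt 𝓘(ℝ, E) 𝓘(ℝ, R3 × R3) ∞ (incl ∘ f) x := by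
  refine ⟨fun h => contMDiff_incl.contMDiffAt.comp x h, fun h => ?_⟩
  rw [contMDiffAt_iff_target]
  refine ⟨isInducing_incl.continuousAt_iff.2 h.continuousAt, ?_⟩
  obtain ⟨i, hi⟩ := chart_mem_atlas (R3 × R2) (f x)
  have h2 : ContDiff ℝ ∞ (fun z : R3 × R3 => (z.1, fun k => z.2 (i.succAbove k))) :=
    contDiff_fst.prodMk (contDiff_pi.2 fun k => contDiff_pi.1 contDiff_snd _)
  refine ((h2.contMDiff.contMDiffAt).comp x h).congr_of_eventuallyEq (Eventually.of_forall ?_)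
  intro y
  show chartAt (R3 × R2) (f x) (f y) = _
  rw [← hi]
  rfl

/-- The differential of the inclusion. -/
noncomputable def tangentIncl (u : Q5) : R3 × R2 →L[ℝ] R3 × R3 :=
  tangentDeriv (R3 × R2) (R3 × R3) incl u

theorem mdifferentiableAt_incl (u : Q5) :
    MDifferentiableAt 𝓘(ℝ, R3 × R2) 𝓘(ℝ, R3 × R3) incl u :=
  contMDiff_incl.contMDiffAt.mdifferentiableAt (by simp)

theorem tangentDeriv_comp_incl {Y F : Type*} [NormedAddCommGroup F] [NormedSpace ℝ F]
    [TopologicalSpace Y] [ChartedSpace F Y] {f : R3 × R3 → Y} {u : Q5}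
    (hf : MDifferentiableAt 𝓘(ℝ, R3 × R3) 𝓘(ℝ, F) f (incl u)) :
    tangentDeriv (R3 × R2) F (f ∘ incl) u =
      (tangentDeriv (R3 × R3) F f (incl u)).comp (tangentIncl u) :=
  tangentDeriv_comp hf (mdifferentiableAt_incl u)

/-- A chart is a linear projection composed with the inclusion, and the differential of a chart is
injective. -/
theorem tangentIncl_injective (u : Q5) : Function.Injective (tangentIncl u) := by
  obtain ⟨i, hi⟩ := chart_mem_atlas (R3 × R2) u
  have h1 : IsManifold 𝓘(ℝ, R3 × R2) 1 Q5 := IsManifold.of_le (n := ∞) (by simp)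
  let P : R3 × R3 →L[ℝ] R3 × R2 := (ContinuousLinearMap.fst ℝ R3 R3).prod
    (ContinuousLinearMap.pi fun k => (ContinuousLinearMap.proj (i.succAbove k)).comp
      (ContinuousLinearMap.snd ℝ R3 R3))
  have h2 : tangentDeriv (R3 × R2) (R3 × R2) (P ∘ incl) u =
      P.comp (tangentIncl u) := by
    rw [tangentDeriv_comp_incl P.differentiableAt.mdifferentiableAt,
      tangentDeriv_eq_fderiv, P.fderiv]
  have h3 : (P ∘ incl : Q5 → R3 × R2) = chartAt (R3 × R2) u := by
    rw [← hi]; rfl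
  rw [h3] at h2
  have h4 : Function.Injective (P.comp (tangentIncl u)) := by
    rw [← h2]
    exact (mdifferentiable_chart (I := 𝓘(ℝ, R3 × R2)) u).mfderiv_injective
      (mem_chart_source (R3 × R2) u)
  exact fun a b h => h4 (congrArg P h)

/-- The pairing `(𝐪, 𝐩) ↦ 𝐩𝐪` has the differential `(a, b) ↦ b𝐪 + 𝐩a`. -/
def pairingDeriv (u : Q5) : R3 × R3 →ₗ[ℝ] ℝ where
  toFun z := z.2 ⬝ᵥ u.q + u.p ⬝ᵥ z.1
  map_add' z w := by simp [add_dotProduct, dotProduct_add]; ring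
  map_smul' c z := by simp [mul_add]

theorem hasFDerivAt_pairing (q p : R3) :
    HasFDerivAt (fun z : R3 × R3 => z.2 ⬝ᵥ z.1)
      (∑ i, (p i • (ContinuousLinearMap.proj (R := ℝ) (φ := fun _ : Fin 3 => ℝ) i).comp
          (ContinuousLinearMap.fst ℝ R3 R3) +
        q i • (ContinuousLinearMap.proj (R := ℝ) (φ := fun _ : Fin 3 => ℝ) i).comp
          (ContinuousLinearMap.snd ℝ R3 R3))) (q, p) := by
  simp only [dotProduct]
  refine HasFDerivAt.fun_sum fun i _ => ?_
  exact (((ContinuousLinearMap.proj (R := ℝ) (φ := fun _ : Fin 3 => ℝ) i).comp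
    (ContinuousLinearMap.snd ℝ R3 R3)).hasFDerivAt (x := (q, p))).mul
    (((ContinuousLinearMap.proj (R := ℝ) (φ := fun _ : Fin 3 => ℝ) i).comp
    (ContinuousLinearMap.fst ℝ R3 R3)).hasFDerivAt (x := (q, p)))

theorem pairingDeriv_tangentIncl (u : Q5) (ξ : R3 × R2) :
    (tangentIncl u ξ).2 ⬝ᵥ u.q + u.p ⬝ᵥ (tangentIncl u ξ).1 = 0 := by
  have h := hasFDerivAt_pairing u.q u.p
  have h1 := tangentDeriv_comp_incl (u := u) (f := fun z : R3 × R3 => z.2 ⬝ᵥ z.1)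
    (HasFDerivAt.differentiableAt h).mdifferentiableAt
  have h2 : (fun z : R3 × R3 => z.2 ⬝ᵥ z.1) ∘ incl = fun _ => (1 : ℝ) :=
    funext fun u => u.pairing
  rw [h2, tangentDeriv_eq_fderiv, show incl u = (u.q, u.p) from rfl, h.fderiv] at h1
  have h3 : tangentDeriv (R3 × R2) ℝ (fun _ : Q5 => (1 : ℝ)) u = 0 := mfderiv_const
  rw [h3] at h1
  have h4 := congrArg (fun l : R3 × R2 →L[ℝ] ℝ => l ξ) h1
  simp only [dotProduct, Fin.sum_univ_three] at h4 ⊢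
  simp at h4
  linarith

/-- Differentiating `𝐩𝐪 = 1` gives one inclusion; equality is a dimension count, `5 = 6 - 1`. -/
theorem range_tangentIncl (u : Q5) :
    LinearMap.range (tangentIncl u : R3 × R2 →ₗ[ℝ] R3 × R3) = LinearMap.ker (pairingDeriv u) := by
  apply Submodule.eq_of_le_of_finrank_eq
  · rintro _ ⟨ξ, rfl⟩
    exact pairingDeriv_tangentIncl u ξ
  · have h1 := LinearMap.finrank_range_of_inj
      (f := (tangentIncl u : R3 × R2 →ₗ[ℝ] R3 × R3)) (tangentIncl_injective u)
    have h2 := LinearMap.finrank_range_add_finrank_ker (pairingDeriv u)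
    have h3 : LinearMap.range (pairingDeriv u) = ⊤ := by
      rw [LinearMap.range_eq_top]
      intro c
      refine ⟨(c • u.q, 0), ?_⟩
      simp [pairingDeriv, u.pairing]
    rw [h3] at h2
    simp only [finrank_top, Module.finrank_self, Module.finrank_prod, Module.finrank_fin_fun] at h1 h2
    omega

theorem exists_tangentIncl_eq {u : Q5} {a b : R3} (h : b ⬝ᵥ u.q + u.p ⬝ᵥ a = 0) :
    ∃ ξ, tangentIncl u ξ = (a, b) := by
  have h1 : ((a, b) : R3 × R3) ∈ LinearMap.ker (pairingDeriv u) := h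
  rw [← range_tangentIncl] at h1
  exact h1

end Q5

/-! ### Affine charts and the fibration -/

/-- The linear action of `SL₃(ℝ)` on `ℝ³ × (ℝ³)*`. -/
noncomputable def linAct (g : SL(3, ℝ)) : R3 × R3 →L[ℝ] R3 × R3 :=
  LinearMap.toContinuousLinearMap (LinearMap.prodMap g.1.mulVecLin (g⁻¹).1.vecMulLinear)

theorem linAct_apply (g : SL(3, ℝ)) (z : R3 × R3) :
    linAct g z = (g.1 *ᵥ z.1, z.2 ᵥ* (g⁻¹).1) := rfl

theorem linAct_incl (g : SL(3, ℝ)) (u : Q5) : linAct g u.incl = (g • u).incl := rfl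

theorem linAct_linAct_inv (g : SL(3, ℝ)) (z : R3 × R3) : linAct g (linAct g⁻¹ z) = z := by
  simp only [linAct_apply, Matrix.mulVec_mulVec, Matrix.vecMul_vecMul]
  rw [← Matrix.SpecialLinearGroup.coe_mul, ← Matrix.SpecialLinearGroup.coe_mul]
  simp

theorem linAct_inv_linAct (g : SL(3, ℝ)) (z : R3 × R3) : linAct g⁻¹ (linAct g z) = z := by
  simpa using linAct_linAct_inv g⁻¹ z

theorem linAct_pairing (g : SL(3, ℝ)) (z w : R3 × R3) :
    (linAct g z).2 ⬝ᵥ (linAct g w).1 = z.2 ⬝ᵥ w.1 := act_pairing g w.1 z.2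

theorem flatMetric_linAct (g : SL(3, ℝ)) (z w : R3 × R3) :
    flatMetric (linAct g z) (linAct g w) = flatMetric z w := by
  unfold flatMetric
  rw [linAct_pairing, linAct_pairing]

/-- The differential of the affine coordinates at `z = (𝐪, 𝐩)`. -/
noncomputable def coordsDeriv (z : R3 × R3) : R3 × R3 →L[ℝ] R4 :=
  fderiv ℝ (fun z : R3 × R3 => M4.coords z.1 z.2) z

theorem contDiffAt_coords {z : R3 × R3} (hq : z.1 2 ≠ 0) (hp : z.2 2 ≠ 0) :
    ContDiffAt ℝ ∞ (fun z : R3 × R3 => M4.coords z.1 z.2) z := by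
  have h1 : ∀ k, ContDiffAt ℝ ∞ (fun y : R3 × R3 => y.1 k) z :=
    fun k => (contDiff_pi.1 contDiff_fst k).contDiffAt
  have h2 : ∀ k, ContDiffAt ℝ ∞ (fun y : R3 × R3 => y.2 k) z :=
    fun k => (contDiff_pi.1 contDiff_snd k).contDiffAt
  refine contDiffAt_pi.2 fun i => ?_
  fin_cases i
  · exact (h1 0).div (h1 2) hq
  · exact (h1 1).div (h1 2) hq
  · exact (h2 0).div (h2 2) hp
  · exact (h2 1).div (h2 2) hp

theorem hasFDerivAt_div {E : Type*} [NormedAddCommGroup E] [NormedSpace ℝ E] {f g : E → ℝ}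
    {f' g' : E →L[ℝ] ℝ} {x : E} (hf : HasFDerivAt f f' x) (hg : HasFDerivAt g g' x)
    (h : g x ≠ 0) :
    HasFDerivAt (fun y => f y / g y) ((g x)⁻¹ • (f' - (f x / g x) • g')) x := by
  simp only [div_eq_mul_inv]
  refine (hf.mul ((hasDerivAt_inv h).comp_hasFDerivAt x hg)).congr_fderiv ?_
  ext v
  simp
  field_simp
  ring

theorem coordsDeriv_apply {z : R3 × R3} (hq : z.1 2 ≠ 0) (hp : z.2 2 ≠ 0) (w : R3 × R3) :
    coordsDeriv z w = ![(w.1 0 - z.1 0 / z.1 2 * w.1 2) / z.1 2,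
      (w.1 1 - z.1 1 / z.1 2 * w.1 2) / z.1 2, (w.2 0 - z.2 0 / z.2 2 * w.2 2) / z.2 2,
      (w.2 1 - z.2 1 / z.2 2 * w.2 2) / z.2 2] := by
  have h1 : ∀ k, HasFDerivAt (fun y : R3 × R3 => y.1 k)
      ((ContinuousLinearMap.proj (R := ℝ) (φ := fun _ : Fin 3 => ℝ) k).comp
        (ContinuousLinearMap.fst ℝ R3 R3)) z := fun k => ContinuousLinearMap.hasFDerivAt
          ((ContinuousLinearMap.proj (R := ℝ) (φ := fun _ : Fin 3 => ℝ) k).comp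
        (ContinuousLinearMap.fst ℝ R3 R3))
  have h2 : ∀ k, HasFDerivAt (fun y : R3 × R3 => y.2 k)
      ((ContinuousLinearMap.proj (R := ℝ) (φ := fun _ : Fin 3 => ℝ) k).comp
        (ContinuousLinearMap.snd ℝ R3 R3)) z := fun k => ContinuousLinearMap.hasFDerivAt
          ((ContinuousLinearMap.proj (R := ℝ) (φ := fun _ : Fin 3 => ℝ) k).comp
        (ContinuousLinearMap.snd ℝ R3 R3))
  have hd := (contDiffAt_coords hq hp).differentiableAt (by simp)
  have key : ∀ i, coordsDeriv z w i = fderiv ℝ (fun z : R3 × R3 => M4.coords z.1 z.2 i) z w := by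
    intro i
    rw [coordsDeriv, fderiv_pi (fun i => differentiableAt_pi.1 hd i)]
    rfl
  ext i
  rw [key]
  fin_cases i
  · refine (congrArg (fun l : R3 × R3 →L[ℝ] ℝ => l w) (hasFDerivAt_div (h1 0) (h1 2) hq).fderiv).trans ?_
    simp [div_eq_inv_mul]
  · refine (congrArg (fun l : R3 × R3 →L[ℝ] ℝ => l w) (hasFDerivAt_div (h1 1) (h1 2) hq).fderiv).trans ?_
    simp [div_eq_inv_mul]
  · refine (congrArg (fun l : R3 × R3 →L[ℝ] ℝ => l w) (hasFDerivAt_div (h2 0) (h2 2) hp).fderiv).trans ?_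
    simp [div_eq_inv_mul]
  · refine (congrArg (fun l : R3 × R3 →L[ℝ] ℝ => l w) (hasFDerivAt_div (h2 1) (h2 2) hp).fderiv).trans ?_
    simp [div_eq_inv_mul]

namespace M4

/-- The chart `chart g` as a homeomorphism between open subsets. -/
noncomputable def affineChart (g : SL(3, ℝ)) : OpenPartialHomeomorph M4 R4 :=
  core.openPartialHomeomorph (chart g) ⟨g, rfl⟩

theorem affineChart_mem_atlas (g : SL(3, ℝ)) : affineChart g ∈ atlas R4 M4 :=
  Set.mem_iUnion₂.2 ⟨chart g, ⟨g, rfl⟩, rfl⟩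

/-- The unimodular basis of the preferred chart at `m`. -/
noncomputable def frame (m : M4) : SL(3, ℝ) := (exists_smul_base m).choose

theorem frame_smul_base (m : M4) : m.frame • base = m := (exists_smul_base m).choose_spec

theorem mem_source_hopf {g : SL(3, ℝ)} {u : Q5} :
    hopf u ∈ (affineChart g).source ↔ (g⁻¹ • u).q 2 ≠ 0 ∧ (g⁻¹ • u).p 2 ≠ 0 := by
  have h1 : hopf u ∈ (affineChart g).source ↔ g⁻¹ • hopf u ∈ chart₀.source :=
    ⟨fun H => H.2, fun H => ⟨trivial, H⟩⟩
  rw [h1]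
  unfold hopf
  rw [smul_ofHomog, mem_source_ofHomog]
  rfl

theorem affineChart_hopf (g : SL(3, ℝ)) (u : Q5) :
    affineChart g (hopf u) = coords (g⁻¹ • u).q (g⁻¹ • u).p := by
  show chart₀ (g⁻¹ • hopf u) = _
  unfold hopf
  rw [smul_ofHomog, chart₀_ofHomog]
  rfl

theorem affineChart_target (g : SL(3, ℝ)) :
    (affineChart g).target = {x | homogLine x ⬝ᵥ homogPoint x ≠ 0} := by
  ext x
  exact ⟨fun H => H.1, fun H => ⟨H, trivial⟩⟩

end M4

theorem hopf_smul (g : SL(3, ℝ)) (u : Q5) : hopf (g • u) = g • hopf u := by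
  unfold hopf
  rw [M4.smul_ofHomog]
  rfl

theorem hopf_surjective : Function.Surjective hopf := by
  intro m
  obtain ⟨q, p, h, rfl⟩ := m.exists_ofHomog
  exact ⟨⟨q, p, h⟩, rfl⟩

/-- A point of `Q⁵` above the base point is `(λ e₃, λ⁻¹ e₃)`. -/
theorem eq_of_hopf_eq_base {u : Q5} (h : hopf u = M4.base) :
    ∃ t : ℝ, t ≠ 0 ∧ u.q = ![0, 0, t] ∧ u.p = ![0, 0, t⁻¹] := by
  have h1 := congrArg M4.point h
  have h2 := congrArg M4.line h
  obtain ⟨a, ha⟩ := (Projectivization.mk_eq_mk_iff' ℝ _ _ _ _).1 h1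
  obtain ⟨b, hb⟩ := (Projectivization.mk_eq_mk_iff' ℝ _ _ _ _).1 h2
  have hp := u.pairing
  rw [← ha, ← hb] at hp
  simp at hp
  have ha0 : a ≠ 0 := by rintro rfl; simp at hp
  refine ⟨a, ha0, by rw [← ha]; simp, ?_⟩
  rw [← hb, ← eq_inv_of_mul_eq_one_left hp]; simp

/-- `u` in the basis of the preferred chart at `Π(u)`. -/
theorem exists_frame_inv_smul (u : Q5) : ∃ t : ℝ, t ≠ 0 ∧
    ((hopf u).frame⁻¹ • u).q = ![0, 0, t] ∧ ((hopf u).frame⁻¹ • u).p = ![0, 0, t⁻¹] := by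
  apply eq_of_hopf_eq_base
  rw [hopf_smul, inv_smul_eq_iff, M4.frame_smul_base]

/-! ### Smoothness and differential of `Π` in affine charts -/

namespace Q5

theorem contMDiff_smul (g : SL(3, ℝ)) :
    ContMDiff 𝓘(ℝ, R3 × R2) 𝓘(ℝ, R3 × R2) ∞ (fun u : Q5 => g • u) := fun u =>
  contMDiffAt_iff.2 ((linAct g).contDiff.contMDiff.contMDiffAt.comp u contMDiff_incl.contMDiffAt)

theorem tangentIncl_smul (g : SL(3, ℝ)) (u : Q5) (ξ : R3 × R2) :
    tangentIncl (g • u) (tangentDeriv (R3 × R2) (R3 × R2) (fun u : Q5 => g • u) u ξ) =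
      linAct g (tangentIncl u ξ) := by
  have h1 := tangentDeriv_comp (mdifferentiableAt_incl (g • u))
    ((contMDiff_smul g).contMDiffAt.mdifferentiableAt (x := u) (by simp))
  have h2 := tangentDeriv_comp_incl (u := u) (f := linAct g)
    (linAct g).differentiableAt.mdifferentiableAt
  rw [tangentDeriv_eq_fderiv, (linAct g).fderiv] at h2
  have h3 : incl ∘ (fun u : Q5 => g • u) = linAct g ∘ incl := rfl
  rw [h3, h2] at h1
  exact (congrArg (fun l : R3 × R2 →L[ℝ] R3 × R3 => l ξ) h1).symm

end Q5

theorem contMDiffAt_affineChart_hopf {g : SL(3, ℝ)} {u : Q5}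
    (h : hopf u ∈ (M4.affineChart g).source) :
    ContMDiffAt 𝓘(ℝ, R3 × R2) 𝓘(ℝ, R4) ∞ (M4.affineChart g ∘ hopf) u := by
  rw [M4.mem_source_hopf] at h
  have h1 : (M4.affineChart g ∘ hopf : Q5 → R4) =
      (fun z : R3 × R3 => M4.coords z.1 z.2) ∘ (Q5.incl ∘ fun u : Q5 => g⁻¹ • u) :=
    funext fun u => M4.affineChart_hopf g u
  rw [h1]
  exact ContMDiffAt.comp u (contDiffAt_coords h.1 h.2).contMDiffAt
    (Q5.contMDiff_incl.comp (Q5.contMDiff_smul g⁻¹)).contMDiffAt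

theorem tangentDeriv_affineChart_hopf {g : SL(3, ℝ)} {u : Q5}
    (h : hopf u ∈ (M4.affineChart g).source) (ξ : R3 × R2) :
    tangentDeriv (R3 × R2) R4 (M4.affineChart g ∘ hopf) u ξ =
      coordsDeriv (g⁻¹ • u).incl (linAct g⁻¹ (u.tangentIncl ξ)) := by
  rw [M4.mem_source_hopf] at h
  have h1 : (M4.affineChart g ∘ hopf : Q5 → R4) =
      ((fun z : R3 × R3 => M4.coords z.1 z.2) ∘ Q5.incl) ∘ fun u : Q5 => g⁻¹ • u :=
    funext fun u => M4.affineChart_hopf g u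
  have h2 : MDifferentiableAt 𝓘(ℝ, R3 × R3) 𝓘(ℝ, R4) (fun z : R3 × R3 => M4.coords z.1 z.2)
      (g⁻¹ • u).incl :=
    ((contDiffAt_coords h.1 h.2).differentiableAt (by simp)).mdifferentiableAt
  rw [h1, tangentDeriv_comp (h2.comp _ (Q5.mdifferentiableAt_incl _))
    ((Q5.contMDiff_smul g⁻¹).contMDiffAt.mdifferentiableAt (by simp)),
    Q5.tangentDeriv_comp_incl h2, tangentDeriv_eq_fderiv, ContinuousLinearMap.comp_apply,
    ContinuousLinearMap.comp_apply, Q5.tangentIncl_smul]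
  rfl

theorem isOpen_hopf_preimage_source (g : SL(3, ℝ)) : IsOpen {u | hopf u ∈ (M4.affineChart g).source} := by
  simp only [M4.mem_source_hopf]
  have h1 := (Q5.contMDiff_smul g⁻¹).continuous
  exact (isOpen_ne_fun ((continuous_apply 2).comp (Q5.continuous_q.comp h1)) continuous_const).inter
    (isOpen_ne_fun ((continuous_apply 2).comp (Q5.continuous_p.comp h1)) continuous_const)

theorem contMDiff_hopf : ContMDiff 𝓘(ℝ, R3 × R2) 𝓘(ℝ, R4) ∞ hopf := by
  intro u
  have hu : hopf u ∈ (M4.affineChart (hopf u).frame).source := mem_chart_source R4 (hopf u)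
  refine contMDiffAt_of_eventuallyEq_symm (M4.affineChart_mem_atlas (hopf u).frame)
    (contMDiffAt_affineChart_hopf hu) ((M4.affineChart _).map_source hu) ?_
  filter_upwards [(isOpen_hopf_preimage_source (hopf u).frame).mem_nhds hu] with w hw
  exact ((M4.affineChart _).left_inv hw).symm

theorem mdifferentiableAt_hopf (u : Q5) : MDifferentiableAt 𝓘(ℝ, R3 × R2) 𝓘(ℝ, R4) hopf u :=
  contMDiff_hopf.contMDiffAt.mdifferentiableAt (by simp)

theorem tangentDeriv_hopf (u : Q5) (ξ : R3 × R2) :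
    tangentDeriv (R3 × R2) R4 hopf u ξ = coordsDeriv ((hopf u).frame⁻¹ • u).incl
      (linAct (hopf u).frame⁻¹ (u.tangentIncl ξ)) := by
  rw [tangentDeriv_eq_chartAt_comp (mdifferentiableAt_hopf u)]
  exact tangentDeriv_affineChart_hopf (mem_chart_source R4 (hopf u)) ξ

/-! ### The dancing metric at the origin of a preferred chart -/

/-- `-(dy·dx' + dy'·dx)`. -/
def splitForm (v w : R4) : ℝ := -(v 2 * w 0 + v 3 * w 1 + w 2 * v 0 + w 3 * v 1)

/-- In the frame of `m`, tangency to `Q5` and orthogonality to the fibre force both third components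
of a horizontal vector to vanish. The horizontal lift of `v` to `(t e₃, t⁻¹ e₃)` is therefore `(t
v₀, t v₁, 0; t⁻¹ v₂, t⁻¹ v₃, 0)`. In the scalar product of two lifts `t` cancels, so exactly one
number qualifies in the definition by `Classical.epsilon`. -/
theorem dancingMetric_eq (m : M4) (v w : R4) : dancingMetric m v w = splitForm v w := by
  have H : ∀ {u : Q5}, hopf u = m → ∀ {v : R4} {ξ : R3 × R2}, IsHorizontalLift u v ξ →
      ∃ t : ℝ, t ≠ 0 ∧ (m.frame⁻¹ • u).q = ![0, 0, t] ∧
        linAct m.frame⁻¹ (u.tangentIncl ξ) =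
        (![t * v 0, t * v 1, 0], ![t⁻¹ * v 2, t⁻¹ * v 3, 0]) := by
    rintro u rfl v ξ ⟨hv, hξ⟩
    obtain ⟨t, ht, hq, hp⟩ := exists_frame_inv_smul u
    refine ⟨t, ht, hq, ?_⟩
    set g := (hopf u).frame
    -- The vertical direction: the velocity of `(eʳ𝐪, e⁻ʳ𝐩)` at `r = 0`.
    obtain ⟨τ, hτ⟩ : ∃ τ, u.tangentIncl τ = (u.q, -u.p) := Q5.exists_tangentIncl_eq (by simp)
    have hlin : linAct g⁻¹ (u.q, -u.p) = ((g⁻¹ • u).q, -(g⁻¹ • u).p) := by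
      rw [linAct_apply, Matrix.neg_vecMul]
      rfl
    have h1 : (g⁻¹ • u).incl.1 2 ≠ 0 := by show (g⁻¹ • u).q 2 ≠ 0; rw [hq]; exact ht
    have h2 : (g⁻¹ • u).incl.2 2 ≠ 0 := by
      show (g⁻¹ • u).p 2 ≠ 0; rw [hp]; exact inv_ne_zero ht
    have hvert := hξ τ (by
      rw [tangentDeriv_hopf, hτ, hlin, coordsDeriv_apply h1 h2]
      simp [Q5.incl, hq, hp])
    have htan := u.pairingDeriv_tangentIncl ξ
    change flatMetric (u.tangentIncl ξ) (u.tangentIncl τ) = 0 at hvert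
    rw [← flatMetric_linAct g⁻¹, hτ, hlin] at hvert
    have e1 := linAct_pairing g⁻¹ (u.tangentIncl ξ) u.incl
    have e2 := linAct_pairing g⁻¹ u.incl (u.tangentIncl ξ)
    rw [linAct_incl] at e1 e2
    change _ = (u.tangentIncl ξ).2 ⬝ᵥ u.q at e1
    change _ = u.p ⬝ᵥ (u.tangentIncl ξ).1 at e2
    rw [← e1, ← e2] at htan
    rw [tangentDeriv_hopf, coordsDeriv_apply h1 h2] at hv
    set z := linAct g⁻¹ (u.tangentIncl ξ)
    simp only [Q5.incl, hq, hp] at hv htan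
    rw [hq, hp] at hvert
    simp [flatMetric, dotProduct, Fin.sum_univ_three] at hvert htan
    -- Tangency and orthogonality say that the sum and the difference of `t z.2 2` and `t⁻¹ z.1 2`
    -- vanish.
    have hz1 : z.1 2 = 0 := by
      have : t⁻¹ * z.1 2 = 0 := by linarith
      simpa [ht] using this
    have hz2 : z.2 2 = 0 := by
      have : z.2 2 * t = 0 := by linarith
      simpa [ht] using this
    have hv0 := congrFun hv 0
    have hv1 := congrFun hv 1
    have hv2 := congrFun hv 2
    have hv3 := congrFun hv 3
    simp at hv0 hv1 hv2 hv3
    refine Prod.ext ?_ ?_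
    · ext i; fin_cases i
      · simp [← hv0]; field_simp
      · simp [← hv1]; field_simp
      · exact hz1
    · ext i; fin_cases i
      · simp [← hv2]; field_simp
      · simp [← hv3]; field_simp
      · exact hz2
  -- Existence of lifts: the vector found above is tangent to `Q5`, projects to `v` and is
  -- orthogonal to the fibre.
  have K : ∀ {u : Q5}, hopf u = m → ∀ v : R4, ∃ ξ, IsHorizontalLift u v ξ := by
    rintro u rfl v
    obtain ⟨t, ht, hq, hp⟩ := exists_frame_inv_smul u
    set g := (hopf u).frame
    have h1 : (g⁻¹ • u).incl.1 2 ≠ 0 := by show (g⁻¹ • u).q 2 ≠ 0; rw [hq]; exact ht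
    have h2 : (g⁻¹ • u).incl.2 2 ≠ 0 := by
      show (g⁻¹ • u).p 2 ≠ 0; rw [hp]; exact inv_ne_zero ht
    set z : R3 × R3 := (![t * v 0, t * v 1, 0], ![t⁻¹ * v 2, t⁻¹ * v 3, 0]) with hz
    have hz' := linAct_inv_linAct g z
    obtain ⟨ξ, hξ⟩ : ∃ ξ, u.tangentIncl ξ = linAct g z := by
      apply Q5.exists_tangentIncl_eq (a := (linAct g z).1) (b := (linAct g z).2)
      have e1 := linAct_pairing g⁻¹ (linAct g z) u.incl
      have e2 := linAct_pairing g⁻¹ u.incl (linAct g z)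
      rw [linAct_incl, hz'] at e1 e2
      change _ = (linAct g z).2 ⬝ᵥ u.q at e1
      change _ = u.p ⬝ᵥ (linAct g z).1 at e2
      change z.2 ⬝ᵥ (g⁻¹ • u).q = _ at e1
      change (g⁻¹ • u).p ⬝ᵥ z.1 = _ at e2
      rw [← e1, ← e2, hq, hp]
      simp [hz]
    refine ⟨ξ, ?_, fun τ hτ => ?_⟩
    · rw [tangentDeriv_hopf, hξ, hz', coordsDeriv_apply h1 h2]
      simp only [Q5.incl, hq, hp]
      ext i
      fin_cases i <;> simp [hz] <;> field_simp
    · rw [tangentDeriv_hopf, coordsDeriv_apply h1 h2] at hτ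
      simp only [Q5.incl, hq, hp] at hτ
      show flatMetric (u.tangentIncl ξ) (u.tangentIncl τ) = 0
      rw [← flatMetric_linAct g⁻¹, hξ, hz']
      set y := linAct g⁻¹ (u.tangentIncl τ)
      have hv0 := congrFun hτ 0
      have hv1 := congrFun hτ 1
      have hv2 := congrFun hτ 2
      have hv3 := congrFun hτ 3
      simp [ht] at hv0 hv1 hv2 hv3
      simp [flatMetric, dotProduct, Fin.sum_univ_three, hv0, hv1, hv2, hv3, hz]
  have key : ∀ r : ℝ, (∃ u ξ ζ, hopf u = m ∧ IsHorizontalLift u v ξ ∧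
      IsHorizontalLift u w ζ ∧ metricQ5 u ξ ζ = r) → r = splitForm v w := by
    rintro r ⟨u, ξ, ζ, hu, hξ, hζ, rfl⟩
    obtain ⟨t, ht, hq, h1⟩ := H hu hξ
    obtain ⟨t', ht', hq', h2⟩ := H hu hζ
    -- Both lifts are at the same point `u`, whose third coordinate is the scale.
    obtain rfl : t = t' := by
      have := congrFun (hq.symm.trans hq') 2
      simpa using this
    show flatMetric (u.tangentIncl ξ) (u.tangentIncl ζ) = _
    rw [← flatMetric_linAct m.frame⁻¹, h1, h2]
    simp [flatMetric, splitForm, dotProduct, Fin.sum_univ_three]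
    field_simp
    ring
  apply key
  unfold dancingMetric
  apply Classical.epsilon_spec (p := fun r : ℝ => ∃ u ξ ζ, hopf u = m ∧ IsHorizontalLift u v ξ ∧
    IsHorizontalLift u w ζ ∧ metricQ5 u ξ ζ = r)
  obtain ⟨u, hu⟩ := hopf_surjective m
  obtain ⟨ξ, hξ⟩ := K hu v
  obtain ⟨ζ, hζ⟩ := K hu w
  exact ⟨_, u, ξ, ζ, hu, hξ, hζ, rfl⟩

/-! ### The dancing metric in affine coordinates -/

/-- The pairing of the homogeneous coordinates. -/
def affinePairing (x : R4) : ℝ := 1 + x 0 * x 2 + x 1 * x 3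

theorem homogLine_dotProduct_homogPoint (x : R4) :
    M4.homogLine x ⬝ᵥ M4.homogPoint x = affinePairing x := by
  simp [M4.homogLine, M4.homogPoint, affinePairing, dotProduct, Fin.sum_univ_three]
  ring

theorem mem_affineChart_target {g : SL(3, ℝ)} {x : R4} :
    x ∈ (M4.affineChart g).target ↔ affinePairing x ≠ 0 := by
  rw [M4.affineChart_target, Set.mem_ofPred_eq, homogLine_dotProduct_homogPoint]

theorem differentiable_affinePairing : Differentiable ℝ affinePairing := by
  unfold affinePairing; fun_prop

/-- Homogeneous coordinates of the point with given affine coordinates. -/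
def homogLift (x : R4) : R3 × R3 := (M4.homogPoint x, M4.homogLine x)

/-- The differential of `homogLift`. -/
noncomputable def homogLiftDeriv : R4 →L[ℝ] R3 × R3 :=
  LinearMap.toContinuousLinearMap
    { toFun := fun v => (![v 0, v 1, 0], ![v 2, v 3, 0])
      map_add' := fun v w => by
        refine Prod.ext ?_ ?_ <;> ext i <;> fin_cases i <;> simp
      map_smul' := fun c v => by
        refine Prod.ext ?_ ?_ <;> ext i <;> fin_cases i <;> simp }

theorem homogLiftDeriv_apply (v : R4) :
    homogLiftDeriv v = (![v 0, v 1, 0], ![v 2, v 3, 0]) := rfl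

theorem hasFDerivAt_homogLift (x : R4) : HasFDerivAt homogLift homogLiftDeriv x := by
  have h : homogLift = fun x => homogLiftDeriv x + (![0, 0, 1], ![0, 0, 1]) := by
    funext x
    refine Prod.ext ?_ ?_ <;> ext i <;> fin_cases i <;>
      simp [homogLift, M4.homogPoint, M4.homogLine, homogLiftDeriv_apply]
  rw [h]
  exact homogLiftDeriv.hasFDerivAt.add_const _

theorem affineChart_affineChart_symm (g h : SL(3, ℝ)) {x : R4} (hx : affinePairing x ≠ 0) :
    M4.affineChart h ((M4.affineChart g).symm x) =
      M4.coords (linAct (h⁻¹ * g) (homogLift x)).1 (linAct (h⁻¹ * g) (homogLift x)).2 :=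
  M4.trans_apply (homogLine_dotProduct_homogPoint x ▸ hx)

theorem affineChart_symm_mem_source {g h : SL(3, ℝ)} {x : R4} (hx : affinePairing x ≠ 0) :
    (M4.affineChart g).symm x ∈ (M4.affineChart h).source ↔
      (linAct (h⁻¹ * g) (homogLift x)).1 2 ≠ 0 ∧ (linAct (h⁻¹ * g) (homogLift x)).2 2 ≠ 0 := by
  have h1 := Set.ext_iff.1 (M4.trans_source g h) x
  rw [PartialEquiv.trans_source] at h1
  have h2 : x ∈ (M4.chart g).symm.source := mem_affineChart_target (g := g).2 hx
  have h3 : x ∈ (M4.chart g).symm.source ∩ (M4.chart g).symm ⁻¹' (M4.chart h).source ↔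
    (M4.affineChart g).symm x ∈ (M4.affineChart h).source := ⟨fun H => H.2, fun H => ⟨h2, H⟩⟩
  rw [← h3, h1]
  exact ⟨fun H => H.2, fun H => ⟨homogLine_dotProduct_homogPoint x ▸ hx, H⟩⟩

theorem affineChart_frame_self (m : M4) : M4.affineChart m.frame m = 0 := by
  obtain ⟨u, rfl⟩ := hopf_surjective m
  obtain ⟨t, ht, hq, hp⟩ := exists_frame_inv_smul u
  rw [M4.affineChart_hopf, hq, hp]
  ext i
  fin_cases i <;> simp [M4.coords]

theorem chartAt_self (m : M4) : chartAt R4 m m = 0 := affineChart_frame_self m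

/-- The metric in affine coordinates. -/
noncomputable def affineForm (x v w : R4) : ℝ :=
  -((v 2 * w 0 + v 3 * w 1 + w 2 * v 0 + w 3 * v 1) / affinePairing x -
    ((v 2 * x 0 + v 3 * x 1) * (x 2 * w 0 + x 3 * w 1) +
      (w 2 * x 0 + w 3 * x 1) * (x 2 * v 0 + x 3 * v 1)) / affinePairing x ^ 2)

/-- The passage from the chart `g` to the preferred chart at `m` is the linear action of `k`
followed by affine coordinates. At the origin the metric is `splitForm`, which can be written
through the pairings of the lifted point and the lifted tangent vectors. These pairings are
invariant under `k`, hence can be evaluated in the chart `g`. -/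
theorem dancingMetric_affineChart (g : SL(3, ℝ)) {x : R4} (hx : affinePairing x ≠ 0) (v w : R4) :
    dancingMetric ((M4.affineChart g).symm x)
      (tangentDeriv R4 R4 (M4.affineChart g).symm x v)
      (tangentDeriv R4 R4 (M4.affineChart g).symm x w) = affineForm x v w := by
  set m := (M4.affineChart g).symm x with hm
  set k := m.frame⁻¹ * g with hk
  have hx' : x ∈ (M4.affineChart g).target := mem_affineChart_target.2 hx
  have hsrc : m ∈ (M4.affineChart m.frame).source := mem_chart_source R4 m
  have hc := (affineChart_symm_mem_source hx).1 hsrc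
  have h0 := (affineChart_affineChart_symm g m.frame hx).symm.trans (affineChart_frame_self m)
  rw [← hk] at hc h0
  set z := linAct k (homogLift x) with hz
  have key : ∀ v, tangentDeriv R4 R4 (M4.affineChart g).symm x v =
      coordsDeriv z (linAct k (homogLiftDeriv v)) := by
    intro v
    rw [tangentDeriv_eq_chartAt_comp
      (mdifferentiableAt_chart_symm (M4.affineChart_mem_atlas g) hx')]
    have h1 : chartAt R4 m ∘ (M4.affineChart g).symm =ᶠ[𝓝 x]
        (fun z : R3 × R3 => M4.coords z.1 z.2) ∘ linAct k ∘ homogLift := by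
      filter_upwards [(M4.affineChart g).open_target.mem_nhds hx'] with y hy
      exact affineChart_affineChart_symm g m.frame (mem_affineChart_target.1 hy)
    rw [tangentDeriv_congr h1, tangentDeriv_eq_fderiv]
    have h2 : HasFDerivAt (fun z : R3 × R3 => M4.coords z.1 z.2) (coordsDeriv z) z :=
      ((contDiffAt_coords hc.1 hc.2).differentiableAt (by simp)).hasFDerivAt
    have h3 := h2.comp x ((linAct k).hasFDerivAt.comp x (hasFDerivAt_homogLift x))
    rw [h3.fderiv]
    rfl
  -- In the preferred chart `m` is the origin, so both homogeneous vectors are multiples of `e₃`.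
  have z0 : z.1 0 = 0 ∧ z.1 1 = 0 ∧ z.2 0 = 0 ∧ z.2 1 = 0 := by
    have a0 := congrFun h0 0
    have a1 := congrFun h0 1
    have a2 := congrFun h0 2
    have a3 := congrFun h0 3
    simp [M4.coords, hc.1, hc.2] at a0 a1 a2 a3
    exact ⟨a0, a1, a2, a3⟩
  obtain ⟨z10, z11, z20, z21⟩ := z0
  obtain ⟨hc1, hc2⟩ := hc
  have e0 := linAct_pairing k (homogLift x) (homogLift x)
  have e1 := fun v => linAct_pairing k (homogLiftDeriv v) (homogLift x)
  have e2 := fun v => linAct_pairing k (homogLift x) (homogLiftDeriv v)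
  have e3 := fun v w => linAct_pairing k (homogLiftDeriv v) (homogLiftDeriv w)
  rw [show (homogLift x).2 ⬝ᵥ (homogLift x).1 = affinePairing x from
    homogLine_dotProduct_homogPoint x] at e0
  rw [← hz] at e0 e1 e2
  simp only [homogLiftDeriv_apply] at key e1 e2 e3
  simp [homogLift, M4.homogPoint, M4.homogLine, dotProduct, Fin.sum_univ_three, z10, z11, z20,
    z21] at e0 e1 e2 e3
  have e1v := e1 v
  have e1w := e1 w
  have e2v := e2 v
  have e2w := e2 w
  have e3v := e3 v w
  have e3w := e3 w v
  rw [key v, key w, dancingMetric_eq, coordsDeriv_apply hc1 hc2, coordsDeriv_apply hc1 hc2]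
  set V := linAct k (![v 0, v 1, 0], ![v 2, v 3, 0])
  set W := linAct k (![w 0, w 1, 0], ![w 2, w 3, 0])
  unfold affineForm
  rw [← e1v, ← e1w, ← e2v, ← e2w, ← e0]
  have f1 : v 2 * w 0 + v 3 * w 1 + w 2 * v 0 + w 3 * v 1 =
    V.2 0 * W.1 0 + V.2 1 * W.1 1 + V.2 2 * W.1 2 +
      (W.2 0 * V.1 0 + W.2 1 * V.1 1 + W.2 2 * V.1 2) := by rw [e3v, e3w]; ring
  rw [f1]
  simp [splitForm, z10, z11, z20, z21]
  field_simp
  ring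

/-- The matrix of the metric in affine coordinates. -/
noncomputable def affineMatrix (x : R4) : Matrix (Fin 4) (Fin 4) ℝ :=
  !![0, 0, -(1 + x 1 * x 3) / affinePairing x ^ 2, x 1 * x 2 / affinePairing x ^ 2;
    0, 0, x 0 * x 3 / affinePairing x ^ 2, -(1 + x 0 * x 2) / affinePairing x ^ 2;
    -(1 + x 1 * x 3) / affinePairing x ^ 2, x 0 * x 3 / affinePairing x ^ 2, 0, 0;
    x 1 * x 2 / affinePairing x ^ 2, -(1 + x 0 * x 2) / affinePairing x ^ 2, 0, 0]

/-- The mixed entries are the derivatives `-∂ᵢ∂ⱼ log s` of the potential `-log s`, `s =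
affinePairing`, with `i` and `j` in different factors. -/
theorem metricMatrix_eq (m : M4) {x : R4} (hx : affinePairing x ≠ 0) :
    metricMatrix dancingMetric m x = affineMatrix x := by
  ext i j
  show dancingMetric ((M4.affineChart m.frame).symm x)
      (tangentDeriv R4 R4 (M4.affineChart m.frame).symm x (Pi.single i 1))
      (tangentDeriv R4 R4 (M4.affineChart m.frame).symm x (Pi.single j 1)) = _
  rw [dancingMetric_affineChart _ hx]
  fin_cases i <;> fin_cases j <;> simp [affineForm, affineMatrix] <;> field_simp <;>
    (unfold affinePairing; ring)

/-- The inverse of the matrix of the metric. -/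
noncomputable def affineMatrixInv (x : R4) : Matrix (Fin 4) (Fin 4) ℝ :=
  (-affinePairing x) • !![0, 0, 1 + x 2 * x 0, x 3 * x 0; 0, 0, x 2 * x 1, 1 + x 3 * x 1;
    1 + x 2 * x 0, x 2 * x 1, 0, 0; x 3 * x 0, 1 + x 3 * x 1, 0, 0]

theorem affineMatrix_inv {x : R4} (hx : affinePairing x ≠ 0) :
    (affineMatrix x)⁻¹ = affineMatrixInv x := by
  apply Matrix.inv_eq_right_inv
  ext i j
  fin_cases i <;> fin_cases j <;>
    simp [affineMatrix, affineMatrixInv, Matrix.mul_apply, Fin.sum_univ_four] <;>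
    field_simp <;> (unfold affinePairing; ring)

/-! ### The Levi-Civita connection and the Weyl tensor -/

/-- The index of the coordinate which is paired with the `i`-th one. -/
def dualIndex : Fin 4 → Fin 4 := ![2, 3, 0, 1]

theorem hasFDerivAt_affinePairing (x : R4) : HasFDerivAt affinePairing
    (∑ i, x (dualIndex i) • ContinuousLinearMap.proj (R := ℝ) (φ := fun _ : Fin 4 => ℝ) i) x := by
  have h : ∀ i : Fin 4, HasFDerivAt (fun y : R4 => y i)
    (ContinuousLinearMap.proj (R := ℝ) (φ := fun _ : Fin 4 => ℝ) i) x := fun i =>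
      (ContinuousLinearMap.proj (R := ℝ) (φ := fun _ : Fin 4 => ℝ) i).hasFDerivAt
  refine ((((h 0).mul (h 2)).const_add 1).add ((h 1).mul (h 3))).congr_fderiv ?_
  ext v
  simp [Fin.sum_univ_four, dualIndex]
  ring

/-- Indices of the same factor of `ℝP² × ℝP²*`. -/
def sameFactor : Fin 4 → Fin 4 → Bool :=
  ![![true, true, false, false], ![true, true, false, false], ![false, false, true, true],
    ![false, false, true, true]]

/-- The common form of the coefficients of the metric. -/
noncomputable def affineEntry (c r : ℝ) (a b : Fin 4) (y : R4) : ℝ :=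
  (c + r * (y a * y b)) / affinePairing y ^ 2

theorem pderiv_affineEntry (c r : ℝ) (a b l : Fin 4) {x : R4} (hx : affinePairing x ≠ 0) :
    pderiv l (affineEntry c r a b) x =
      (r * ((if a = l then 1 else 0) * x b + x a * (if b = l then 1 else 0)) * affinePairing x -
        2 * (c + r * (x a * x b)) * x (dualIndex l)) / affinePairing x ^ 3 := by
  have h : ∀ i : Fin 4, HasFDerivAt (fun y : R4 => y i)
    (ContinuousLinearMap.proj (R := ℝ) (φ := fun _ : Fin 4 => ℝ) i) x := fun i =>
      (ContinuousLinearMap.proj (R := ℝ) (φ := fun _ : Fin 4 => ℝ) i).hasFDerivAt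
  have h1 := hasFDerivAt_div ((((h a).mul (h b)).const_mul r).const_add c)
    ((hasFDerivAt_affinePairing x).pow 2) (pow_ne_zero 2 hx)
  refine (congrArg (fun l' : R4 →L[ℝ] ℝ => l' (Pi.single l 1)) h1.fderiv).trans ?_
  simp [Pi.single_apply]
  split_ifs <;> field_simp <;> ring

/-- The tables list `c, r, a, b` for each entry, so that `pderiv_affineEntry` differentiates all
sixteen at once. Where `c = r = 0` the indices `a, b` are irrelevant. -/
theorem affineMatrix_eq_entry (x : R4) (i j : Fin 4) : affineMatrix x i j = affineEntry
    ((!![0, 0, -1, 0; 0, 0, 0, -1; -1, 0, 0, 0; 0, -1, 0, 0] : Matrix (Fin 4) (Fin 4) ℝ) i j)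
    ((!![0, 0, -1, 1; 0, 0, 1, -1; -1, 1, 0, 0; 1, -1, 0, 0] : Matrix (Fin 4) (Fin 4) ℝ) i j)
    ((!![0, 0, 1, 1; 0, 0, 0, 0; 1, 0, 0, 0; 1, 0, 0, 0] : Matrix (Fin 4) (Fin 4) (Fin 4)) i j)
    ((!![0, 0, 3, 2; 0, 0, 3, 2; 3, 3, 0, 0; 2, 2, 0, 0] : Matrix (Fin 4) (Fin 4) (Fin 4)) i j)
    x := by
  fin_cases i <;> fin_cases j <;> simp [affineMatrix, affineEntry] <;> ring

theorem eventually_affinePairing_ne_zero {x : R4} (hx : affinePairing x ≠ 0) :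
    ∀ᶠ y in 𝓝 x, affinePairing y ≠ 0 :=
  differentiable_affinePairing.continuous.continuousAt.eventually_ne hx

theorem pderiv_congr {f f' : R4 → ℝ} {x : R4} (l : Fin 4) (h : f =ᶠ[𝓝 x] f') :
    pderiv l f x = pderiv l f' x := by
  unfold pderiv; rw [h.fderiv_eq]

theorem pderiv_metricMatrix (m : M4) (i j l : Fin 4) {x : R4} (hx : affinePairing x ≠ 0) :
    pderiv l (fun y => metricMatrix dancingMetric m y i j) x = pderiv l (affineEntry
    ((!![0, 0, -1, 0; 0, 0, 0, -1; -1, 0, 0, 0; 0, -1, 0, 0] : Matrix (Fin 4) (Fin 4) ℝ) i j)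
    ((!![0, 0, -1, 1; 0, 0, 1, -1; -1, 1, 0, 0; 1, -1, 0, 0] : Matrix (Fin 4) (Fin 4) ℝ) i j)
    ((!![0, 0, 1, 1; 0, 0, 0, 0; 1, 0, 0, 0; 1, 0, 0, 0] : Matrix (Fin 4) (Fin 4) (Fin 4)) i j)
    ((!![0, 0, 3, 2; 0, 0, 3, 2; 3, 3, 0, 0; 2, 2, 0, 0] : Matrix (Fin 4) (Fin 4) (Fin 4)) i j))
    x := by
  apply pderiv_congr
  filter_upwards [eventually_affinePairing_ne_zero hx] with y hy
  rw [metricMatrix_eq m hy, affineMatrix_eq_entry]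

/-- The Christoffel symbols in affine coordinates. -/
noncomputable def affineChristoffel (k i j : Fin 4) (x : R4) : ℝ :=
  -((if sameFactor i j ∧ j = k then 1 else 0) * x (dualIndex i) +
    (if sameFactor i j ∧ i = k then 1 else 0) * x (dualIndex j)) / affinePairing x

set_option maxHeartbeats 4000000 in
-- For a metric with a potential of this kind, symbols with indices of both factors cancel. Within
-- one factor the symbol is the inverse metric applied to one derivative of the mixed block.
theorem christoffel_eq (m : M4) (k i j : Fin 4) {x : R4} (hx : affinePairing x ≠ 0) :
    christoffel dancingMetric m k i j x = affineChristoffel k i j x := by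
  unfold christoffel
  simp only [pderiv_metricMatrix m _ _ _ hx, pderiv_affineEntry _ _ _ _ _ hx,
    metricMatrix_eq m hx, affineMatrix_inv hx, Fin.sum_univ_four]
  fin_cases i <;> fin_cases j <;> fin_cases k <;>
    simp [affineMatrixInv, affineChristoffel, dualIndex, sameFactor, -mul_eq_zero] <;> field_simp <;>
      (unfold affinePairing; ring)

theorem affinePairing_zero : affinePairing 0 = 1 := by simp [affinePairing]

theorem affinePairing_zero_ne_zero : affinePairing 0 ≠ 0 := by simp [affinePairing]

/-- The metric is even in `x`, so its Christoffel symbols are odd. Each preferred chart is thus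
geodesic to first order at its origin, which simplifies both the curvature and the horizontal lift.
-/
theorem christoffel_zero (m : M4) (k i j : Fin 4) : christoffel dancingMetric m k i j 0 = 0 := by
  rw [christoffel_eq m k i j affinePairing_zero_ne_zero]
  simp [affineChristoffel]

/-- The partial derivatives `∂ₗΓᵏᵢⱼ` at the origin. -/
def christoffelDeriv (l k i j : Fin 4) : ℤ :=
  -((if sameFactor i j ∧ j = k then 1 else 0) * (if dualIndex i = l then 1 else 0) +
    (if sameFactor i j ∧ i = k then 1 else 0) * (if dualIndex j = l then 1 else 0))

/-- The numerator of the symbol vanishes at the origin and `s = 1` there, so only the derivative of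
the numerator contributes. The values are integers, which makes the later tensor identities
decidable. -/
theorem pderiv_christoffel_zero (m : M4) (l k i j : Fin 4) :
    pderiv l (christoffel dancingMetric m k i j) 0 = christoffelDeriv l k i j := by
  have h0 : christoffel dancingMetric m k i j =ᶠ[𝓝 0] affineChristoffel k i j := by
    filter_upwards [eventually_affinePairing_ne_zero affinePairing_zero_ne_zero] with y hy
    exact christoffel_eq m k i j hy
  rw [pderiv_congr l h0]
  have h : ∀ i : Fin 4, HasFDerivAt (fun y : R4 => y i)
    (ContinuousLinearMap.proj (R := ℝ) (φ := fun _ : Fin 4 => ℝ) i) 0 := fun i =>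
      (ContinuousLinearMap.proj (R := ℝ) (φ := fun _ : Fin 4 => ℝ) i).hasFDerivAt
  have h1 := hasFDerivAt_div
    ((((h (dualIndex i)).const_mul (if sameFactor i j ∧ j = k then 1 else 0)).add
    ((h (dualIndex j)).const_mul (if sameFactor i j ∧ i = k then 1 else 0))).neg)
    (hasFDerivAt_affinePairing 0) affinePairing_zero_ne_zero
  refine (congrArg (fun l' : R4 →L[ℝ] ℝ => l' (Pi.single l 1)) h1.fderiv).trans ?_
  simp only [christoffelDeriv]
  clear h0
  split_ifs <;> (simp_all [affinePairing_zero]; try norm_num)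

/-- The components `Rˡₖᵢⱼ` at the origin. -/
def curvatureConst (l k i j : Fin 4) : ℤ := christoffelDeriv i l j k - christoffelDeriv j l i k

/-- The quadratic terms in the Christoffel symbols vanish at the origin. -/
theorem curvature_zero (m : M4) (l k i j : Fin 4) :
    curvature dancingMetric m l k i j 0 = curvatureConst l k i j := by
  unfold curvature
  simp only [pderiv_christoffel_zero, christoffel_zero, curvatureConst]
  simp

/-- The matrix of the metric at the origin. -/
def metricConst : Matrix (Fin 4) (Fin 4) ℤ :=
  !![0, 0, -1, 0; 0, 0, 0, -1; -1, 0, 0, 0; 0, -1, 0, 0]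

theorem metricMatrix_zero (m : M4) (i j : Fin 4) :
    metricMatrix dancingMetric m 0 i j = metricConst i j := by
  rw [metricMatrix_eq m affinePairing_zero_ne_zero]
  fin_cases i <;> fin_cases j <;> simp [affineMatrix, metricConst, affinePairing_zero]

theorem metricMatrix_zero_inv (m : M4) (i j : Fin 4) :
    (metricMatrix dancingMetric m 0)⁻¹ i j = metricConst i j := by
  rw [metricMatrix_eq m affinePairing_zero_ne_zero, affineMatrix_inv affinePairing_zero_ne_zero]
  fin_cases i <;> fin_cases j <;> simp [affineMatrixInv, metricConst, affinePairing_zero]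

/-- The Einstein equation, a finite check on integer components. -/
theorem ricci_zero (m : M4) (j k : Fin 4) :
    ricci dancingMetric m j k 0 = (-3 * metricConst j k : ℤ) := by
  unfold ricci
  simp only [curvature_zero]
  rw [← Int.cast_sum]
  congr 1
  revert j k
  decide

theorem scalarCurvature_zero (m : M4) : scalarCurvature dancingMetric m 0 = -12 := by
  unfold scalarCurvature
  simp only [metricMatrix_zero_inv, ricci_zero, ← Int.cast_mul, ← Int.cast_sum]
  have h : ∑ j, ∑ k, metricConst j k * (-3 * metricConst j k) = -12 := by decide
  rw [h]
  norm_num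

/-- The components of the Weyl tensor at the origin. -/
def weylConst (i j k l : Fin 4) : ℤ :=
  ∑ n, metricConst k n * curvatureConst n l i j +
    (metricConst i k * metricConst j l - metricConst i l * metricConst j k)

/-- With `Ric = -3g` and scalar curvature `-12`, the Ricci and scalar corrections are multiples of
`GᵢₖGⱼₗ - GᵢₗGⱼₖ` with coefficients `3` and `-2`, leaving coefficient `1`. -/
theorem weyl_zero (m : M4) (i j k l : Fin 4) :
    weyl dancingMetric m i j k l 0 = weylConst i j k l := by
  unfold weyl riemann weylConst
  simp only [metricMatrix_zero, ricci_zero, scalarCurvature_zero, curvature_zero]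
  push_cast
  ring

/-! ### Hodge operator, orientation and the Weyl operator at the origin -/

theorem gram_eq (m : M4) : gram dancingMetric m = (metricConst.map (Int.cast : ℤ → ℝ)) := by
  ext i j
  simp only [gram, Matrix.of_apply, dancingMetric_eq, Matrix.map_apply]
  fin_cases i <;> fin_cases j <;> simp [splitForm, metricConst]

theorem gram_inv (m : M4) : (gram dancingMetric m)⁻¹ = gram dancingMetric m := by
  apply Matrix.inv_eq_right_inv
  rw [gram_eq]
  change metricConst.map (Int.castRingHom ℝ) * metricConst.map (Int.castRingHom ℝ) = 1
  rw [← Matrix.map_mul]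
  have : metricConst * metricConst = 1 := by decide
  rw [this, Matrix.map_one _ (map_zero _) (map_one _)]

theorem gram_det (m : M4) : (gram dancingMetric m).det = 1 := by
  rw [gram_eq]
  have h : metricConst.det = 1 := by decide +kernel
  have h2 := (Int.castRingHom ℝ).map_det metricConst
  rw [h] at h2
  simpa using h2.symm

/-- The Gram matrix is minus the permutation that exchanges paired coordinates; raising two indices
makes the signs cancel. -/
theorem raise_eq (m : M4) (β : Matrix (Fin 4) (Fin 4) ℝ) (i j : Fin 4) :
    raise dancingMetric m β i j = β (dualIndex i) (dualIndex j) := by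
  unfold raise
  rw [gram_inv, gram_eq]
  fin_cases i <;> fin_cases j <;>
    simp [Matrix.mul_apply, Fin.sum_univ_four, metricConst, dualIndex]

theorem orientationSign_eq (m : M4) : orientationSign m = 1 := by
  unfold orientationSign
  -- The signs in the last two rows compensate `g(∂₀, ∂₂) = g(∂₁, ∂₃) = -1`; two of them leave the
  -- determinant positive.
  refine if_pos ⟨!![1, 0, 0, 0; 0, 1, 0, 0; 0, 0, -1, 0; 0, 0, 0, -1], ?_, ?_⟩
  · simp [IsSplitNullBasis, dancingMetric_eq, splitForm]
  · have h : (Matrix.of !![1, 0, 0, 0; 0, 1, 0, 0; 0, 0, -1, 0; 0, 0, 0, -1] :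
        Matrix (Fin 4) (Fin 4) ℝ) = Matrix.diagonal ![1, 1, -1, -1] := by
      ext i j; fin_cases i <;> fin_cases j <;> rfl
    rw [h, Matrix.det_diagonal]
    simp [Fin.prod_univ_four]

theorem volCoeff_eq (m : M4) : volCoeff dancingMetric orientationSign m = 1 := by
  simp [volCoeff, gram_det, orientationSign_eq]

/-- The self-dual 2-forms. -/
theorem isSelfDualForm_iff (m : M4) {β : Matrix (Fin 4) (Fin 4) ℝ} (hβ : βᵀ = -β) :
    IsSelfDualForm dancingMetric orientationSign m β ↔
      β 0 3 = 0 ∧ β 1 2 = 0 ∧ β 1 3 = β 0 2 := by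
  have hs : ∀ {α : Matrix (Fin 4) (Fin 4) ℝ}, αᵀ = -α → ∀ i j, α j i = -α i j :=
    fun h i j => congrFun (congrFun h i) j
  unfold IsSelfDualForm
  simp only [volCoeff_eq, formInner, raise_eq, wedge, Fin.sum_univ_four, dualIndex]
  have hb := hs hβ
  have d : ∀ {α : Matrix (Fin 4) (Fin 4) ℝ}, αᵀ = -α → ∀ i, α i i = 0 := fun h i => by
    have := hs h i i
    linarith
  have hd := d hβ
  constructor
  · intro h
    -- Testing against `dx⁰ ∧ dx³`, `dx¹ ∧ dx²` and `dx⁰ ∧ dx²` suffices; the remaining basis forms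
    -- give nothing new.
    have h1 := h (Matrix.single 0 3 1 - Matrix.single 3 0 1) (by
      simp [Matrix.transpose_sub])
    have h2 := h (Matrix.single 1 2 1 - Matrix.single 2 1 1) (by
      simp [Matrix.transpose_sub])
    have h3 := h (Matrix.single 0 2 1 - Matrix.single 2 0 1) (by
      simp [Matrix.transpose_sub])
    simp at h1 h2 h3
    have b1 := hb 0 3
    have b2 := hb 1 2
    have b3 := hb 0 2
    exact ⟨by linarith, by linarith, by linarith⟩
  · rintro ⟨h1, h2, h3⟩ α hα
    have ha := hs hα
    have had := d hα
    simp only [Matrix.cons_val, Matrix.cons_val_zero, Matrix.cons_val_one, had]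
    rw [hb 0 1, hb 0 2, hb 0 3, hb 1 2, hb 1 3, hb 2 3, ha 0 1, ha 0 2, ha 0 3, ha 1 2, ha 1 3,
      ha 2 3, h1, h2, h3]
    ring

/-- The Weyl operator on self-dual 2-forms. -/
theorem wedge_weylOp (m : M4) {β : Matrix (Fin 4) (Fin 4) ℝ} (hβ : βᵀ = -β)
    (h3 : β 1 3 = β 0 2) :
    wedge β (weylOp dancingMetric m β) = 2 * (β 0 1 * β 2 3 + 2 * β 0 2 ^ 2) := by
  have hb : ∀ i j, β j i = -β i j := fun i j => congrFun (congrFun hβ i) j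
  have hd : ∀ i, β i i = 0 := fun i => by
    have := hb i i
    linarith
  -- By these tables `𝒲` multiplies `β₀₁` and `β₂₃` by `1`, and `β₀₂ = β₁₃` by `-2`.
  have w01 : ∀ k l, weylConst 0 1 k l =
    (![![0, 0, 0, 0], ![0, 0, 0, 0], ![0, 0, 0, 1], ![0, 0, -1, 0]] : Fin 4 → Fin 4 → ℤ) k l := by decide
  have w02 : ∀ k l, weylConst 0 2 k l =
    (![![0, 0, 1, 0], ![0, 0, 0, 1], ![-1, 0, 0, 0], ![0, -1, 0, 0]] : Fin 4 → Fin 4 → ℤ) k l := by decide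
  have w03 : ∀ k l, weylConst 0 3 k l = 0 := by decide
  have w12 : ∀ k l, weylConst 1 2 k l = 0 := by decide
  have w13 : ∀ k l, weylConst 1 3 k l =
    (![![0, 0, 1, 0], ![0, 0, 0, 1], ![-1, 0, 0, 0], ![0, -1, 0, 0]] : Fin 4 → Fin 4 → ℤ) k l := by decide
  have w23 : ∀ k l, weylConst 2 3 k l =
    (![![0, 1, 0, 0], ![-1, 0, 0, 0], ![0, 0, 0, 0], ![0, 0, 0, 0]] : Fin 4 → Fin 4 → ℤ) k l := by decide
  simp only [wedge, weylOp, Matrix.of_apply, chartAt_self, weyl_zero, raise_eq, w01, w02, w03, w12,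
    w13, w23]
  simp [Fin.sum_univ_four, dualIndex]
  rw [hb 0 1, hb 0 2, hb 1 3, hb 2 3, h3]
  ring

/-! ### The planes `Π_* 𝒟` -/

/-- Invariance of the volume form: as `det g = 1`, the inverse of `g` is its adjugate, whose entries
are the minors that occur in the cross product. This makes `𝒟` invariant. -/
theorem cross_vecMul_inv (g : SL(3, ℝ)) (a b : R3) :
    (a ⨯₃ b) ᵥ* (g⁻¹).1 = (g.1 *ᵥ a) ⨯₃ (g.1 *ᵥ b) := by
  rw [Matrix.SpecialLinearGroup.coe_inv, Matrix.adjugate_fin_three]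
  ext i
  fin_cases i <;>
    simp [cross_apply, Matrix.vecMul, Matrix.mulVec, dotProduct, Fin.sum_univ_three] <;> ring

theorem linAct_cross (g : SL(3, ℝ)) (u : Q5) (a : R3) :
    linAct g (a, u.q ⨯₃ a) = (g.1 *ᵥ a, (g • u).q ⨯₃ (g.1 *ᵥ a)) :=
  Prod.ext rfl (cross_vecMul_inv g u.q a)

theorem mem_distribution {u : Q5} {ξ : R3 × R2} :
    ξ ∈ distribution u ↔ (u.tangentIncl ξ).2 = u.q ⨯₃ (u.tangentIncl ξ).1 := Iff.rfl

/-- The splitting `ℝ⁴ = ℝ² × ℝ²` into the tangent spaces of `ℝP²` and of `ℝP²*`. -/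
noncomputable def splitting : R4 ≃L[ℝ] R2 × R2 :=
  LinearEquiv.toContinuousLinearEquiv
    { toFun := fun v => (![v 0, v 1], ![v 2, v 3])
      invFun := fun z => ![z.1 0, z.1 1, z.2 0, z.2 1]
      map_add' := fun v w => by
        refine Prod.ext ?_ ?_ <;> ext i <;> fin_cases i <;> simp
      map_smul' := fun c v => by
        refine Prod.ext ?_ ?_ <;> ext i <;> fin_cases i <;> simp
      left_inv := fun v => by ext i; fin_cases i <;> rfl
      right_inv := fun z => by
        refine Prod.ext ?_ ?_ <;> ext i <;> fin_cases i <;> rfl }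

theorem splitting_apply (v : R4) : splitting v = (![v 0, v 1], ![v 2, v 3]) := rfl

/-- The endomorphism of `ℝ²` with the matrix `f`. -/
noncomputable def ofEntries (f : Fin 2 → Fin 2 → ℝ) : R2 →L[ℝ] R2 :=
  ∑ a, ∑ b, f a b • (ContinuousLinearMap.proj (R := ℝ) (φ := fun _ : Fin 2 => ℝ) b).smulRight
    (Pi.single a (1 : ℝ) : R2)

theorem ofEntries_apply (f : Fin 2 → Fin 2 → ℝ) (v : R2) :
    ofEntries f v = ![f 0 0 * v 0 + f 0 1 * v 1, f 1 0 * v 0 + f 1 1 * v 1] := by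
  ext i
  fin_cases i <;> simp [ofEntries]

/-- The common form of the entries of `hopfSlope`. -/
noncomputable def slopeEntry (c r : ℝ) (a b : Fin 3) (z : R3 × R3) : ℝ :=
  (c * (z.1 2 * z.1 2 * z.2 2) + r * (z.1 2 * (z.1 a * z.2 b))) / z.2 2 ^ 2

/-- The matrix of `hopfSlope`. -/
noncomputable def slopeMatrix (z : R3 × R3) : Fin 2 → Fin 2 → ℝ :=
  ![![slopeEntry 0 1 1 0 z, slopeEntry (-1) (-1) 0 0 z],
    ![slopeEntry 1 1 1 1 z, slopeEntry 0 (-1) 0 1 z]]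

/-- The plane `Π_* 𝒟` at `z = (𝐪, 𝐩)` is the graph of this linear map, in affine coordinates. -/
noncomputable def hopfSlope (z : R3 × R3) : R2 →L[ℝ] R2 := ofEntries (slopeMatrix z)

theorem hopfSlope_apply (z : R3 × R3) (d : R2) : hopfSlope z d =
    ![slopeEntry 0 1 1 0 z * d 0 + slopeEntry (-1) (-1) 0 0 z * d 1,
      slopeEntry 1 1 1 1 z * d 0 + slopeEntry 0 (-1) 0 1 z * d 1] := by
  rw [hopfSlope, ofEntries_apply]
  rfl

/-- Let `d` be the affine velocity of `[𝐪]`. Then `a - q₂(d₀, d₁, 0)` is a multiple of `𝐪`, so `𝐪 ×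
a = q₂ 𝐪 × (d₀, d₁, 0)` depends on `d` only. Its projection to the affine coordinates of `[𝐩]` is
`hopfSlope z d`. -/
theorem splitting_coordsDeriv_cross {z : R3 × R3} (hq : z.1 2 ≠ 0) (hp : z.2 2 ≠ 0) (a : R3) :
    splitting (coordsDeriv z (a, z.1 ⨯₃ a)) ∈
      LinearMap.graph (hopfSlope z : R2 →ₗ[ℝ] R2) := by
  rw [LinearMap.mem_graph_iff]
  show _ = hopfSlope z _
  rw [splitting_apply, coordsDeriv_apply hq hp, hopfSlope_apply]
  ext i
  fin_cases i <;> simp [slopeEntry, cross_apply] <;> field_simp <;> ring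

/-- Converse to `splitting_coordsDeriv_cross`. The condition `𝐩a = 0` is exactly tangency of `(a, 𝐪
× a)` to `Q5`, because `(𝐪 × a)𝐪 = 0`. -/
theorem exists_coordsDeriv_cross (w : Q5) (hq : w.q 2 ≠ 0) (hp : w.p 2 ≠ 0) {v : R4}
    (hv : splitting v ∈ LinearMap.graph (hopfSlope w.incl : R2 →ₗ[ℝ] R2)) :
    ∃ a, w.p ⬝ᵥ a = 0 ∧ coordsDeriv w.incl (a, w.q ⨯₃ a) = v := by
  -- The vectors `a` above `(v₀, v₁)` are `q₂(v₀, v₁, 0) + (t/q₂)𝐪`, and `𝐩a = 0` with `𝐩𝐪 = 1`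
  -- determines `t`.
  set t := - w.q 2 ^ 2 * (w.p 0 * v 0 + w.p 1 * v 1) with ht
  refine ⟨![w.q 2 * v 0 + w.q 0 / w.q 2 * t, w.q 2 * v 1 + w.q 1 / w.q 2 * t, t], ?_, ?_⟩
  · have h := w.pairing
    simp only [dotProduct, Fin.sum_univ_three] at h ⊢
    simp
    field_simp
    have : w.q 2 ^ 2 * (w.p 0 * v 0 + w.p 1 * v 1) +
      (w.p 0 * w.q 0 + w.p 1 * w.q 1 + w.p 2 * w.q 2) * t = 0 := by
        rw [h, ht]; ring
    linear_combination this
  · have h1 := splitting_coordsDeriv_cross (z := w.incl) hq hp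
      ![w.q 2 * v 0 + w.q 0 / w.q 2 * t, w.q 2 * v 1 + w.q 1 / w.q 2 * t, t]
    rw [LinearMap.mem_graph_iff] at hv h1
    apply splitting.injective
    refine Prod.ext ?_ ?_
    · rw [splitting_apply, splitting_apply, coordsDeriv_apply hq hp]
      simp [Q5.incl]
      constructor <;> field_simp
    · refine h1.trans (Eq.trans ?_ hv.symm)
      congr 1
      rw [splitting_apply, splitting_apply, coordsDeriv_apply hq hp]
      simp [Q5.incl]
      constructor <;> field_simp

/-- By invariance of `𝒟` the computation for the chart `g` at `u` is the one in standard affine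
coordinates at `g⁻¹ • u`. It holds in every affine chart around `Π(u)`, as needed to vary `u` in a
fixed chart. -/
theorem map_distribution {g : SL(3, ℝ)} {u : Q5} (h : hopf u ∈ (M4.affineChart g).source) :
    (distribution u).map (tangentDeriv (R3 × R2) R4 (M4.affineChart g ∘ hopf) u :
      R3 × R2 →ₗ[ℝ] R4) =
    (LinearMap.graph (hopfSlope (g⁻¹ • u).incl : R2 →ₗ[ℝ] R2)).map
      (splitting.symm : R2 × R2 →ₗ[ℝ] R4) := by
  have h' := M4.mem_source_hopf.1 h
  have hmem : ∀ v : R4, v ∈ (LinearMap.graph (hopfSlope (g⁻¹ • u).incl : R2 →ₗ[ℝ] R2)).map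
      (splitting.symm : R2 × R2 →ₗ[ℝ] R4) ↔
      splitting v ∈ LinearMap.graph (hopfSlope (g⁻¹ • u).incl : R2 →ₗ[ℝ] R2) := by
    intro v
    constructor
    · rintro ⟨z, hz, rfl⟩
      have : splitting (splitting.symm z) = z := splitting.apply_symm_apply z
      exact this.symm ▸ hz
    · exact fun H => ⟨_, H, splitting.symm_apply_apply v⟩
  ext v
  rw [hmem]
  constructor
  · rintro ⟨ξ, hξ, rfl⟩
    have hξ' := mem_distribution.1 hξ
    have e1 : u.tangentIncl ξ = ((u.tangentIncl ξ).1, u.q ⨯₃ (u.tangentIncl ξ).1) :=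
      Prod.ext rfl hξ'
    change splitting (tangentDeriv (R3 × R2) R4 (M4.affineChart g ∘ hopf) u ξ) ∈ _
    rw [tangentDeriv_affineChart_hopf h, e1, linAct_cross]
    exact splitting_coordsDeriv_cross (z := (g⁻¹ • u).incl) h'.1 h'.2 _
  · intro hv
    obtain ⟨a, ha, hav⟩ := exists_coordsDeriv_cross (g⁻¹ • u) h'.1 h'.2 hv
    have e1 : linAct g (a, (g⁻¹ • u).q ⨯₃ a) = (g.1 *ᵥ a, u.q ⨯₃ (g.1 *ᵥ a)) := by
      rw [linAct_cross, smul_inv_smul]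
    obtain ⟨ξ, hξ⟩ : ∃ ξ, u.tangentIncl ξ = (g.1 *ᵥ a, u.q ⨯₃ (g.1 *ᵥ a)) := by
      apply Q5.exists_tangentIncl_eq
      have e2 := linAct_pairing g (g⁻¹ • u).incl (a, (g⁻¹ • u).q ⨯₃ a)
      rw [linAct_incl, smul_inv_smul, e1] at e2
      change u.p ⬝ᵥ (g.1 *ᵥ a) = (g⁻¹ • u).p ⬝ᵥ a at e2
      rw [e2, ha, dotProduct_comm, dot_self_cross, add_zero]
    refine ⟨ξ, ?_, ?_⟩
    · show (u.tangentIncl ξ).2 = _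
      rw [show tangentDeriv (R3 × R2) (R3 × R3) Q5.incl u ξ = u.tangentIncl ξ from rfl, hξ]
    · change tangentDeriv (R3 × R2) R4 (M4.affineChart g ∘ hopf) u ξ = v
      rw [tangentDeriv_affineChart_hopf h, hξ, ← e1, linAct_inv_linAct]
      exact hav

theorem hopf_mem_source_frame (u : Q5) : hopf u ∈ (M4.affineChart (hopf u).frame).source :=
  mem_chart_source R4 (hopf u)

theorem map_distribution_hopf (u : Q5) :
    (distribution u).map (tangentDeriv (R3 × R2) R4 hopf u : R3 × R2 →ₗ[ℝ] R4) =
    (LinearMap.graph (hopfSlope ((hopf u).frame⁻¹ • u).incl : R2 →ₗ[ℝ] R2)).map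
      (splitting.symm : R2 × R2 →ₗ[ℝ] R4) := by
  rw [tangentDeriv_eq_chartAt_comp (mdifferentiableAt_hopf u)]
  exact map_distribution (hopf_mem_source_frame u)

/-- The map `ν`, `ν(u) = Π_* 𝒟ᵤ`. -/
noncomputable def twistorLift (u : Q5) : TwoPlane M4 where
  pt := hopf u
  plane := (distribution u).map (tangentDeriv (R3 × R2) R4 hopf u : R3 × R2 →ₗ[ℝ] R4)
  finrank_plane := by
    rw [map_distribution_hopf]
    exact TwoPlane.finrank_graphIn splitting _

/-- The plane `ν(u)` in the preferred chart. -/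
theorem exists_mem_twistorLift (u : Q5) : ∃ t : ℝ, t ≠ 0 ∧
    ((hopf u).frame⁻¹ • u).q = ![0, 0, t] ∧ ((hopf u).frame⁻¹ • u).p = ![0, 0, t⁻¹] ∧
    ∀ v : R4, v ∈ (twistorLift u).plane ↔ v 2 = -t ^ 3 * v 1 ∧ v 3 = t ^ 3 * v 0 := by
  obtain ⟨t, ht, hq, hp⟩ := exists_frame_inv_smul u
  refine ⟨t, ht, hq, hp, fun v => ?_⟩
  have h1 : (twistorLift u).plane = _ := map_distribution_hopf u
  -- At `𝐪 = t e₃`, `𝐩 = t⁻¹ e₃` only the terms `∓q₂²/p₂ = ∓t³` of the slope survive.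
  have h2 : ∀ d, hopfSlope ((hopf u).frame⁻¹ • u).incl d = ![-t ^ 3 * d 1, t ^ 3 * d 0] := by
    intro d
    rw [hopfSlope_apply]
    ext i
    fin_cases i <;> simp [slopeEntry, Q5.incl, hq, hp, -mul_eq_mul_right_iff] <;> field_simp
  have h3 : v ∈ (twistorLift u).plane ↔
      splitting v ∈ LinearMap.graph (hopfSlope ((hopf u).frame⁻¹ • u).incl : R2 →ₗ[ℝ] R2) := by
    rw [h1]
    constructor
    · rintro ⟨z, hz, rfl⟩
      have : splitting (splitting.symm z) = z := splitting.apply_symm_apply z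
      exact this.symm ▸ hz
    · exact fun H => ⟨_, H, splitting.symm_apply_apply v⟩
  rw [h3, LinearMap.mem_graph_iff, splitting_apply]
  change ![v 2, v 3] = hopfSlope _ _ ↔ _
  rw [h2]
  simp

/-! ### Self-dual null planes of the dancing metric -/

theorem transpose_of_plucker (θ : Fin 2 → R4) :
    (Matrix.of fun i j => θ 0 i * θ 1 j - θ 0 j * θ 1 i)ᵀ =
      -(Matrix.of fun i j => θ 0 i * θ 1 j - θ 0 j * θ 1 i : Matrix (Fin 4) (Fin 4) ℝ) := by
  ext i j
  simp

theorem IsPluckerForm.transpose {W : Submodule ℝ R4} {β : Matrix (Fin 4) (Fin 4) ℝ}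
    (h : IsPluckerForm W β) : βᵀ = -β := by
  obtain ⟨θ, -, -, rfl⟩ := h
  exact transpose_of_plucker θ

theorem IsPluckerForm.plucker {W : Submodule ℝ R4} {β : Matrix (Fin 4) (Fin 4) ℝ}
    (h : IsPluckerForm W β) : β 0 1 * β 2 3 - β 0 2 * β 1 3 + β 0 3 * β 1 2 = 0 := by
  obtain ⟨θ, -, -, rfl⟩ := h
  simp only [Matrix.of_apply]
  ring

theorem IsPluckerForm.mulVec {W : Submodule ℝ R4} {β : Matrix (Fin 4) (Fin 4) ℝ}
    (h : IsPluckerForm W β) {w : R4} (hw : w ∈ W) : β *ᵥ w = 0 := by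
  obtain ⟨θ, -, hθ, rfl⟩ := h
  have h0 := hθ 0 w hw
  have h1 := hθ 1 w hw
  ext i
  simp only [Matrix.mulVec, dotProduct, Matrix.of_apply, Fin.sum_univ_four, Pi.zero_apply] at h0 h1 ⊢
  linear_combination θ 0 i * h1 - θ 1 i * h0

/-- On self-dual forms the Plücker relation becomes `β₀₁β₂₃ = β₀₂²`, so `β₀₂` alone detects
principal planes. -/
theorem wedge_weylOp_of_isSelfDualForm {m : M4} {W : Submodule ℝ R4}
    {β : Matrix (Fin 4) (Fin 4) ℝ} (h : IsPluckerForm W β)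
    (hsd : IsSelfDualForm dancingMetric orientationSign m β) :
    wedge β (weylOp dancingMetric m β) = 6 * β 0 2 ^ 2 ∧ β 0 1 * β 2 3 = β 0 2 ^ 2 := by
  obtain ⟨h1, h2, h3⟩ := (isSelfDualForm_iff m h.transpose).1 hsd
  have hp := h.plucker
  rw [wedge_weylOp m h.transpose h3]
  rw [h1, h2, h3] at hp
  constructor <;> linarith

/-- A non-principal self-dual 2-plane is the graph of a multiple of the rotation by a right
angle. -/
theorem exists_eq_of_not_isPrincipal {W : TwoPlane M4}
    (hsd : IsSelfDual dancingMetric orientationSign W) (hnull : IsNull dancingMetric W)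
    (h : ¬ IsPrincipal dancingMetric W) :
    ∃ a : ℝ, a ≠ 0 ∧ ∀ v ∈ W.plane, v 2 = -a * v 1 ∧ v 3 = a * v 0 := by
  unfold IsPrincipal at h
  push Not at h
  obtain ⟨β, hβ, hne⟩ := h hnull
  obtain ⟨h1, h2⟩ := wedge_weylOp_of_isSelfDualForm hβ (hsd β hβ)
  obtain ⟨h03, h12, h13⟩ := (isSelfDualForm_iff W.pt hβ.transpose).1 (hsd β hβ)
  rw [h1] at hne
  have hc : β 0 2 ≠ 0 := fun H => hne (by rw [H]; ring)
  -- Otherwise the Plücker relation would give `β₀₂ = 0`.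
  have hb : β 0 1 ≠ 0 := fun H => by
    rw [H, zero_mul] at h2
    exact hc (pow_eq_zero_iff two_ne_zero |>.1 h2.symm)
  have hs : ∀ i j, β j i = -β i j := fun i j => congrFun (congrFun hβ.transpose i) j
  have h00 : β 0 0 = 0 := by have := hs 0 0; linarith
  have h11 : β 1 1 = 0 := by have := hs 1 1; linarith
  -- Rows `0` and `1` of `βv = 0` read `β₀₁v₁ + β₀₂v₂ = 0` and `-β₀₁v₀ + β₀₂v₃ = 0`.
  refine ⟨β 0 1 / β 0 2, div_ne_zero hb hc, fun v hv => ?_⟩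
  have hv' := hβ.mulVec hv
  have e0 := congrFun hv' 0
  have e1 := congrFun hv' 1
  simp only [Matrix.mulVec, dotProduct, Fin.sum_univ_four, Pi.zero_apply, h00, h11, h03, h12, h13,
    hs 0 1] at e0 e1
  constructor
  · field_simp; linarith
  · field_simp; linarith

/-- The plane of the vectors `(d₀, d₁, -a d₁, a d₀)`. -/
theorem isPluckerForm_rotation {W : Submodule ℝ R4} {a : ℝ} 
    (hW : ∀ v ∈ W, v 2 = -a * v 1 ∧ v 3 = a * v 0) :
    IsPluckerForm W (Matrix.of fun i j => (![![0, a, 1, 0], ![-a, 0, 0, 1]] : Fin 2 → R4) 0 i *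
      (![![0, a, 1, 0], ![-a, 0, 0, 1]] : Fin 2 → R4) 1 j -
      (![![0, a, 1, 0], ![-a, 0, 0, 1]] : Fin 2 → R4) 0 j *
      (![![0, a, 1, 0], ![-a, 0, 0, 1]] : Fin 2 → R4) 1 i) := by
  refine ⟨![![0, a, 1, 0], ![-a, 0, 0, 1]], ?_, ?_, rfl⟩
  · rw [LinearIndependent.pair_iff]
    intro s t h
    have h2 := congrFun h 2
    have h3 := congrFun h 3
    simp at h2 h3
    exact ⟨h2, h3⟩
  · intro i w hw
    obtain ⟨h1, h2⟩ := hW w hw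
    fin_cases i <;> simp [dotProduct, Fin.sum_univ_four, h1, h2]

theorem isNull_twistorLift (u : Q5) : IsNull dancingMetric (twistorLift u) := by
  obtain ⟨t, -, -, -, h⟩ := exists_mem_twistorLift u
  intro v hv w hw
  obtain ⟨h1, h2⟩ := (h v).1 hv
  obtain ⟨h3, h4⟩ := (h w).1 hw
  rw [dancingMetric_eq, splitForm, h1, h2, h3, h4]
  ring

theorem isSelfDual_twistorLift (u : Q5) :
    IsSelfDual dancingMetric orientationSign (twistorLift u) := by
  obtain ⟨t, ht, -, -, h⟩ := exists_mem_twistorLift u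
  intro β hβ
  have hs : ∀ i j, β j i = -β i j := fun i j => congrFun (congrFun hβ.transpose i) j
  have h00 : β 0 0 = 0 := by have := hs 0 0; linarith
  have h11 : β 1 1 = 0 := by have := hs 1 1; linarith
  have ha : t ^ 3 ≠ 0 := pow_ne_zero 3 ht
  -- These two vectors span the plane. The first two rows of `βw = 0` for each of them give `β₀₃ =
  -- β₁₂ = 0` and `β₁₃ = β₀₂ = β₀₁/t³`.
  have w1 := hβ.mulVec ((h ![1, 0, 0, t ^ 3]).2 (by simp))
  have w2 := hβ.mulVec ((h ![0, 1, -t ^ 3, 0]).2 (by simp))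
  have e0 := congrFun w1 0
  have e1 := congrFun w1 1
  have e2 := congrFun w2 0
  have e3 := congrFun w2 1
  simp only [Matrix.mulVec, dotProduct, Fin.sum_univ_four, Pi.zero_apply, h00, h11, hs 0 1,
    Matrix.cons_val] at e0 e1 e2 e3
  refine (isSelfDualForm_iff _ hβ.transpose).2 ⟨?_, ?_, ?_⟩
  · exact mul_right_cancel₀ ha (by linarith)
  · exact mul_right_cancel₀ ha (by linarith)
  · exact mul_right_cancel₀ ha (by linarith)

theorem not_isPrincipal_twistorLift (u : Q5) : ¬ IsPrincipal dancingMetric (twistorLift u) := by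
  obtain ⟨t, ht, -, -, h⟩ := exists_mem_twistorLift u
  rintro ⟨-, hP⟩
  have hβ := isPluckerForm_rotation (W := (twistorLift u).plane) (a := t ^ 3)
    fun v hv => by simpa using (h v).1 hv
  have h1 := (wedge_weylOp_of_isSelfDualForm hβ (isSelfDual_twistorLift u _ hβ)).1
  rw [hP _ hβ] at h1
  simp [ht] at h1

theorem twistorLift_mem (u : Q5) : twistorLift u ∈ nonPrincipalTwistorSpace :=
  ⟨⟨isNull_twistorLift u, isSelfDual_twistorLift u⟩, not_isPrincipal_twistorLift u⟩

/-! ### Equivariance -/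

/-- The coordinates of `g • m'` in the chart `h` are those of `m'` in the chart `g⁻¹ * h`: in
suitable charts the action is the identity. -/
theorem M4.contMDiff_smul (g : SL(3, ℝ)) :
    ContMDiff 𝓘(ℝ, R4) 𝓘(ℝ, R4) ∞ (fun m : M4 => g • m) := by
  intro m
  set h := (g • m).frame
  have e : ∀ m' : M4, M4.affineChart h (g • m') = M4.affineChart (g⁻¹ * h) m' := by
    intro m'
    show M4.chart₀ (h⁻¹ • g • m') = M4.chart₀ ((g⁻¹ * h)⁻¹ • m')
    rw [mul_inv_rev, inv_inv, smul_smul]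
  have es : ∀ m' : M4, g • m' ∈ (M4.affineChart h).source ↔
      m' ∈ (M4.affineChart (g⁻¹ * h)).source := by
    intro m'
    show (_ ∧ h⁻¹ • g • m' ∈ M4.chart₀.source) ↔ (_ ∧ (g⁻¹ * h)⁻¹ • m' ∈ M4.chart₀.source)
    rw [mul_inv_rev, inv_inv, smul_smul]
    rfl
  have hm : g • m ∈ (M4.affineChart h).source := mem_chart_source R4 (g • m)
  have hm' := (es m).1 hm
  refine contMDiffAt_of_eventuallyEq_symm (M4.affineChart_mem_atlas h)
    (contMDiffAt_of_mem_maximalAtlas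
      (mem_maximalAtlas (M4.affineChart_mem_atlas (g⁻¹ * h))) hm') ?_ ?_
  · rw [← e]
    exact (M4.affineChart h).map_source hm
  · filter_upwards [(M4.affineChart (g⁻¹ * h)).open_source.mem_nhds hm'] with m' hm'
    rw [Function.comp_apply, ← e]
    exact ((M4.affineChart h).left_inv ((es m').2 hm')).symm

theorem map_distribution_smul (g : SL(3, ℝ)) (u : Q5) :
    (distribution u).map (tangentDeriv (R3 × R2) (R3 × R2) (fun u : Q5 => g • u) u :
      R3 × R2 →ₗ[ℝ] R3 × R2) ≤ distribution (g • u) := by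
  rintro _ ⟨ξ, hξ, rfl⟩
  rw [mem_distribution]
  change (Q5.tangentIncl (g • u)
    (tangentDeriv (R3 × R2) (R3 × R2) (fun u : Q5 => g • u) u ξ)).2 = _ ⨯₃ (Q5.tangentIncl (g • u)
    (tangentDeriv (R3 × R2) (R3 × R2) (fun u : Q5 => g • u) u ξ)).1
  rw [Q5.tangentIncl_smul]
  have e1 : u.tangentIncl ξ = ((u.tangentIncl ξ).1, u.q ⨯₃ (u.tangentIncl ξ).1) :=
    Prod.ext rfl (mem_distribution.1 hξ)
  rw [e1, linAct_cross]

/-- The chain rule for `Π ∘ g = g ∘ Π` and the invariance of `𝒟` give one inclusion. Both planes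
have dimension two, since the differential of `g` has that of `g⁻¹` as a left inverse. -/
theorem twistorLift_smul (g : SL(3, ℝ)) (u : Q5) :
    (twistorLift (g • u)).plane = (twistorLift u).plane.map
      (tangentDeriv R4 R4 (fun m : M4 => g • m) (twistorLift u).pt : R4 →ₗ[ℝ] R4) := by
  have d1 := (M4.contMDiff_smul g).contMDiffAt.mdifferentiableAt (x := hopf u) (by simp)
  have d2 := (Q5.contMDiff_smul g).contMDiffAt.mdifferentiableAt (x := u) (by simp)
  have h1 := tangentDeriv_comp d1 (mdifferentiableAt_hopf u)
  have h2 := tangentDeriv_comp (mdifferentiableAt_hopf (g • u)) d2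
  have h3 : (fun m : M4 => g • m) ∘ hopf = hopf ∘ fun u : Q5 => g • u :=
    funext fun u => (hopf_smul g u).symm
  rw [h3, h2] at h1
  have h4 : Function.Injective (tangentDeriv R4 R4 (fun m : M4 => g • m) (hopf u)) := by
    have d3 := (M4.contMDiff_smul g⁻¹).contMDiffAt.mdifferentiableAt (x := g • hopf u) (by simp)
    have h5 := tangentDeriv_comp d3 d1
    have h6 : (fun m : M4 => g⁻¹ • m) ∘ (fun m : M4 => g • m) = id :=
      funext fun m => inv_smul_smul g m
    have h7 : tangentDeriv R4 R4 (id : M4 → M4) (hopf u) = ContinuousLinearMap.id ℝ R4 := mfderiv_id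
    rw [h6, h7] at h5
    intro a b hab
    have := congrArg (tangentDeriv R4 R4 (fun m : M4 => g⁻¹ • m) (g • hopf u)) hab
    rw [← ContinuousLinearMap.comp_apply, ← ContinuousLinearMap.comp_apply, ← h5] at this
    exact this
  have h8 : (twistorLift u).plane.map
      (tangentDeriv R4 R4 (fun m : M4 => g • m) (hopf u) : R4 →ₗ[ℝ] R4) ≤
      (twistorLift (g • u)).plane := by
    rintro _ ⟨_, ⟨ξ, hξ, rfl⟩, rfl⟩
    exact ⟨_, map_distribution_smul g u ⟨ξ, hξ, rfl⟩,
      congrArg (fun l : R3 × R2 →L[ℝ] R4 => l ξ) h1⟩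
  refine (Submodule.eq_of_le_of_finrank_eq h8 ?_).symm
  rw [(twistorLift (g • u)).finrank_plane]
  exact TwoPlane.finrank_map (twistorLift u).finrank_plane h4

/-! ### Bijectivity -/

/-- The real cube root. -/
noncomputable def cbrt (x : ℝ) : ℝ := x * (x ^ 2) ^ (-(1 / 3) : ℝ)

theorem cbrt_pow_three (t : ℝ) : cbrt (t ^ 3) = t := by
  rcases eq_or_ne t 0 with rfl | ht
  · simp [cbrt]
  have h1 : 0 < t ^ 2 := by positivity
  have h2 : ((t ^ 3) ^ 2) ^ (-(1 / 3) : ℝ) = (t ^ 2)⁻¹ := by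
    rw [show (t ^ 3) ^ 2 = (t ^ 2) ^ (3 : ℝ) by norm_cast; ring, ← Real.rpow_mul h1.le]
    norm_num
    rw [Real.rpow_neg_one]
  rw [cbrt, h2]
  field_simp

theorem cbrt_pow {x : ℝ} (hx : x ≠ 0) : cbrt x ^ 3 = x := by
  have h1 : 0 < x ^ 2 := by positivity
  have h2 : ((x ^ 2) ^ (-(1 / 3) : ℝ)) ^ 3 = (x ^ 2)⁻¹ := by
    rw [← Real.rpow_natCast, ← Real.rpow_mul h1.le]
    norm_num
    rw [Real.rpow_neg_one]
  rw [cbrt, mul_pow, h2]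
  field_simp

/-- Written as `x (x²)^(-1/3)`, the cube root involves a real power of a positive base only, for
both signs of `x`. -/
theorem contDiffAt_cbrt {x : ℝ} (hx : x ≠ 0) : ContDiffAt ℝ ∞ cbrt x :=
  contDiffAt_id.mul ((contDiffAt_id.pow 2).rpow_const_of_ne (pow_ne_zero 2 hx))

theorem twistorLift_injective : Function.Injective twistorLift := by
  intro u u' h
  obtain ⟨t, ht, hq, hp, hm⟩ := exists_mem_twistorLift u
  obtain ⟨t', ht', hq', hp', hm'⟩ := exists_mem_twistorLift u'
  have h1 : hopf u = hopf u' := congrArg TwoPlane.pt h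
  rw [← h1] at hq' hp'
  rw [← h] at hm'
  -- The vector `(1, 0, 0, t³)` of the common plane recovers `t³`; then `t` and the base point
  -- determine `u`.
  have h2 := ((hm' _).1 ((hm ![1, 0, 0, t ^ 3]).2 (by simp))).2
  simp only [Matrix.cons_val, mul_one] at h2
  have h3 : t = t' := by rw [← cbrt_pow_three t, h2, cbrt_pow_three]
  subst h3
  have h4 : (hopf u).frame⁻¹ • u = (hopf u).frame⁻¹ • u' :=
    Q5.ext (hq.trans hq'.symm) (hp.trans hp'.symm)
  exact smul_left_cancel _ h4

theorem twistorLift_surjOn {W : TwoPlane M4} (hW : W ∈ nonPrincipalTwistorSpace) :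
    ∃ u, twistorLift u = W := by
  obtain ⟨⟨hn, hsd⟩, hp⟩ := hW
  obtain ⟨a, ha, h⟩ := exists_eq_of_not_isPrincipal hsd hn hp
  have hc : cbrt a ≠ 0 := fun H => ha (by rw [← cbrt_pow ha, H]; ring)
  -- The scale must be `cbrt a`, because `ν` has rotation coefficient `t³` at `(t e₃, t⁻¹ e₃)`.
  set w : Q5 := ⟨![0, 0, cbrt a], ![0, 0, (cbrt a)⁻¹], by simp [hc]⟩ with hw
  have hwb : hopf w = M4.base := by
    ext1
    · exact (Projectivization.mk_eq_mk_iff' ℝ _ _ _ _).2 ⟨cbrt a, by simp [hw]⟩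
    · exact (Projectivization.mk_eq_mk_iff' ℝ _ _ _ _).2 ⟨(cbrt a)⁻¹, by simp [hw]⟩
  set u := W.pt.frame • w with hu
  have hpt : hopf u = W.pt := by rw [hu, hopf_smul, hwb, M4.frame_smul_base]
  refine ⟨u, TwoPlane.ext' hpt ?_⟩
  obtain ⟨t, ht, hq, -, hm⟩ := exists_mem_twistorLift u
  rw [hpt, hu, inv_smul_smul] at hq
  have hta : cbrt a = t := by simpa [hw] using congrFun hq 2
  symm
  apply Submodule.eq_of_le_of_finrank_eq
  · intro v hv
    rw [hm, ← hta, cbrt_pow ha]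
    exact h v hv
  · rw [W.finrank_plane, (twistorLift u).finrank_plane]

theorem bijOn_twistorLift : Set.BijOn twistorLift Set.univ nonPrincipalTwistorSpace :=
  ⟨fun u _ => twistorLift_mem u, twistorLift_injective.injOn, fun W hW => by
    obtain ⟨u, rfl⟩ := twistorLift_surjOn hW
    exact ⟨u, trivial, rfl⟩⟩

/-! ### Smoothness -/

/-- A chart of the bundle of 2-planes as a homeomorphism between open subsets. -/
noncomputable def planeChart {M : Type*} [TopologicalSpace M] [ChartedSpace R4 M]
    [IsManifold 𝓘(ℝ, R4) ∞ M] (i : atlas R4 M) (L : R4 ≃L[ℝ] R2 × R2) :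
    OpenPartialHomeomorph (TwoPlane M) (R4 × (R2 →L[ℝ] R2)) :=
  (TwoPlane.core M).openPartialHomeomorph (TwoPlane.chart i L) ⟨i, L, rfl⟩

theorem planeChart_mem_atlas {M : Type*} [TopologicalSpace M] [ChartedSpace R4 M]
    [IsManifold 𝓘(ℝ, R4) ∞ M] (i : atlas R4 M) (L : R4 ≃L[ℝ] R2 × R2) :
    planeChart i L ∈ atlas (R4 × (R2 →L[ℝ] R2)) (TwoPlane M) :=
  Set.mem_iUnion₂.2 ⟨TwoPlane.chart i L, ⟨i, L, rfl⟩, rfl⟩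

/-- The chart `affineChart g` as an element of the atlas. -/
noncomputable def M4.atlasChart (g : SL(3, ℝ)) : atlas R4 M4 :=
  ⟨M4.affineChart g, M4.affineChart_mem_atlas g⟩

/-- For smoothness, nearby planes have to be read in one fixed chart `g` and not in the preferred
chart of each base point. The change of components turns the differential of `Π` into that of
`affineChart g ∘ Π`. -/
theorem map_planeIn_twistorLift {g : SL(3, ℝ)} {u : Q5}
    (h : hopf u ∈ (M4.affineChart g).source) :
    (TwoPlane.planeIn (M4.atlasChart g) (twistorLift u)).map (splitting : R4 →ₗ[ℝ] R2 × R2) =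
      LinearMap.graph (hopfSlope (g⁻¹ • u).incl : R2 →ₗ[ℝ] R2) := by
  have h1 : TwoPlane.planeIn (M4.atlasChart g) (twistorLift u) =
      (distribution u).map (tangentDeriv (R3 × R2) R4 (M4.affineChart g ∘ hopf) u :
        R3 × R2 →ₗ[ℝ] R4) := by
    have h2 := tangentDeriv_atlas_comp (M4.atlasChart g) (mdifferentiableAt_hopf u) h
    change tangentDeriv (R3 × R2) R4 (M4.affineChart g ∘ hopf) u = _ at h2
    rw [h2]
    exact (Submodule.map_comp _ _ _).symm
  rw [h1, map_distribution h, ← Submodule.map_comp]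
  exact TwoPlane.map_eq_self splitting.apply_symm_apply _

theorem twistorLift_mem_source {g : SL(3, ℝ)} {u : Q5} (h : hopf u ∈ (M4.affineChart g).source) :
    twistorLift u ∈ (planeChart (M4.atlasChart g) splitting).source :=
  ⟨h, _, map_planeIn_twistorLift h⟩

theorem planeChart_twistorLift {g : SL(3, ℝ)} {u : Q5}
    (h : hopf u ∈ (M4.affineChart g).source) :
    planeChart (M4.atlasChart g) splitting (twistorLift u) =
      (M4.affineChart g (hopf u), hopfSlope (g⁻¹ • u).incl) :=
  Prod.ext rfl (TwoPlane.slope_eq (map_planeIn_twistorLift h))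

theorem contDiffAt_slopeEntry (c r : ℝ) (a b : Fin 3) {z : R3 × R3} (hp : z.2 2 ≠ 0) :
    ContDiffAt ℝ ∞ (slopeEntry c r a b) z := by
  have h1 : ∀ k, ContDiffAt ℝ ∞ (fun y : R3 × R3 => y.1 k) z :=
    fun k => (contDiff_pi.1 contDiff_fst k).contDiffAt
  have h2 : ∀ k, ContDiffAt ℝ ∞ (fun y : R3 × R3 => y.2 k) z :=
    fun k => (contDiff_pi.1 contDiff_snd k).contDiffAt
  exact ((contDiffAt_const.mul (((h1 2).mul (h1 2)).mul (h2 2))).add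
    (contDiffAt_const.mul ((h1 2).mul ((h1 a).mul (h2 b))))).div ((h2 2).pow 2) (pow_ne_zero 2 hp)

theorem contDiffAt_slopeMatrix {z : R3 × R3} (hp : z.2 2 ≠ 0) (a b : Fin 2) :
    ContDiffAt ℝ ∞ (fun z => slopeMatrix z a b) z := by
  fin_cases a <;> fin_cases b <;> exact contDiffAt_slopeEntry _ _ _ _ hp

theorem contDiffAt_hopfSlope {z : R3 × R3} (hp : z.2 2 ≠ 0) : ContDiffAt ℝ ∞ hopfSlope z := by
  unfold hopfSlope ofEntries
  exact ContDiffAt.sum fun a _ => ContDiffAt.sum fun b _ =>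
    (contDiffAt_slopeMatrix hp a b).smul contDiffAt_const

theorem contMDiffAt_hopfSlope {g : SL(3, ℝ)} {u : Q5}
    (h : hopf u ∈ (M4.affineChart g).source) :
    ContMDiffAt 𝓘(ℝ, R3 × R2) 𝓘(ℝ, R2 →L[ℝ] R2) ∞ (fun u : Q5 => hopfSlope (g⁻¹ • u).incl) u :=
  ContMDiffAt.comp (g := hopfSlope) u (contDiffAt_hopfSlope (M4.mem_source_hopf.1 h).2).contMDiffAt
    (Q5.contMDiff_incl.comp (Q5.contMDiff_smul g⁻¹)).contMDiffAt

theorem contMDiffAt_planeCoords {g : SL(3, ℝ)} {u : Q5}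
    (h : hopf u ∈ (M4.affineChart g).source) :
    ContMDiffAt 𝓘(ℝ, R3 × R2) 𝓘(ℝ, R4 × (R2 →L[ℝ] R2)) ∞
      (fun u : Q5 => (M4.affineChart g (hopf u), hopfSlope (g⁻¹ • u).incl)) u :=
  (contMDiffAt_affineChart_hopf h).prodMk_space (contMDiffAt_hopfSlope h)

theorem contMDiff_twistorLift :
    ContMDiff 𝓘(ℝ, R3 × R2) 𝓘(ℝ, R4 × (R2 →L[ℝ] R2)) ∞ twistorLift := by
  intro u
  have h := hopf_mem_source_frame u
  refine contMDiffAt_of_eventuallyEq_symm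
    (planeChart_mem_atlas (M4.atlasChart (hopf u).frame) splitting)
    (contMDiffAt_planeCoords h) ((M4.affineChart _).map_source h) ?_
  filter_upwards [(isOpen_hopf_preimage_source (hopf u).frame).mem_nhds h] with w hw
  rw [Function.comp_apply, ← planeChart_twistorLift hw]
  exact ((planeChart _ splitting).left_inv (twistorLift_mem_source hw)).symm

/-! ### The local inverse -/

open Classical in
/-- The point `(λ𝐪, (λ s)⁻¹𝐩)` of `Q⁵` above the point with affine coordinates `x`, where `𝐪, 𝐩` are
the homogeneous coordinates and `s = 𝐩𝐪`. -/
noncomputable def ofAffine (x : R4) (t : ℝ) : Q5 :=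
  if h : t ≠ 0 ∧ affinePairing x ≠ 0 then
    ⟨t • M4.homogPoint x, (t * affinePairing x)⁻¹ • M4.homogLine x, by
      have h1 := h.1
      have h2 := h.2
      rw [smul_dotProduct, dotProduct_smul, homogLine_dotProduct_homogPoint, smul_eq_mul,
        smul_eq_mul]
      field_simp⟩
  else ⟨Pi.single 0 1, Pi.single 0 1, by simp⟩

theorem ofAffine_incl {x : R4} {t : ℝ} (ht : t ≠ 0) (hx : affinePairing x ≠ 0) :
    (ofAffine x t).incl = (t • M4.homogPoint x, (t * affinePairing x)⁻¹ • M4.homogLine x) := by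
  rw [ofAffine, dif_pos ⟨ht, hx⟩]
  rfl

theorem contDiff_affinePairing : ContDiff ℝ ∞ affinePairing := by
  unfold affinePairing
  exact (contDiff_const.add ((contDiff_apply ℝ ℝ 0).mul (contDiff_apply ℝ ℝ 2))).add
    ((contDiff_apply ℝ ℝ 1).mul (contDiff_apply ℝ ℝ 3))

theorem contMDiffAt_ofAffine {y : R4 × ℝ} (ht : y.2 ≠ 0) (hx : affinePairing y.1 ≠ 0) :
    ContMDiffAt 𝓘(ℝ, R4 × ℝ) 𝓘(ℝ, R3 × R2) ∞ (fun y : R4 × ℝ => ofAffine y.1 y.2) y := by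
  rw [Q5.contMDiffAt_iff]
  have hs : ContDiffAt ℝ ∞ (fun y : R4 × ℝ => affinePairing y.1) y :=
    (contDiff_affinePairing.comp contDiff_fst).contDiffAt
  have h1 : ContDiffAt ℝ ∞ (fun y : R4 × ℝ => (y.2 • M4.homogPoint y.1,
      (y.2 * affinePairing y.1)⁻¹ • M4.homogLine y.1)) y :=
    (contDiffAt_snd.smul (M4.contDiff_homogPoint.comp contDiff_fst).contDiffAt).prodMk
      (((contDiffAt_snd.mul hs).inv (mul_ne_zero ht hx)).smul
        (M4.contDiff_homogLine.comp contDiff_fst).contDiffAt)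
  refine h1.contMDiffAt.congr_of_eventuallyEq ?_
  filter_upwards [hs.continuousAt.eventually_ne hx, continuousAt_snd.eventually_ne ht] with z h2 h3
  exact ofAffine_incl h3 h2

/-- Twice the antisymmetric part of an endomorphism of `ℝ²`. -/
noncomputable def rotationPart : (R2 →L[ℝ] R2) →L[ℝ] ℝ :=
  (ContinuousLinearMap.proj (R := ℝ) (φ := fun _ : Fin 2 => ℝ) 1).comp
      (ContinuousLinearMap.apply ℝ R2 (Pi.single 0 1 : R2)) -
    (ContinuousLinearMap.proj (R := ℝ) (φ := fun _ : Fin 2 => ℝ) 0).comp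
      (ContinuousLinearMap.apply ℝ R2 (Pi.single 1 1 : R2))

theorem rotationPart_apply (φ : R2 →L[ℝ] R2) :
    rotationPart φ = φ (Pi.single 0 1) 1 - φ (Pi.single 1 1) 0 := rfl

/-- The cube of the scale of a point of `Q⁵`, as a function of the coordinates of the plane. -/
noncomputable def cubedScale (y : R4 × (R2 →L[ℝ] R2)) : ℝ :=
  rotationPart y.2 / ((1 + affinePairing y.1) * affinePairing y.1)

/-- The coordinates of planes for which the formula of the inverse makes sense. -/
def inverseDomain : Set (R4 × (R2 →L[ℝ] R2)) :=
  {y | affinePairing y.1 ≠ 0 ∧ 1 + affinePairing y.1 ≠ 0 ∧ rotationPart y.2 ≠ 0}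

theorem isOpen_inverseDomain : IsOpen inverseDomain := by
  have hs : Continuous fun y : R4 × (R2 →L[ℝ] R2) => affinePairing y.1 :=
    contDiff_affinePairing.continuous.comp continuous_fst
  exact (isOpen_ne_fun hs continuous_const).inter
    ((isOpen_ne_fun (continuous_const.add hs) continuous_const).inter
      (isOpen_ne_fun (rotationPart.continuous.comp continuous_snd) continuous_const))

theorem cubedScale_ne_zero {y : R4 × (R2 →L[ℝ] R2)} (hy : y ∈ inverseDomain) :
    cubedScale y ≠ 0 :=
  div_ne_zero hy.2.2 (mul_ne_zero hy.2.1 hy.1)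

theorem cbrt_ne_zero {x : ℝ} (hx : x ≠ 0) : cbrt x ≠ 0 := fun h =>
  hx (by rw [← cbrt_pow hx, h]; ring)

theorem contDiffAt_cubedScale {y : R4 × (R2 →L[ℝ] R2)} (hy : y ∈ inverseDomain) :
    ContDiffAt ℝ ∞ cubedScale y := by
  have hs : ContDiffAt ℝ ∞ (fun y : R4 × (R2 →L[ℝ] R2) => affinePairing y.1) y :=
    (contDiff_affinePairing.comp contDiff_fst).contDiffAt
  exact ((rotationPart.contDiff.comp contDiff_snd).contDiffAt).div
    ((contDiffAt_const.add hs).mul hs) (mul_ne_zero hy.2.1 hy.1)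

theorem affinePairing_coords {u : Q5} (hq : u.q 2 ≠ 0) (hp : u.p 2 ≠ 0) :
    affinePairing (M4.coords u.q u.p) = (u.q 2 * u.p 2)⁻¹ := by
  have h := u.pairing
  simp only [dotProduct, Fin.sum_univ_three] at h
  simp [affinePairing, M4.coords]
  field_simp
  linarith

/-- The antisymmetric combination contains `q₀p₀ + q₁p₁`, which `𝐩𝐪 = 1` replaces by `1 - q₂p₂`.
Only the third coordinates remain. -/
theorem rotationPart_hopfSlope {u : Q5} (hp : u.p 2 ≠ 0) :
    rotationPart (hopfSlope u.incl) = u.q 2 * (1 + u.q 2 * u.p 2) / u.p 2 ^ 2 := by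
  have h := u.pairing
  simp only [dotProduct, Fin.sum_univ_three] at h
  rw [rotationPart_apply, hopfSlope_apply, hopfSlope_apply]
  simp [slopeEntry, Q5.incl]
  field_simp
  linear_combination u.q 2 * h

/-- With `s = (q₂p₂)⁻¹`, dividing `q₂(1 + q₂p₂)/p₂²` by `(1 + s)s` yields `q₂³`. So `cubedScale`
recovers `q₂`, and with it the representatives `𝐪` and `𝐩`. -/
theorem ofAffine_coords {u : Q5} (hq : u.q 2 ≠ 0) (hp : u.p 2 ≠ 0)
    (h : (M4.coords u.q u.p, hopfSlope u.incl) ∈ inverseDomain) :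
    ofAffine (M4.coords u.q u.p) (cbrt (cubedScale (M4.coords u.q u.p, hopfSlope u.incl))) = u := by
  have h1 : cubedScale (M4.coords u.q u.p, hopfSlope u.incl) = u.q 2 ^ 3 := by
    have h2 := h.2.1
    simp only [cubedScale]
    simp only [affinePairing_coords hq hp, rotationPart_hopfSlope hp] at h2 ⊢
    have h3 : 1 + u.q 2 * u.p 2 ≠ 0 := by
      intro h3
      apply h2
      field_simp
      linarith
    have h4 : u.q 2 * u.p 2 + 1 ≠ 0 := by rwa [add_comm]
    field_simp
    ring
  rw [h1, cbrt_pow_three]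
  have h4 := ofAffine_incl hq h.1
  apply Q5.ext
  · refine (congrArg Prod.fst h4).trans ?_
    ext i
    fin_cases i <;> simp [M4.homogPoint, M4.coords] <;> field_simp
  · refine (congrArg Prod.snd h4).trans ?_
    simp only [affinePairing_coords hq hp]
    ext i
    fin_cases i <;> simp [M4.homogLine, M4.coords] <;> field_simp

theorem isDiffeoOnto_twistorLift : IsDiffeoOnto (E := R3 × R2) (F := R4 × (R2 →L[ℝ] R2))
    twistorLift nonPrincipalTwistorSpace := by
  refine ⟨contMDiff_twistorLift, bijOn_twistorLift, fun u => ?_⟩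
  set g := (hopf u).frame with hg
  set e := planeChart (M4.atlasChart g) splitting with he
  have hsrc : ∀ {w : Q5}, twistorLift w ∈ e.source → hopf w ∈ (M4.affineChart g).source :=
    fun h => h.1
  have hcoord : ∀ {w : Q5}, hopf w ∈ (M4.affineChart g).source → e (twistorLift w) =
      (M4.coords (g⁻¹ • w).q (g⁻¹ • w).p, hopfSlope (g⁻¹ • w).incl) := by
    intro w hw
    rw [he, planeChart_twistorLift hw, M4.affineChart_hopf]
  have hu := hopf_mem_source_frame u
  refine ⟨e.source ∩ e ⁻¹' inverseDomain, e.isOpen_inter_preimage isOpen_inverseDomain,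
    ⟨twistorLift_mem_source hu, ?_⟩,
    -- The formula makes sense on an open set of all planes, self-dual or not, as an extension of
    -- the inverse must.
    fun W => g • ofAffine (e W).1 (cbrt (cubedScale (e W))), ?_, ?_⟩
  · obtain ⟨t, ht, hq, hp⟩ := exists_frame_inv_smul u
    have hq' : (g⁻¹ • u).q 2 = t := by rw [hq]; rfl
    have hp' : (g⁻¹ • u).p 2 = t⁻¹ := by rw [hp]; rfl
    have hq0 : (g⁻¹ • u).q 2 ≠ 0 := by rw [hq']; exact ht
    have hp0 : (g⁻¹ • u).p 2 ≠ 0 := by rw [hp']; exact inv_ne_zero ht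
    show e (twistorLift u) ∈ inverseDomain
    rw [hcoord hu]
    refine ⟨?_, ?_, ?_⟩
    · rw [affinePairing_coords hq0 hp0]
      exact inv_ne_zero (mul_ne_zero hq0 hp0)
    -- At the origin `s = 1`, so `1 + s = 2`; the rotation part in the next item is `2t³`.
    · rw [affinePairing_coords hq0 hp0, hq', hp', mul_inv_cancel₀ ht]
      norm_num
    · rw [rotationPart_hopfSlope hp0, hq', hp', mul_inv_cancel₀ ht]
      simp [ht]
  · rintro W ⟨hW, hW'⟩
    refine ContMDiffAt.contMDiffWithinAt ?_
    have h1 : ContMDiffAt 𝓘(ℝ, R4 × (R2 →L[ℝ] R2)) 𝓘(ℝ, R4 × (R2 →L[ℝ] R2)) ∞ e W :=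
      contMDiffAt_of_mem_maximalAtlas (mem_maximalAtlas (planeChart_mem_atlas _ _)) hW
    have hc := cubedScale_ne_zero hW'
    have h2 : ContMDiffAt 𝓘(ℝ, R4 × (R2 →L[ℝ] R2)) 𝓘(ℝ, R4 × ℝ) ∞
        (fun y : R4 × (R2 →L[ℝ] R2) => (y.1, cbrt (cubedScale y))) (e W) :=
      (contDiffAt_fst.prodMk
        ((contDiffAt_cbrt hc).comp (e W) (contDiffAt_cubedScale hW'))).contMDiffAt
    have h3 := contMDiffAt_ofAffine (y := ((e W).1, cbrt (cubedScale (e W)))) (cbrt_ne_zero hc)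
      hW'.1
    exact (Q5.contMDiff_smul g).contMDiffAt.comp W
      (ContMDiffAt.comp (g := fun y : R4 × ℝ => ofAffine y.1 y.2) W h3 (h2.comp W h1))
  · rintro w ⟨hw, hw'⟩
    have hw1 := hsrc hw
    have hw2 := M4.mem_source_hopf.1 hw1
    change e (twistorLift w) ∈ inverseDomain at hw'
    rw [hcoord hw1] at hw'
    simp only [hcoord hw1]
    rw [ofAffine_coords hw2.1 hw2.2 hw', smul_inv_smul]

/-! ### The twistor distribution -/

/-- The first term of the numerator and the denominator involve only `q₂, p₂`, which are stationary;
the second term contains two factors that vanish at `z`. -/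
theorem fderiv_slopeEntry (c r : ℝ) {a b : Fin 3} {z w : R3 × R3}
    (hp : z.2 2 ≠ 0) (hza : z.1 a = 0) (hzb : z.2 b = 0) (hw1 : w.1 2 = 0) (hw2 : w.2 2 = 0) :
    fderiv ℝ (slopeEntry c r a b) z w = 0 := by
  have h1 : ∀ k, HasFDerivAt (fun y : R3 × R3 => y.1 k)
      ((ContinuousLinearMap.proj (R := ℝ) (φ := fun _ : Fin 3 => ℝ) k).comp
        (ContinuousLinearMap.fst ℝ R3 R3)) z := fun k => ContinuousLinearMap.hasFDerivAt
          ((ContinuousLinearMap.proj (R := ℝ) (φ := fun _ : Fin 3 => ℝ) k).comp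
        (ContinuousLinearMap.fst ℝ R3 R3))
  have h2 : ∀ k, HasFDerivAt (fun y : R3 × R3 => y.2 k)
      ((ContinuousLinearMap.proj (R := ℝ) (φ := fun _ : Fin 3 => ℝ) k).comp
        (ContinuousLinearMap.snd ℝ R3 R3)) z := fun k => ContinuousLinearMap.hasFDerivAt
          ((ContinuousLinearMap.proj (R := ℝ) (φ := fun _ : Fin 3 => ℝ) k).comp
        (ContinuousLinearMap.snd ℝ R3 R3))
  have h3 := hasFDerivAt_div (((((h1 2).mul (h1 2)).mul (h2 2)).const_mul c).add
    (((h1 2).mul ((h1 a).mul (h2 b))).const_mul r)) ((h2 2).pow 2) (pow_ne_zero 2 hp)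
  refine (congrArg (fun l : R3 × R3 →L[ℝ] ℝ => l w) h3.fderiv).trans ?_
  simp [hza, hzb, hw1, hw2]

theorem fderiv_hopfSlope {z w : R3 × R3} (hp : z.2 2 ≠ 0) (hz10 : z.1 0 = 0) (hz11 : z.1 1 = 0)
    (hz20 : z.2 0 = 0) (hz21 : z.2 1 = 0) (hw1 : w.1 2 = 0) (hw2 : w.2 2 = 0) :
    fderiv ℝ hopfSlope z w = 0 := by
  have hd := fun a b => ((contDiffAt_slopeMatrix hp a b).differentiableAt (by simp)).hasFDerivAt
  have h1 : ∀ a b, fderiv ℝ (fun z => slopeMatrix z a b) z w = 0 := by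
    intro a b
    fin_cases a <;> fin_cases b <;>
      exact fderiv_slopeEntry _ _ hp (by assumption) (by assumption) hw1 hw2
  have h2 : HasFDerivAt hopfSlope (∑ a, ∑ b, (fderiv ℝ (fun z => slopeMatrix z a b) z).smulRight
      ((ContinuousLinearMap.proj (R := ℝ) (φ := fun _ : Fin 2 => ℝ) b).smulRight
    (Pi.single a (1 : ℝ) : R2))) z := by
    unfold hopfSlope ofEntries
    exact HasFDerivAt.fun_sum fun a _ => HasFDerivAt.fun_sum fun b _ => (hd a b).smul_const
      ((ContinuousLinearMap.proj (R := ℝ) (φ := fun _ : Fin 2 => ℝ) b).smulRight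
        (Pi.single a (1 : ℝ) : R2))
  rw [h2.fderiv]
  simp [h1]

/-- In the frame of `Π(u)`, vectors of `𝒟` have `dq₂ = dp₂ = 0`: `(𝐪 × d𝐪)𝐪 = 0` reduces tangency to
`𝐩 d𝐪 = 0` with `𝐩` a multiple of `e₃`, and `𝐪 × d𝐪` has no third component as `𝐪` is a multiple of
`e₃`. -/
theorem tangentDeriv_hopfSlope {u : Q5} {ξ : R3 × R2} (hξ : ξ ∈ distribution u) :
    tangentDeriv (R3 × R2) (R2 →L[ℝ] R2)
      (fun w : Q5 => hopfSlope ((hopf u).frame⁻¹ • w).incl) u ξ = 0 := by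
  set g := (hopf u).frame
  obtain ⟨t, ht, hq, hp⟩ := exists_frame_inv_smul u
  have hp2 : (g⁻¹ • u).incl.2 2 ≠ 0 := by
    show (g⁻¹ • u).p 2 ≠ 0
    rw [hp]; exact inv_ne_zero ht
  have hd : MDifferentiableAt 𝓘(ℝ, R3 × R3) 𝓘(ℝ, R2 →L[ℝ] R2) hopfSlope (g⁻¹ • u).incl :=
    ((contDiffAt_hopfSlope hp2).differentiableAt (by simp)).mdifferentiableAt
  have h1 := tangentDeriv_comp (hd.comp _ (Q5.mdifferentiableAt_incl (g⁻¹ • u)))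
    ((Q5.contMDiff_smul g⁻¹).contMDiffAt.mdifferentiableAt (x := u) (by simp))
  change tangentDeriv (R3 × R2) (R2 →L[ℝ] R2) (fun w : Q5 => hopfSlope (g⁻¹ • w).incl) u = _ at h1
  rw [h1, Q5.tangentDeriv_comp_incl hd, ContinuousLinearMap.comp_apply,
    ContinuousLinearMap.comp_apply, Q5.tangentIncl_smul, tangentDeriv_eq_fderiv]
  have e1 : u.tangentIncl ξ = ((u.tangentIncl ξ).1, u.q ⨯₃ (u.tangentIncl ξ).1) :=
    Prod.ext rfl (mem_distribution.1 hξ)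
  have e2 := u.pairingDeriv_tangentIncl ξ
  rw [e1] at e2
  dsimp only at e2
  rw [dotProduct_comm, dot_self_cross, zero_add] at e2
  have e3 := linAct_pairing g⁻¹ u.incl (u.tangentIncl ξ)
  rw [linAct_incl] at e3
  change (g⁻¹ • u).p ⬝ᵥ _ = u.p ⬝ᵥ _ at e3
  rw [e2, hp] at e3
  apply fderiv_hopfSlope hp2
  · exact congrFun hq 0
  · exact congrFun hq 1
  · exact congrFun hp 0
  · exact congrFun hp 1
  · simpa [ht, dotProduct, Fin.sum_univ_three] using e3
  · rw [e1, linAct_cross, hq]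
    simp [cross_apply]

/-- In a change of the complement of a plane, the horizontal vectors stay horizontal. -/
theorem fderiv_planeChart_trans {M : Type*} [TopologicalSpace M] [ChartedSpace R4 M]
    [IsManifold 𝓘(ℝ, R4) ∞ M] (i : atlas R4 M) (L K : R4 ≃L[ℝ] R2 × R2)
    {y : R4 × (R2 →L[ℝ] R2)} (hy : y ∈ ((planeChart i L).symm.trans (planeChart i K)).source)
    (v : R4) : fderiv ℝ ((planeChart i L).symm.trans (planeChart i K)) y (v, 0) = (v, 0) := by
  set τ := (planeChart i L).symm.trans (planeChart i K) with hτ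
  have hd : DifferentiableAt ℝ τ y :=
    ((TwoPlane.contDiffOn_trans i i L K).contDiffAt (τ.open_source.mem_nhds hy)).differentiableAt
      (by simp)
  have h1 : HasFDerivAt (fun x : R4 => ((x, y.2) : R4 × (R2 →L[ℝ] R2)))
      ((ContinuousLinearMap.id ℝ R4).prod 0) y.1 :=
    (hasFDerivAt_id y.1).prodMk (hasFDerivAt_const y.2 y.1)
  have h2 := hd.hasFDerivAt.comp y.1 h1
  set σ : R2 →L[ℝ] R2 := (τ y).2
  -- Both charts use the same chart `i` of `M`, so no change of tangent components occurs and the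
  -- transition acts on the slope by a fractional linear map independent of `x`.
  have hblk : ∀ x ∈ i.1.target, TwoPlane.blk i i L K (x, y.2) =
      (K : R4 →L[ℝ] R2 × R2).comp ((L.symm : R2 × R2 →L[ℝ] R4).comp
        ((ContinuousLinearMap.id ℝ R2).prod y.2)) := by
    intro x hx
    ext1 a
    exact congrArg K (TwoPlane.change_self (i.1.map_target hx) _)
  have hτ' : ∀ z (hz : z ∈ τ.source), τ z = (i.1 (i.1.symm z.1),
      (ContinuousLinearMap.snd ℝ R2 R2).comp (TwoPlane.blk i i L K z) *
        Ring.inverse ((ContinuousLinearMap.fst ℝ R2 R2).comp (TwoPlane.blk i i L K z))) :=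
    fun z hz => TwoPlane.trans_apply (i := i) (j := i) (L := L) (K := K) hz
  have htgt : ∀ z ∈ τ.source, z.1 ∈ i.1.target := fun z hz => hz.1
  have h3 : (fun x => τ (x, y.2)) =ᶠ[𝓝 y.1] fun x => (x, σ) := by
    have hc : ContinuousAt (fun x : R4 => ((x, y.2) : R4 × (R2 →L[ℝ] R2))) y.1 :=
      h1.continuousAt
    filter_upwards [hc (τ.open_source.mem_nhds hy)] with x hx
    have hx1 : ((x, y.2) : R4 × (R2 →L[ℝ] R2)) ∈ τ.source := hx
    have e1 := hblk _ (htgt _ hx1)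
    have e2 := hblk _ (htgt _ hy)
    refine (hτ' _ hx1).trans (Prod.ext (i.1.right_inv (htgt _ hx1)) ?_)
    show _ = (τ y).2
    rw [hτ' _ hy, e1]
    change _ = (ContinuousLinearMap.snd ℝ R2 R2).comp (TwoPlane.blk i i L K (y.1, y.2)) *
        Ring.inverse ((ContinuousLinearMap.fst ℝ R2 R2).comp (TwoPlane.blk i i L K (y.1, y.2)))
    rw [e2]
  have h4 : HasFDerivAt (fun x => τ (x, y.2)) ((ContinuousLinearMap.id ℝ R4).prod 0) y.1 :=
    ((hasFDerivAt_id y.1).prodMk (hasFDerivAt_const σ y.1)).congr_of_eventuallyEq h3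
  exact congrArg (fun l : R4 →L[ℝ] R4 × (R2 →L[ℝ] R2) => l v) (h2.unique h4)

/-- The preferred chart at `ν(u)` uses the chosen isomorphism `frameAt`, whereas the slope is
explicit for `splitting`. There its derivative along `𝒟` is zero, and `fderiv_planeChart_trans`
carries `(v, 0)` unchanged to the preferred chart. -/
theorem tangentDeriv_twistorLift {u : Q5} {ξ : R3 × R2} (hξ : ξ ∈ distribution u) :
    tangentDeriv (R3 × R2) (R4 × (R2 →L[ℝ] R2)) twistorLift u ξ =
      (tangentDeriv (R3 × R2) R4 hopf u ξ, 0) := by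
  set g := (hopf u).frame with hg
  have hu := hopf_mem_source_frame u
  have hν := contMDiff_twistorLift.contMDiffAt.mdifferentiableAt (x := u) (by simp)
  rw [tangentDeriv_eq_chartAt_comp hν]
  set L := (twistorLift u).frameAt
  set i := M4.atlasChart g
  have hc : chartAt (R4 × (R2 →L[ℝ] R2)) (twistorLift u) = planeChart i L := rfl
  rw [hc]
  set e := planeChart i splitting
  set τ := e.symm.trans (planeChart i L) with hτ
  have hsrc : twistorLift u ∈ e.source := twistorLift_mem_source hu
  have hsrc' : twistorLift u ∈ (planeChart i L).source :=
    hc ▸ mem_chart_source (R4 × (R2 →L[ℝ] R2)) (twistorLift u)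
  have hy : e (twistorLift u) ∈ τ.source := by
    refine ⟨e.map_source hsrc, ?_⟩
    show e.symm (e (twistorLift u)) ∈ (planeChart i L).source
    rw [e.left_inv hsrc]
    exact hsrc'
  have hev : ∀ᶠ w in 𝓝 u, hopf w ∈ (M4.affineChart g).source :=
    (isOpen_hopf_preimage_source g).mem_nhds hu
  have h1 : (planeChart i L) ∘ twistorLift =ᶠ[𝓝 u] τ ∘
      fun w : Q5 => (M4.affineChart g (hopf w), hopfSlope (g⁻¹ • w).incl) := by
    filter_upwards [hev] with w hw
    have hw' : twistorLift w ∈ e.source := twistorLift_mem_source hw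
    show _ = planeChart i L (e.symm (M4.affineChart g (hopf w), hopfSlope (g⁻¹ • w).incl))
    rw [← planeChart_twistorLift hw, e.left_inv hw']
    rfl
  have hτd : DifferentiableAt ℝ τ (e (twistorLift u)) :=
    ((TwoPlane.contDiffOn_trans i i splitting L).contDiffAt
      (τ.open_source.mem_nhds hy)).differentiableAt (by simp)
  have hF := (contMDiffAt_planeCoords hu).mdifferentiableAt (by simp)
  have he : e (twistorLift u) = (M4.affineChart g (hopf u), hopfSlope (g⁻¹ • u).incl) :=
    planeChart_twistorLift hu
  rw [tangentDeriv_congr h1, tangentDeriv_comp (by rw [← he]; exact hτd.mdifferentiableAt) hF,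
    tangentDeriv_eq_fderiv, ← he, ContinuousLinearMap.comp_apply]
  have hprod : tangentDeriv (R3 × R2) (R4 × (R2 →L[ℝ] R2))
      (fun w : Q5 => (M4.affineChart g (hopf w), hopfSlope (g⁻¹ • w).incl)) u ξ =
      (tangentDeriv (R3 × R2) R4 (M4.affineChart g ∘ hopf) u ξ,
        tangentDeriv (R3 × R2) (R2 →L[ℝ] R2) (fun w : Q5 => hopfSlope (g⁻¹ • w).incl) u ξ) := by
    have d1 : MDifferentiableAt 𝓘(ℝ, R4 × (R2 →L[ℝ] R2)) 𝓘(ℝ, R4)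
        (ContinuousLinearMap.fst ℝ R4 (R2 →L[ℝ] R2))
        (M4.affineChart g (hopf u), hopfSlope (g⁻¹ • u).incl) :=
      (ContinuousLinearMap.differentiableAt _).mdifferentiableAt
    have d2 : MDifferentiableAt 𝓘(ℝ, R4 × (R2 →L[ℝ] R2)) 𝓘(ℝ, R2 →L[ℝ] R2)
        (ContinuousLinearMap.snd ℝ R4 (R2 →L[ℝ] R2))
        (M4.affineChart g (hopf u), hopfSlope (g⁻¹ • u).incl) :=
      (ContinuousLinearMap.differentiableAt _).mdifferentiableAt
    have c1 := tangentDeriv_comp (f := fun w : Q5 =>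
      (M4.affineChart g (hopf w), hopfSlope (g⁻¹ • w).incl)) d1 hF
    have c2 := tangentDeriv_comp (f := fun w : Q5 =>
      (M4.affineChart g (hopf w), hopfSlope (g⁻¹ • w).incl)) d2 hF
    rw [tangentDeriv_eq_fderiv, ContinuousLinearMap.fderiv] at c1 c2
    exact Prod.ext (congrArg (fun l : R3 × R2 →L[ℝ] R4 => l ξ) c1).symm
      (congrArg (fun l : R3 × R2 →L[ℝ] R2 →L[ℝ] R2 => l ξ) c2).symm
  rw [hprod, tangentDeriv_hopfSlope hξ, fderiv_planeChart_trans i splitting L hy,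
    tangentDeriv_eq_chartAt_comp (mdifferentiableAt_hopf u)]
  rfl

theorem christoffelMap_eq_zero (m : M4) (v w : R4) : christoffelMap dancingMetric m v w = 0 := by
  ext k
  simp [christoffelMap, chartAt_self, christoffel_zero]

/-- The connection vanishes at the origin of the preferred chart. -/
theorem mem_twistorDistribution {W : TwoPlane M4} {ξ : R4 × (R2 →L[ℝ] R2)} :
    ξ ∈ twistorDistribution dancingMetric W ↔ ξ.1 ∈ W.plane ∧ ξ.2 = 0 := by
  have h0 : ξ ∈ twistorDistribution dancingMetric W ↔ ξ.1 ∈ W.plane ∧ ∀ a : R2,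
    W.frameAt.symm (0, ξ.2 a) +
      christoffelMap dancingMetric W.pt ξ.1 (W.frameAt.symm (a, 0)) ∈ W.plane := Iff.rfl
  rw [h0]
  refine and_congr_right fun _ => ⟨fun h => ?_, fun h a => ?_⟩
  · ext1 a
    have h1 := h a
    rw [christoffelMap_eq_zero, add_zero] at h1
    -- `L` maps `W` onto `ℝ² × 0`, so `L⁻¹(0, ψ a) ∈ W` forces `ψ a = 0`.
    have h2 : (W.frameAt (W.frameAt.symm (0, ξ.2 a))) ∈
        LinearMap.graph ((0 : R2 →L[ℝ] R2) : R2 →ₗ[ℝ] R2) := by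
      rw [← W.map_frameAt]
      exact ⟨_, h1, rfl⟩
    rw [ContinuousLinearEquiv.apply_symm_apply] at h2
    exact h2
  · rw [christoffelMap_eq_zero, h, add_zero]
    have : W.frameAt.symm ((0 : R2), (0 : R2 →L[ℝ] R2) a) = 0 := W.frameAt.symm.map_zero
    rw [this]
    exact W.plane.zero_mem

theorem map_distribution_twistorLift (u : Q5) :
    (distribution u).map (tangentDeriv (R3 × R2) (R4 × (R2 →L[ℝ] R2)) twistorLift u :
      R3 × R2 →ₗ[ℝ] R4 × (R2 →L[ℝ] R2)) = twistorDistribution dancingMetric (twistorLift u) := by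
  ext ζ
  rw [mem_twistorDistribution]
  constructor
  · rintro ⟨ξ, hξ, rfl⟩
    change (tangentDeriv (R3 × R2) (R4 × (R2 →L[ℝ] R2)) twistorLift u ξ).1 ∈ _ ∧
      (tangentDeriv (R3 × R2) (R4 × (R2 →L[ℝ] R2)) twistorLift u ξ).2 = 0
    rw [tangentDeriv_twistorLift hξ]
    exact ⟨⟨ξ, hξ, rfl⟩, rfl⟩
  · rintro ⟨⟨ξ, hξ, h1⟩, h2⟩
    exact ⟨ξ, hξ, (tangentDeriv_twistorLift hξ).trans (Prod.ext h1 h2.symm)⟩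

end Dancing

/-! ### The theorem -/

theorem mainTheorem7 :
    ∃ ν : Q5 → TwoPlane M4,
      (∀ u : Q5, (ν u).pt = hopf u ∧
        (ν u).plane = (distribution u).map
          (tangentDeriv (R3 × R2) R4 hopf u : R3 × R2 →ₗ[ℝ] R4)) ∧
      (∀ u : Q5, IsNull dancingMetric (ν u) ∧ IsSelfDual dancingMetric orientationSign (ν u) ∧
        ¬ IsPrincipal dancingMetric (ν u)) ∧
      (∀ (g : SL(3, ℝ)) (u : Q5), (ν (g • u)).pt = g • (ν u).pt ∧
        (ν (g • u)).plane = (ν u).plane.map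
          (tangentDeriv R4 R4 (fun m : M4 => g • m) (ν u).pt : R4 →ₗ[ℝ] R4)) ∧
      IsDiffeoOnto (E := R3 × R2) (F := R4 × (R2 →L[ℝ] R2)) ν nonPrincipalTwistorSpace ∧
      (∀ u : Q5, (distribution u).map
          (tangentDeriv (R3 × R2) (R4 × (R2 →L[ℝ] R2)) ν u :
            R3 × R2 →ₗ[ℝ] R4 × (R2 →L[ℝ] R2)) =
        twistorDistribution dancingMetric (ν u)) :=
  ⟨twistorLift, fun _ => ⟨rfl, rfl⟩,
    fun u => ⟨isNull_twistorLift u, isSelfDual_twistorLift u, not_isPrincipal_twistorLift u⟩,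
    fun g u => ⟨hopf_smul g u, twistorLift_smul g u⟩, isDiffeoOnto_twistorLift,
    map_distribution_twistorLift⟩
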